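/- **Setting.** Groupoid compositions are written from left to right. A *double groupoid* $\mathcal T$ (a groupoid object in the category of groupoids) is given by sets $\mathcal P$ (points), $\mathcal H$ (horizontal arrows), $\mathcal V$ (vertical arrows), $\mathcal B$ (boxes) and four groupoids: $\mathcal H\rightrightarrows\mathcal P$ with source $l$ and target $r$; $\mathcal V\rightrightarrows\mathcal P$ with source $t$ and target $b$; the horizontal groupoid $\mathcal B\rightrightarrows\mathcal V$ with source $l$ (left side), target $r$ (right side) and composition $XY$; and the vertical groupoid $\mathcal B\rightrightarrows\mathcal H$ with source $t$ (top side), target $b$ (bottom side) and composition $\begin{smallmatrix}X\\Y\end{smallmatrix}$. The sides of a box match at its four corners, sides and identities are compatible with the compositions (the source, target, identity and composition maps of either groupoid structure on $\mathcal B$ are functorial for the other), and the interchange law holds. Write $\mathrm{id}\,x$ ($x\in\mathcal H$) for the identity of the vertical groupoid at $x$ and $\mathrm{id}\,g$ ($g\in\mathcal V$) for the identity of the horizontal groupoid at $g$; identify points with identity arrows, and $x\in\mathcal H$, $g\in\mathcal V$ with the boxes $\mathrm{id}\,x$, $\mathrm{id}\,g$. Put $\Theta_P=\mathrm{id}\,\mathrm{id}_P$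 for $P\in\mathcal P$. Let $A^h$, $A^v$ be the horizontal and vertical inverses of a box $A$, and $A^{-1}=(A^h)^v$. Assume that $\mathcal T$ is finite. Let $\ulcorner(A)$ (resp. $\urcorner(A)$, $\llcorner(A)$) be the number of boxes with the same left and top (resp. right and top, left and bottom) sides as $A$. Assume the *filling condition*: for all $g\in\mathcal V$, $x\in\mathcal H$ with $r(x)=t(g)$ there is at least one box with top side $x$ and right side $g$. The *core groupoids* over $\mathcal P$, both with identities $\Theta_P$, are - $\mathbf D=\{D\in\mathcal B: l(D),b(D)\in\mathcal P\}$, with source $s(D)=r(t(D))$, target $e(D)=l(t(D))$ and composition (defined when $e(D)=s(L)$) $D\diamond L=\begin{smallmatrix}\mathrm{id}\,t(L)&D\\ L&\mathrm{id}\,r(L)\end{smallmatrix}$; - $\mathbf E=\{E\in\mathcal B: r(E),t(E)\in\mathcal P\}$, with source $s(E)=l(b(E))$, target $e(E)=r(b(E))$ and composition (defined when $e(M)=s(E)$) $M\circ E=\begin{smallmatrix}\mathrm{id}\,l(E)&E\\ M&\mathrm{id}\,b(E)\end{smallmatrix}$. Let $\Bbbk$ be a field of characteristic zero and $\Bbbk\mathcal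 T$ the vector space with basis $\mathcal B$. For $D\in\mathbf D$ and $E\in\mathbf E$ put ${}_D\mathbf 1=\sum_{z\in\mathcal H,\ r(z)=e(D)}(\mathrm{id}\,z)D$ and $\mathbf 1_E=\sum_{x\in\mathcal H,\ l(x)=e(E)}E(\mathrm{id}\,x)$ (horizontal compositions). If $t(A)\in\mathcal P$ put $\phi(A)=\begin{smallmatrix}A^{-1}\\ \mathrm{id}\,r(A)\end{smallmatrix}\in\mathbf D$; if $b(A)\in\mathcal P$ put $\psi(A)=\begin{smallmatrix}\mathrm{id}\,l(A)\\ A^{-1}\end{smallmatrix}\in\mathbf E$. A *weak bialgebra* over $\Bbbk$ is a unital associative algebra $H$ with a coassociative counital coalgebra structure $(\Delta,\epsilon)$ such that $\Delta(ab)=\Delta(a)\Delta(b)$, $\Delta^{(2)}(1)=(\Delta(1)\otimes1)(1\otimes\Delta(1))=(1\otimes\Delta(1))(\Delta(1)\otimes1)$ and $\epsilon(abc)=\epsilon(ab_1)\epsilon(b_2c)=\epsilon(ab_2)\epsilon(b_1c)$ for all $a,b,c\in H$. Its source and target maps are $\epsilon_s(h)=(\mathrm{id}\otimes\epsilon)((1\otimes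 h)\Delta(1))$ and $\epsilon_t(h)=(\epsilon\otimes\mathrm{id})(\Delta(1)(h\otimes1))$; their images are the source and target subalgebras. It is a *weak Hopf algebra* if it has an antipode, i.e. a linear map $\mathcal S$ with $m(\mathrm{id}\otimes\mathcal S)\Delta=\epsilon_t$, $m(\mathcal S\otimes\mathrm{id})\Delta=\epsilon_s$ and $m^{(2)}(\mathcal S\otimes\mathrm{id}\otimes\mathcal S)\Delta^{(2)}=\mathcal S$. **Theorem.** Let $\mathcal T$ be a finite double groupoid satisfying the filling condition. Then $\Bbbk\mathcal T$ is a weak Hopf algebra with the multiplication $$A\cdot B=\begin{cases}\begin{smallmatrix}A\\B\end{smallmatrix}&\text{if } b(A)=t(B),\\0&\text{otherwise,}\end{cases}$$ the unit $\sum_{x\in\mathcal H}\mathrm{id}\,x$ and the comultiplication $$\Delta(A)=\sum_{XY=A}\frac1{\urcorner(Y)}\,X\otimes Y .$$ Its counit is given by $\epsilon(A)=\ulcorner(A)$ if $A\in\mathcal V$ (that is, $A=\mathrm{id}\,g$ for some $g\in\mathcal V$) and $\epsilon(A)=0$ otherwise. Its antipode is determined by $\mathcal S(A)=\dfrac{\ulcorner(A)}{\llcorner(A)}\,A^{-1}$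 for $A\in\mathcal B$. The source and target maps are given by $$\epsilon_s(A)=\begin{cases}{}_{\phi(A)}\mathbf 1&\text{if } t(A)\in\mathcal P,\\0&\text{otherwise,}\end{cases}\qquad \epsilon_t(A)=\begin{cases}\dfrac{\ulcorner(A)}{\llcorner(A)}\,\mathbf 1_{\psi(A)}&\text{if } b(A)\in\mathcal P,\\0&\text{otherwise.}\end{cases}$$ The source and target subalgebras are isomorphic, as algebras, to the groupoid algebras $\Bbbk\mathbf D$ and $(\Bbbk\mathbf E)^{\mathrm{op}}$, respectively. -/

import Mathlib

open scoped TensorProduct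

noncomputable section

/-! ### Groupoids, presented by a set of arrows over a set of objects -/

/-- A groupoid structure on a set `A` of arrows over a base `O`. Composition is written from left
to right: `comp f g` is defined when the target of `f` is the source of `g`. -/
structure GroupoidStr (A : Type*) (O : Type*) where
  src : A → O
  tgt : A → O
  idn : O → A
  comp : (f g : A) → tgt f = src g → A
  inv : A → A
  src_idn : ∀ p, src (idn p) = p
  tgt_idn : ∀ p, tgt (idn p) = p
  src_comp : ∀ f g h, src (comp f g h) = src f
  tgt_comp : ∀ f g h, tgt (comp f g h) = tgt g
  src_inv : ∀ f, src (inv f) = tgt f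
  tgt_inv : ∀ f, tgt (inv f) = src f
  id_comp : ∀ f, comp (idn (src f)) f (tgt_idn _) = f
  comp_id : ∀ f, comp f (idn (tgt f)) (src_idn _).symm = f
  assoc : ∀ f g k (h₁ : tgt f = src g) (h₂ : tgt g = src k),
    comp (comp f g h₁) k ((tgt_comp _ _ _).trans h₂) =
      comp f (comp g k h₂) (h₁.trans (src_comp _ _ _).symm)
  comp_inv : ∀ f, comp f (inv f) (src_inv f).symm = idn (src f)
  inv_comp : ∀ f, comp (inv f) f (tgt_inv f) = idn (tgt f)

namespace GroupoidStr

variable {A O : Type*} (G : GroupoidStr A O)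

/-- The arrow `f` is an identity, i.e. it belongs to the base under the usual identification. -/
def IsId (f : A) : Prop := ∃ p, f = G.idn p

theorem comp_congr {f f' g g' : A} (hf : f = f') (hg : g = g') (h : G.tgt f = G.src g)
    (h' : G.tgt f' = G.src g') : G.comp f g h = G.comp f' g' h' := by
  subst hf hg; rfl

theorem id_comp' {e f : A} (he : G.IsId e) (h : G.tgt e = G.src f) : G.comp e f h = f := by
  obtain ⟨p, rfl⟩ := he
  obtain rfl : p = G.src f := by rw [← h, G.tgt_idn]
  exact G.id_comp f

theorem comp_id' {e f : A} (he : G.IsId e) (h : G.tgt f = G.src e) : G.comp f e h = f := by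
  obtain ⟨p, rfl⟩ := he
  obtain rfl : p = G.tgt f := by rw [h, G.src_idn]
  exact G.comp_id f

theorem IsId.src_eq_tgt {G : GroupoidStr A O} {e : A} (he : G.IsId e) : G.src e = G.tgt e := by
  obtain ⟨p, rfl⟩ := he
  rw [G.src_idn, G.tgt_idn]

theorem IsId.eq_idn_src {G : GroupoidStr A O} {e : A} (he : G.IsId e) : e = G.idn (G.src e) := by
  obtain ⟨p, rfl⟩ := he
  rw [G.src_idn]

theorem IsId.eq_idn_tgt {G : GroupoidStr A O} {e : A} (he : G.IsId e) : e = G.idn (G.tgt e) := by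
  obtain ⟨p, rfl⟩ := he
  rw [G.tgt_idn]

theorem isId_idn (p : O) : G.IsId (G.idn p) := ⟨p, rfl⟩

theorem eq_inv {f g : A} (h : G.tgt f = G.src g) (hfg : G.IsId (G.comp f g h)) : g = G.inv f := by
  have h1 : G.comp (G.inv f) (G.comp f g h) ((G.tgt_inv f).trans (G.src_comp _ _ _).symm) = g := by
    rw [← G.assoc (G.inv f) f g (G.tgt_inv f) h]
    exact G.id_comp' ⟨_, G.inv_comp f⟩ _
  rw [← h1]
  exact G.comp_id' hfg _

theorem inv_idn (p : O) : G.inv (G.idn p) = G.idn p :=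
  (G.eq_inv (by rw [G.tgt_idn, G.src_idn])
    ⟨p, G.id_comp' (G.isId_idn p) _⟩).symm

theorem IsId.inv {G : GroupoidStr A O} {e : A} (he : G.IsId e) : G.IsId (G.inv e) := by
  obtain ⟨p, rfl⟩ := he
  exact ⟨p, G.inv_idn p⟩

/-- A category with arrows `A` and base `O` in which every arrow has a right inverse is a
groupoid. -/
def ofRightInv {A O : Type*} (src tgt : A → O) (idn : O → A)
    (comp : (f g : A) → tgt f = src g → A) (inv : A → A)
    (src_idn : ∀ p, src (idn p) = p)
    (tgt_idn : ∀ p, tgt (idn p) = p)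
    (src_comp : ∀ f g h, src (comp f g h) = src f)
    (tgt_comp : ∀ f g h, tgt (comp f g h) = tgt g)
    (src_inv : ∀ f, src (inv f) = tgt f)
    (tgt_inv : ∀ f, tgt (inv f) = src f)
    (id_comp : ∀ f, comp (idn (src f)) f (tgt_idn _) = f)
    (comp_id : ∀ f, comp f (idn (tgt f)) (src_idn _).symm = f)
    (assoc : ∀ f g k (h₁ : tgt f = src g) (h₂ : tgt g = src k),
      comp (comp f g h₁) k ((tgt_comp _ _ _).trans h₂) =
        comp f (comp g k h₂) (h₁.trans (src_comp _ _ _).symm))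
    (comp_inv : ∀ f, comp f (inv f) (src_inv f).symm = idn (src f)) :
    GroupoidStr A O where
  src := src
  tgt := tgt
  idn := idn
  comp := comp
  inv := inv
  src_idn := src_idn
  tgt_idn := tgt_idn
  src_comp := src_comp
  tgt_comp := tgt_comp
  src_inv := src_inv
  tgt_inv := tgt_inv
  id_comp := id_comp
  comp_id := comp_id
  assoc := assoc
  comp_inv := comp_inv
  inv_comp := by
    intro f
    have cid : ∀ (a : A) (p : O) (h : tgt a = src (idn p)), comp a (idn p) h = a := by
      intro a p h
      obtain rfl : tgt a = p := by rw [h, src_idn]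
      exact comp_id a
    have idc : ∀ (a : A) (p : O) (h : tgt (idn p) = src a), comp (idn p) a h = a := by
      intro a p h
      obtain rfl : src a = p := by rw [← h, tgt_idn]
      exact id_comp a
    have cc : ∀ (a b b' : A) (e : b = b') (h : tgt a = src b),
        comp a b h = comp a b' (e ▸ h) := by
      intro a b b' e h; subst e; rfl
    have cc' : ∀ (a a' b : A) (e : a = a') (h : tgt a = src b),
        comp a b h = comp a' b (e ▸ h) := by
      intro a b b' e h; subst e; rfl
    -- with `g` the right inverse of `f` and `k` that of `g`, first show `k = f`
    have hk : inv (inv f) = f := by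
      have h1 := assoc f (inv f) (inv (inv f)) (src_inv f).symm (src_inv _).symm
      rw [cc' _ _ _ (comp_inv f), idc, cc _ _ _ (comp_inv (inv f)), cid] at h1
      exact h1
    have h2 := comp_inv (inv f)
    rw [cc _ _ _ hk] at h2
    rw [h2, src_inv]

end GroupoidStr

/-! ### The groupoid algebra -/

/-- The groupoid algebra `kG`: the vector space with basis the arrows of `G`, in which the product
of two arrows is their composite if they are composable, and zero otherwise. -/
def GroupoidAlgebra (k : Type*) [Field k] {A O : Type*} (_G : GroupoidStr A O) := A →₀ k

namespace GroupoidAlgebra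

variable {k : Type*} [Field k] {A O : Type*} {G : GroupoidStr A O}

instance : AddCommGroup (GroupoidAlgebra k G) := inferInstanceAs (AddCommGroup (A →₀ k))
instance : Module k (GroupoidAlgebra k G) := inferInstanceAs (Module k (A →₀ k))

variable (k G) in
/-- The basis of the groupoid algebra given by the arrows. -/
def basis : Module.Basis A k (GroupoidAlgebra k G) := ⟨LinearEquiv.refl k (A →₀ k)⟩

variable (k G) in
/-- The arrow `a`, as an element of the groupoid algebra. -/
def of (a : A) : GroupoidAlgebra k G := basis k G a

open Classical in
/-- The bilinear multiplication, determined by its values on arrows. -/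
def mulMap : GroupoidAlgebra k G →ₗ[k] GroupoidAlgebra k G →ₗ[k] GroupoidAlgebra k G :=
  (basis k G).constr k fun a => (basis k G).constr k fun b =>
    if h : G.tgt a = G.src b then of k G (G.comp a b h) else 0

instance : Mul (GroupoidAlgebra k G) := ⟨fun x y => mulMap x y⟩
instance [Fintype O] : One (GroupoidAlgebra k G) := ⟨∑ p : O, of k G (G.idn p)⟩

theorem mul_def (x y : GroupoidAlgebra k G) : x * y = mulMap x y := rfl
theorem one_def [Fintype O] : (1 : GroupoidAlgebra k G) = ∑ p : O, of k G (G.idn p) := rfl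

open Classical in
theorem of_mul_of (a b : A) : of k G a * of k G b =
    if h : G.tgt a = G.src b then of k G (G.comp a b h) else 0 := by
  rw [mul_def, mulMap, of, Module.Basis.constr_basis, of, Module.Basis.constr_basis]

theorem of_mul_of_pos {a b : A} (h : G.tgt a = G.src b) :
    of k G a * of k G b = of k G (G.comp a b h) := by
  rw [of_mul_of, dif_pos h]

theorem of_mul_of_neg {a b : A} (h : ¬ G.tgt a = G.src b) :
    of k G a * of k G b = 0 := by
  rw [of_mul_of, dif_neg h]

theorem mul_zero' (x : GroupoidAlgebra k G) : x * (0 : GroupoidAlgebra k G) = 0 :=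
  map_zero (mulMap x)

theorem zero_mul' (x : GroupoidAlgebra k G) : (0 : GroupoidAlgebra k G) * x = 0 := by
  rw [mul_def, map_zero, LinearMap.zero_apply]

theorem mul_assoc' (x y z : GroupoidAlgebra k G) : x * y * z = x * (y * z) := by
  let L : GroupoidAlgebra k G →ₗ[k] GroupoidAlgebra k G →ₗ[k] GroupoidAlgebra k G →ₗ[k]
      GroupoidAlgebra k G := LinearMap.mk₂ k (fun x y => mulMap (mulMap x y))
        (by intros; simp) (by intros; simp) (by intros; simp) (by intros; simp)
  let R : GroupoidAlgebra k G →ₗ[k] GroupoidAlgebra k G →ₗ[k] GroupoidAlgebra k G →ₗ[k]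
      GroupoidAlgebra k G := LinearMap.mk₂ k (fun x y => mulMap x ∘ₗ mulMap y)
        (by intros; simp [LinearMap.add_comp]) (by intros; simp [LinearMap.smul_comp])
        (by intros; simp [LinearMap.comp_add]) (by intros; simp [LinearMap.comp_smul])
  have hLR : L = R := by
    refine (basis k G).ext fun a => (basis k G).ext fun b => (basis k G).ext fun c => ?_
    change (of k G a * of k G b) * of k G c = of k G a * (of k G b * of k G c)
    by_cases h₁ : G.tgt a = G.src b
    · rw [of_mul_of_pos h₁]
      by_cases h₂ : G.tgt b = G.src c
      · rw [of_mul_of_pos h₂, of_mul_of_pos ((G.tgt_comp _ _ _).trans h₂),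
          of_mul_of_pos (h₁.trans (G.src_comp _ _ _).symm), G.assoc]
      · rw [of_mul_of_neg h₂, of_mul_of_neg (by rwa [G.tgt_comp]), mul_zero']
    · rw [of_mul_of_neg h₁, zero_mul']
      by_cases h₂ : G.tgt b = G.src c
      · rw [of_mul_of_pos h₂, of_mul_of_neg (by rwa [G.src_comp])]
      · rw [of_mul_of_neg h₂, mul_zero']
  exact congrArg (fun F => F x y z) hLR

theorem one_mul' [Fintype O] (x : GroupoidAlgebra k G) : 1 * x = x := by
  have : mulMap (1 : GroupoidAlgebra k G) = LinearMap.id := by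
    refine (basis k G).ext fun b => ?_
    change mulMap (1 : GroupoidAlgebra k G) (of k G b) = of k G b
    rw [one_def, map_sum, LinearMap.sum_apply]
    change ∑ p : O, of k G (G.idn p) * of k G b = of k G b
    rw [Finset.sum_eq_single (G.src b)]
    · rw [of_mul_of_pos (G.tgt_idn _), G.id_comp]
    · intro p _ hp
      exact of_mul_of_neg (by rwa [G.tgt_idn])
    · intro h
      exact absurd (Finset.mem_univ _) h
  exact congrArg (fun F => F x) this

theorem mul_one' [Fintype O] (x : GroupoidAlgebra k G) : x * 1 = x := by
  have : mulMap.flip (1 : GroupoidAlgebra k G) = LinearMap.id := by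
    refine (basis k G).ext fun b => ?_
    change mulMap (of k G b) (1 : GroupoidAlgebra k G) = of k G b
    rw [one_def, map_sum]
    change ∑ p : O, of k G b * of k G (G.idn p) = of k G b
    rw [Finset.sum_eq_single (G.tgt b)]
    · rw [of_mul_of_pos (G.src_idn _).symm, G.comp_id]
    · intro p _ hp
      exact of_mul_of_neg (by rw [G.src_idn]; exact fun h => hp h.symm)
    · intro h
      exact absurd (Finset.mem_univ _) h
  exact congrArg (fun F => F x) this

instance [Fintype O] : Ring (GroupoidAlgebra k G) :=
  { (inferInstance : AddCommGroup (GroupoidAlgebra k G)),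
    (inferInstance : Mul (GroupoidAlgebra k G)),
    (inferInstance : One (GroupoidAlgebra k G)) with
    left_distrib := fun x y z => map_add (mulMap x) y z
    right_distrib := fun x y z => by simp only [mul_def, map_add, LinearMap.add_apply]
    zero_mul := zero_mul'
    mul_zero := mul_zero'
    mul_assoc := mul_assoc'
    one_mul := one_mul'
    mul_one := mul_one' }

instance [Fintype O] : Algebra k (GroupoidAlgebra k G) :=
  Algebra.ofModule
    (fun r x y => by simp only [mul_def, map_smul, LinearMap.smul_apply])
    (fun r x y => by simp only [mul_def, map_smul])

end GroupoidAlgebra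

/-! ### Weak bialgebras and weak Hopf algebras -/

open Coalgebra in
/-- A weak bialgebra over `k`: an associative unital algebra and a coassociative counital
coalgebra, such that `Δ` is multiplicative,
`Δ²(1) = (Δ(1) ⊗ 1)(1 ⊗ Δ(1)) = (1 ⊗ Δ(1))(Δ(1) ⊗ 1)`, and
`ε(abc) = ε(a b₁) ε(b₂ c) = ε(a b₂) ε(b₁ c)`. -/
class WeakBialgebra (k H : Type*) [Field k] [Ring H] [Algebra k H] extends Coalgebra k H where
  comul_mul : ∀ a b : H, comul (a * b) = comul a * comul b
  comul_one_left : comul.rTensor H (comul (1 : H)) =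
    (comul (1 : H) ⊗ₜ[k] (1 : H)) *
      (TensorProduct.assoc k H H H).symm ((1 : H) ⊗ₜ[k] comul (1 : H))
  comul_one_right : comul.rTensor H (comul (1 : H)) =
    (TensorProduct.assoc k H H H).symm ((1 : H) ⊗ₜ[k] comul (1 : H)) *
      (comul (1 : H) ⊗ₜ[k] (1 : H))
  counit_mul_left : ∀ a b c : H, counit (a * b * c) =
    LinearMap.mul' k k (TensorProduct.map (counit ∘ₗ LinearMap.mulLeft k a)
      (counit ∘ₗ LinearMap.mulRight k c) (comul b))
  counit_mul_right : ∀ a b c : H, counit (a * b * c) =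
    LinearMap.mul' k k (TensorProduct.map (counit ∘ₗ LinearMap.mulRight k c)
      (counit ∘ₗ LinearMap.mulLeft k a) (comul b))

section
open Coalgebra
variable (k H : Type*) [Field k] [Ring H] [Algebra k H] [WeakBialgebra k H]

/-- The source map `ε_s(h) = (id ⊗ ε)((1 ⊗ h) Δ(1))`. -/
def weakSource : H →ₗ[k] H where
  toFun h := TensorProduct.rid k H
    (counit.lTensor H (((1 : H) ⊗ₜ[k] h) * comul (R := k) (1 : H)))
  map_add' x y := by simp [TensorProduct.tmul_add, add_mul]
  map_smul' r x := by simp [TensorProduct.tmul_smul]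

/-- The target map `ε_t(h) = (ε ⊗ id)(Δ(1) (h ⊗ 1))`. -/
def weakTarget : H →ₗ[k] H where
  toFun h := TensorProduct.lid k H
    (counit.rTensor H (comul (R := k) (1 : H) * (h ⊗ₜ[k] (1 : H))))
  map_add' x y := by simp [TensorProduct.add_tmul, mul_add]
  map_smul' r x := by simp [← TensorProduct.smul_tmul']

end

open Coalgebra in
/-- A weak Hopf algebra (quantum groupoid): a weak bialgebra with an antipode `S`, i.e. a linear map
such that `m(id ⊗ S)Δ = ε_t`, `m(S ⊗ id)Δ = ε_s` and `m²(S ⊗ id ⊗ S)Δ² = S`. -/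
class WeakHopfAlgebra (k H : Type*) [Field k] [Ring H] [Algebra k H] extends
    WeakBialgebra k H where
  antipode : H →ₗ[k] H
  mul_id_antipode : ∀ h : H,
    LinearMap.mul' k H (antipode.lTensor H (comul h)) = weakTarget k H h
  mul_antipode_id : ∀ h : H,
    LinearMap.mul' k H (antipode.rTensor H (comul h)) = weakSource k H h
  mul_antipode_id_antipode : ∀ h : H,
    LinearMap.mul' k H ((LinearMap.mul' k H).rTensor H
      (TensorProduct.map (TensorProduct.map antipode LinearMap.id) antipode
        (comul.rTensor H (comul h)))) = antipode h

/-! ### Double groupoids -/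

/-- A double groupoid (a groupoid object in groupoids) in the form of four related groupoids.
`P` is the set of points, `H` the set of horizontal arrows (source `left`, target `right`), `V` the
set of vertical arrows (source `top`, target `bottom`) and `B` the set of boxes. Boxes compose
horizontally over `V` (`hor`, source the left side, target the right side) and vertically over `H`
(`ver`, source the top side, target the bottom side). -/
structure DoubleGroupoid (P H V B : Type*) where
  sideH : GroupoidStr H P
  sideV : GroupoidStr V P
  hor : GroupoidStr B V
  ver : GroupoidStr B H
  corner_tl : ∀ A, sideH.src (ver.src A) = sideV.src (hor.src A)
  corner_tr : ∀ A, sideH.tgt (ver.src A) = sideV.src (hor.tgt A)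
  corner_bl : ∀ A, sideH.src (ver.tgt A) = sideV.tgt (hor.src A)
  corner_br : ∀ A, sideH.tgt (ver.tgt A) = sideV.tgt (hor.tgt A)
  top_hor : ∀ X Y (h : hor.tgt X = hor.src Y), ver.src (hor.comp X Y h) =
    sideH.comp (ver.src X) (ver.src Y) (by rw [corner_tr, corner_tl, h])
  bot_hor : ∀ X Y (h : hor.tgt X = hor.src Y), ver.tgt (hor.comp X Y h) =
    sideH.comp (ver.tgt X) (ver.tgt Y) (by rw [corner_br, corner_bl, h])
  left_ver : ∀ X Y (h : ver.tgt X = ver.src Y), hor.src (ver.comp X Y h) =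
    sideV.comp (hor.src X) (hor.src Y) (by rw [← corner_bl, ← corner_tl, h])
  right_ver : ∀ X Y (h : ver.tgt X = ver.src Y), hor.tgt (ver.comp X Y h) =
    sideV.comp (hor.tgt X) (hor.tgt Y) (by rw [← corner_br, ← corner_tr, h])
  top_hor_idn : ∀ g, ver.src (hor.idn g) = sideH.idn (sideV.src g)
  bot_hor_idn : ∀ g, ver.tgt (hor.idn g) = sideH.idn (sideV.tgt g)
  left_ver_idn : ∀ x, hor.src (ver.idn x) = sideV.idn (sideH.src x)
  right_ver_idn : ∀ x, hor.tgt (ver.idn x) = sideV.idn (sideH.tgt x)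
  idn_idn : ∀ p, ver.idn (sideH.idn p) = hor.idn (sideV.idn p)
  hor_idn_comp : ∀ g g' (h : sideV.tgt g = sideV.src g'), hor.idn (sideV.comp g g' h) =
    ver.comp (hor.idn g) (hor.idn g') (by rw [bot_hor_idn, top_hor_idn, h])
  ver_idn_comp : ∀ x y (h : sideH.tgt x = sideH.src y), ver.idn (sideH.comp x y h) =
    hor.comp (ver.idn x) (ver.idn y) (by rw [right_ver_idn, left_ver_idn, h])
  interchange : ∀ X Y Z W (hXY : hor.tgt X = hor.src Y) (hZW : hor.tgt Z = hor.src W)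
    (hXZ : ver.tgt X = ver.src Z) (hYW : ver.tgt Y = ver.src W),
    ver.comp (hor.comp X Y hXY) (hor.comp Z W hZW) (by simp only [bot_hor, top_hor, hXZ, hYW]) =
      hor.comp (ver.comp X Z hXZ) (ver.comp Y W hYW) (by simp only [left_ver, right_ver, hXY, hZW])

namespace DoubleGroupoid

variable {P H V B : Type*} (T : DoubleGroupoid P H V B)

/-- The top side of a box. -/
abbrev top (A : B) : H := T.ver.src A
/-- The bottom side of a box. -/
abbrev bot (A : B) : H := T.ver.tgt A
/-- The left side of a box. -/
abbrev left (A : B) : V := T.hor.src A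
/-- The right side of a box. -/
abbrev right (A : B) : V := T.hor.tgt A

/-- The total inverse `A⁻¹ = (A^h)^v` of a box. -/
def boxInv (A : B) : B := T.ver.inv (T.hor.inv A)

theorem top_hor_inv (A : B) : T.top (T.hor.inv A) = T.sideH.inv (T.top A) := by
  refine T.sideH.eq_inv (by rw [T.corner_tr, T.corner_tl, T.hor.src_inv]) ?_
  rw [← T.top_hor A (T.hor.inv A) (T.hor.src_inv A).symm, T.hor.comp_inv, T.top_hor_idn]
  exact ⟨_, rfl⟩

theorem bot_hor_inv (A : B) : T.bot (T.hor.inv A) = T.sideH.inv (T.bot A) := by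
  refine T.sideH.eq_inv (by rw [T.corner_br, T.corner_bl, T.hor.src_inv]) ?_
  rw [← T.bot_hor A (T.hor.inv A) (T.hor.src_inv A).symm, T.hor.comp_inv, T.bot_hor_idn]
  exact ⟨_, rfl⟩

theorem left_ver_inv (A : B) : T.left (T.ver.inv A) = T.sideV.inv (T.left A) := by
  refine T.sideV.eq_inv (by rw [← T.corner_bl, ← T.corner_tl, T.ver.src_inv]) ?_
  rw [← T.left_ver A (T.ver.inv A) (T.ver.src_inv A).symm, T.ver.comp_inv, T.left_ver_idn]
  exact ⟨_, rfl⟩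

theorem right_ver_inv (A : B) : T.right (T.ver.inv A) = T.sideV.inv (T.right A) := by
  refine T.sideV.eq_inv (by rw [← T.corner_br, ← T.corner_tr, T.ver.src_inv]) ?_
  rw [← T.right_ver A (T.ver.inv A) (T.ver.src_inv A).symm, T.ver.comp_inv, T.right_ver_idn]
  exact ⟨_, rfl⟩

theorem top_boxInv (A : B) : T.top (T.boxInv A) = T.sideH.inv (T.bot A) := by
  rw [boxInv, top, T.ver.src_inv, ← T.bot_hor_inv]

theorem bot_boxInv (A : B) : T.bot (T.boxInv A) = T.sideH.inv (T.top A) := by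
  rw [boxInv, bot, T.ver.tgt_inv, ← T.top_hor_inv]

theorem left_boxInv (A : B) : T.left (T.boxInv A) = T.sideV.inv (T.right A) := by
  rw [boxInv, T.left_ver_inv, left, T.hor.src_inv]

theorem right_boxInv (A : B) : T.right (T.boxInv A) = T.sideV.inv (T.left A) := by
  rw [boxInv, T.right_ver_inv, right, T.hor.tgt_inv]

theorem hor_inv_idn (x : H) : T.hor.inv (T.ver.idn x) = T.ver.idn (T.sideH.inv x) := by
  refine (T.hor.eq_inv (by rw [T.right_ver_idn, T.left_ver_idn, T.sideH.src_inv]) ?_).symm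
  rw [← T.ver_idn_comp x (T.sideH.inv x) (T.sideH.src_inv x).symm, T.sideH.comp_inv, T.idn_idn]
  exact ⟨_, rfl⟩

/-! ### Core groupoids -/

/-- The set `D` of boxes whose left and bottom sides are identities. -/
abbrev CoreD : Type _ := {A : B // T.sideV.IsId (T.left A) ∧ T.sideH.IsId (T.bot A)}

/-- The set `E` of boxes whose right and top sides are identities. -/
abbrev CoreE : Type _ := {A : B // T.sideV.IsId (T.right A) ∧ T.sideH.IsId (T.top A)}

variable {T}

theorem left_eq_idn {A : B} (h : T.sideV.IsId (T.left A)) :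
    T.left A = T.sideV.idn (T.sideH.src (T.top A)) := by
  rw [T.corner_tl]; exact h.eq_idn_src

theorem bot_eq_idn {A : B} (h : T.sideV.IsId (T.left A)) (h' : T.sideH.IsId (T.bot A)) :
    T.bot A = T.sideH.idn (T.sideH.src (T.top A)) := by
  rw [T.corner_tl, h.src_eq_tgt, ← T.corner_bl]; exact h'.eq_idn_src

theorem right_eq_idn {A : B} (h : T.sideV.IsId (T.right A)) :
    T.right A = T.sideV.idn (T.sideH.tgt (T.bot A)) := by
  rw [T.corner_br]; exact h.eq_idn_tgt

theorem top_eq_idn {A : B} (h : T.sideV.IsId (T.right A)) (h' : T.sideH.IsId (T.top A)) :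
    T.top A = T.sideH.idn (T.sideH.tgt (T.bot A)) := by
  rw [T.corner_br, ← h.src_eq_tgt, ← T.corner_tr]; exact h'.eq_idn_tgt

theorem top_comp_of_isId_left {A C : B} (h : T.hor.tgt A = T.hor.src C)
    (hA : T.sideH.IsId (T.top A)) : T.top (T.hor.comp A C h) = T.top C := by
  rw [top, T.top_hor]; exact T.sideH.id_comp' hA _

theorem bot_comp_of_isId_right {A C : B} (h : T.hor.tgt A = T.hor.src C)
    (hC : T.sideH.IsId (T.bot C)) : T.bot (T.hor.comp A C h) = T.bot A := by
  rw [bot, T.bot_hor]; exact T.sideH.comp_id' hC _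

theorem top_comp_of_isId_right {A C : B} (h : T.hor.tgt A = T.hor.src C)
    (hC : T.sideH.IsId (T.top C)) : T.top (T.hor.comp A C h) = T.top A := by
  rw [top, T.top_hor]; exact T.sideH.comp_id' hC _

theorem bot_comp_of_isId_left {A C : B} (h : T.hor.tgt A = T.hor.src C)
    (hA : T.sideH.IsId (T.bot A)) : T.bot (T.hor.comp A C h) = T.bot C := by
  rw [bot, T.bot_hor]; exact T.sideH.id_comp' hA _

theorem isId_left_ver {A C : B} (h : T.ver.tgt A = T.ver.src C) (hA : T.sideV.IsId (T.left A))
    (hC : T.sideV.IsId (T.left C)) : T.sideV.IsId (T.left (T.ver.comp A C h)) := by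
  rw [left, T.left_ver, T.sideV.id_comp' hA]; exact hC

theorem isId_right_ver {A C : B} (h : T.ver.tgt A = T.ver.src C) (hA : T.sideV.IsId (T.right A))
    (hC : T.sideV.IsId (T.right C)) : T.sideV.IsId (T.right (T.ver.comp A C h)) := by
  rw [right, T.right_ver, T.sideV.id_comp' hA]; exact hC

theorem isId_left_idn (x : H) : T.sideV.IsId (T.left (T.ver.idn x)) := ⟨_, T.left_ver_idn x⟩
theorem isId_right_idn (x : H) : T.sideV.IsId (T.right (T.ver.idn x)) := ⟨_, T.right_ver_idn x⟩
theorem isId_top_idn (g : V) : T.sideH.IsId (T.top (T.hor.idn g)) := ⟨_, T.top_hor_idn g⟩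
theorem isId_bot_idn (g : V) : T.sideH.IsId (T.bot (T.hor.idn g)) := ⟨_, T.bot_hor_idn g⟩

variable (T) in
/-- The box `Θ_P`. -/
def Theta (p : P) : B := T.ver.idn (T.sideH.idn p)

theorem top_Theta (p : P) : T.top (T.Theta p) = T.sideH.idn p := T.ver.src_idn _
theorem bot_Theta (p : P) : T.bot (T.Theta p) = T.sideH.idn p := T.ver.tgt_idn _
theorem Theta_eq (p : P) : T.Theta p = T.hor.idn (T.sideV.idn p) := T.idn_idn p

theorem coreD_row {D : B} (hl : T.sideV.IsId (T.left D)) (x : H)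
    (h : T.sideH.tgt x = T.sideH.src (T.top D)) : T.right (T.ver.idn x) = T.left D := by
  rw [right, T.right_ver_idn, left_eq_idn hl, h]

theorem coreE_row {E : B} (hr : T.sideV.IsId (T.right E)) (x : H)
    (h : T.sideH.tgt (T.bot E) = T.sideH.src x) : T.right E = T.left (T.ver.idn x) := by
  rw [left, T.left_ver_idn, right_eq_idn hr, h]

namespace CoreD

/-- The composition `D ⋄ L`: the first row `idd t(L) | D` on top of the second row
`L | idd r(L)`. -/
def comp (D L : T.CoreD) (h : T.sideH.src (T.top D.1) = T.sideH.tgt (T.top L.1)) : T.CoreD :=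
  ⟨T.ver.comp
    (T.hor.comp (T.ver.idn (T.top L.1)) D.1 (coreD_row D.2.1 _ h.symm))
    (T.hor.comp L.1 (T.hor.idn (T.right L.1)) (T.hor.src_idn _).symm)
    (by
      have h1 := bot_comp_of_isId_right (coreD_row D.2.1 _ h.symm) D.2.2
      rw [T.hor.comp_id]
      exact h1.trans (T.ver.tgt_idn _)),
   by
    refine isId_left_ver _ ?_ ?_
    · rw [left, T.hor.src_comp]; exact isId_left_idn _
    · rw [left, T.hor.src_comp]; exact L.2.1,
   by
    rw [bot, T.ver.tgt_comp, T.hor.comp_id]; exact L.2.2⟩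

theorem comp_aux (D L : T.CoreD) (h : T.sideH.src (T.top D.1) = T.sideH.tgt (T.top L.1)) :
    T.ver.tgt (T.hor.comp (T.ver.idn (T.top L.1)) D.1 (coreD_row D.2.1 _ h.symm)) =
      T.ver.src L.1 :=
  (bot_comp_of_isId_right (coreD_row D.2.1 _ h.symm) D.2.2).trans (T.ver.tgt_idn _)

theorem comp_val (D L : T.CoreD) (h : T.sideH.src (T.top D.1) = T.sideH.tgt (T.top L.1)) :
    (comp D L h).1 = T.ver.comp
      (T.hor.comp (T.ver.idn (T.top L.1)) D.1 (coreD_row D.2.1 _ h.symm)) L.1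
      (comp_aux D L h) := by
  simp only [comp, T.hor.comp_id]

theorem top_comp (D L : T.CoreD) (h : T.sideH.src (T.top D.1) = T.sideH.tgt (T.top L.1)) :
    T.top (comp D L h).1 = T.sideH.comp (T.top L.1) (T.top D.1) h.symm := by
  rw [comp_val, top, T.ver.src_comp, T.top_hor]
  simp only [T.ver.src_idn]

/-- The identity `Θ_P`, as an element of `D`. -/
def one (p : P) : T.CoreD :=
  ⟨T.Theta p, isId_left_idn _, ⟨p, bot_Theta p⟩⟩

theorem inv_aux (D : T.CoreD) :
    T.right (T.ver.idn (T.sideH.inv (T.top D.1))) = T.left D.1 :=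
  coreD_row D.2.1 _ (T.sideH.tgt_inv _)

/-- The inverse `(idd t(D)⁻¹ | D)^v`. -/
def inv (D : T.CoreD) : T.CoreD :=
  ⟨T.ver.inv (T.hor.comp (T.ver.idn (T.sideH.inv (T.top D.1))) D.1 (inv_aux D)),
   by
    rw [left_ver_inv, left, T.hor.src_comp]
    exact (isId_left_idn _).inv,
   by
    rw [bot, T.ver.tgt_inv, T.top_hor]
    simp only [T.ver.src_idn, T.sideH.inv_comp]
    exact ⟨_, rfl⟩⟩

theorem top_inv (D : T.CoreD) : T.top (inv D).1 = T.sideH.inv (T.top D.1) := by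
  rw [inv, top, T.ver.src_inv]
  exact (bot_comp_of_isId_right (inv_aux D) D.2.2).trans (T.ver.tgt_idn _)

end CoreD

variable (T) in
/-- The core groupoid `D` over `P`, with source `s(D) = rt(D)`, target `e(D) = lt(D)`, identities
`Θ_P` and composition `⋄`. -/
def coreD : GroupoidStr T.CoreD P :=
  GroupoidStr.ofRightInv
    (fun D => T.sideH.tgt (T.top D.1)) (fun D => T.sideH.src (T.top D.1))
    CoreD.one CoreD.comp CoreD.inv
    (fun p => by rw [CoreD.one, top_Theta, T.sideH.tgt_idn])
    (fun p => by rw [CoreD.one, top_Theta, T.sideH.src_idn])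
    (fun D L h => by rw [CoreD.top_comp, T.sideH.tgt_comp])
    (fun D L h => by rw [CoreD.top_comp, T.sideH.src_comp])
    (fun D => by rw [CoreD.top_inv, T.sideH.tgt_inv])
    (fun D => by rw [CoreD.top_inv, T.sideH.src_inv])
    (fun D => by
      refine Subtype.ext ?_
      rw [CoreD.comp_val]
      refine T.ver.id_comp' ⟨T.top D.1, ?_⟩ _
      refine T.hor.comp_id' ⟨_, Theta_eq _⟩ _)
    (fun D => by
      refine Subtype.ext ?_
      rw [CoreD.comp_val]
      refine (T.ver.comp_id' ⟨_, rfl⟩ _).trans ?_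
      refine T.hor.id_comp' ⟨T.sideV.idn (T.sideH.src (T.top D.1)), ?_⟩ _
      rw [CoreD.one, top_Theta, T.idn_idn])
    (fun D L K h₁ h₂ => by
      refine Subtype.ext ?_
      have hr : T.hor.tgt (T.ver.idn (T.top K.1)) = T.hor.src L.1 := coreD_row L.2.1 _ h₂.symm
      have hLD : T.hor.tgt (T.ver.idn (T.top L.1)) = T.hor.src D.1 := coreD_row D.2.1 _ h₁.symm
      have hKL : T.hor.tgt (T.ver.idn (T.top K.1)) = T.hor.src (T.ver.idn (T.top L.1)) := by
        rw [T.right_ver_idn, T.left_ver_idn, h₂]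
      have hKD := hKL.trans (T.hor.src_comp _ _ hLD).symm
      have hKK : T.ver.tgt (T.ver.idn (T.top K.1)) = T.ver.src (T.ver.idn (T.top K.1)) := by
        rw [T.ver.tgt_idn, T.ver.src_idn]
      have hi := T.interchange _ _ _ _ hKD hr hKK (CoreD.comp_aux D L h₁)
      have e2 := (T.hor.comp_congr (T.ver.id_comp' ⟨_, rfl⟩ hKK).symm (CoreD.comp_val D L h₁)
        (coreD_row (CoreD.comp D L h₁).2.1 _ (by rw [CoreD.top_comp, T.sideH.src_comp, h₂]))
        (by rw [T.right_ver, T.left_ver]; exact T.sideV.comp_congr hKD hr _ _)).trans hi.symm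
      have hLK : T.ver.tgt (T.hor.comp _ _ hr) = T.ver.src K.1 := CoreD.comp_aux L K h₂
      refine (CoreD.comp_val (CoreD.comp D L h₁) K _).trans ?_
      refine Eq.trans ?_ (CoreD.comp_val D (CoreD.comp L K h₂) _).symm
      refine (T.ver.comp_congr e2 rfl _ ((T.ver.tgt_comp _ _ _).trans hLK)).trans ?_
      refine (T.ver.assoc _ _ _ _ hLK).trans ?_
      refine T.ver.comp_congr ?_ (CoreD.comp_val L K h₂).symm _ _
      refine (T.hor.assoc _ _ _ hKL hLD).symm.trans ?_
      refine T.hor.comp_congr ?_ rfl _ _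
      rw [← T.ver_idn_comp _ _ h₂.symm, CoreD.top_comp])
    (fun D => by
      refine Subtype.ext ?_
      rw [CoreD.comp_val]
      simp only [CoreD.top_inv]
      refine (T.ver.comp_inv _).trans ?_
      rw [T.top_hor]
      simp only [T.ver.src_idn, T.sideH.inv_comp]
      rfl)

namespace CoreE

/-- The composition `M ∘ E`: the first row `idd l(E) | E` on top of the second row
`M | idd b(E)`. -/
def comp (M E : T.CoreE) (h : T.sideH.tgt (T.bot M.1) = T.sideH.src (T.bot E.1)) : T.CoreE :=
  ⟨T.ver.comp
    (T.hor.comp (T.hor.idn (T.left E.1)) E.1 (T.hor.tgt_idn _))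
    (T.hor.comp M.1 (T.ver.idn (T.bot E.1)) (coreE_row M.2.1 _ h))
    (by
      have h1 := top_comp_of_isId_left (coreE_row M.2.1 _ h) M.2.2
      rw [T.hor.id_comp]
      exact (h1.trans (T.ver.src_idn _)).symm),
   by
    refine isId_right_ver _ ?_ ?_
    · rw [right, T.hor.tgt_comp]; exact E.2.1
    · rw [right, T.hor.tgt_comp]; exact isId_right_idn _,
   by
    rw [top, T.ver.src_comp, T.hor.id_comp]; exact E.2.2⟩

theorem comp_aux (M E : T.CoreE) (h : T.sideH.tgt (T.bot M.1) = T.sideH.src (T.bot E.1)) :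
    T.ver.tgt E.1 =
      T.ver.src (T.hor.comp M.1 (T.ver.idn (T.bot E.1)) (coreE_row M.2.1 _ h)) :=
  ((top_comp_of_isId_left (coreE_row M.2.1 _ h) M.2.2).trans (T.ver.src_idn _)).symm

theorem comp_val (M E : T.CoreE) (h : T.sideH.tgt (T.bot M.1) = T.sideH.src (T.bot E.1)) :
    (comp M E h).1 = T.ver.comp E.1
      (T.hor.comp M.1 (T.ver.idn (T.bot E.1)) (coreE_row M.2.1 _ h)) (comp_aux M E h) := by
  simp only [comp, T.hor.id_comp]

theorem bot_comp (M E : T.CoreE) (h : T.sideH.tgt (T.bot M.1) = T.sideH.src (T.bot E.1)) :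
    T.bot (comp M E h).1 = T.sideH.comp (T.bot M.1) (T.bot E.1) h := by
  rw [comp_val, bot, T.ver.tgt_comp, T.bot_hor]
  simp only [T.ver.tgt_idn]

/-- The identity `Θ_P`, as an element of `E`. -/
def one (p : P) : T.CoreE :=
  ⟨T.Theta p, isId_right_idn _, ⟨p, top_Theta p⟩⟩

theorem inv_aux (E : T.CoreE) :
    T.right E.1 = T.left (T.ver.idn (T.sideH.inv (T.bot E.1))) :=
  coreE_row E.2.1 _ (T.sideH.src_inv _).symm

/-- The inverse `(E | idd b(E)⁻¹)^v`. -/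
def inv (E : T.CoreE) : T.CoreE :=
  ⟨T.ver.inv (T.hor.comp E.1 (T.ver.idn (T.sideH.inv (T.bot E.1))) (inv_aux E)),
   by
    rw [right_ver_inv, right, T.hor.tgt_comp]
    exact (isId_right_idn _).inv,
   by
    rw [top, T.ver.src_inv, T.bot_hor]
    simp only [T.ver.tgt_idn, T.sideH.comp_inv]
    exact ⟨_, rfl⟩⟩

theorem bot_inv (E : T.CoreE) : T.bot (inv E).1 = T.sideH.inv (T.bot E.1) := by
  rw [inv, bot, T.ver.tgt_inv]
  exact (top_comp_of_isId_left (inv_aux E) E.2.2).trans (T.ver.src_idn _)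

end CoreE

variable (T) in
/-- The core groupoid `E` over `P`, with source `s(E) = bl(E)`, target `e(E) = br(E)`, identities
`Θ_P` and composition `∘`. -/
def coreE : GroupoidStr T.CoreE P :=
  GroupoidStr.ofRightInv
    (fun E => T.sideH.src (T.bot E.1)) (fun E => T.sideH.tgt (T.bot E.1))
    CoreE.one CoreE.comp CoreE.inv
    (fun p => by rw [CoreE.one, bot_Theta, T.sideH.src_idn])
    (fun p => by rw [CoreE.one, bot_Theta, T.sideH.tgt_idn])
    (fun D L h => by rw [CoreE.bot_comp, T.sideH.src_comp])
    (fun D L h => by rw [CoreE.bot_comp, T.sideH.tgt_comp])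
    (fun D => by rw [CoreE.bot_inv, T.sideH.src_inv])
    (fun D => by rw [CoreE.bot_inv, T.sideH.tgt_inv])
    (fun E => by
      refine Subtype.ext ?_
      rw [CoreE.comp_val]
      refine T.ver.comp_id' ⟨T.bot E.1, ?_⟩ _
      refine T.hor.id_comp' ⟨_, Theta_eq _⟩ _)
    (fun E => by
      refine Subtype.ext ?_
      rw [CoreE.comp_val]
      refine (T.ver.id_comp' ⟨_, rfl⟩ _).trans ?_
      refine T.hor.comp_id' ⟨T.sideV.idn (T.sideH.tgt (T.bot E.1)), ?_⟩ _
      rw [CoreE.one, bot_Theta, T.idn_idn])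
    (fun K M E h₁ h₂ => by
      refine Subtype.ext ?_
      have hr : T.hor.tgt M.1 = T.hor.src (T.ver.idn (T.bot E.1)) := coreE_row M.2.1 _ h₂
      have hKM : T.hor.tgt K.1 = T.hor.src (T.ver.idn (T.bot M.1)) := coreE_row K.2.1 _ h₁
      have hME : T.hor.tgt (T.ver.idn (T.bot M.1)) = T.hor.src (T.ver.idn (T.bot E.1)) := by
        rw [T.right_ver_idn, T.left_ver_idn, h₂]
      have hKE := (T.hor.tgt_comp _ _ hKM).trans hME
      have hEE : T.ver.tgt (T.ver.idn (T.bot E.1)) = T.ver.src (T.ver.idn (T.bot E.1)) := by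
        rw [T.ver.tgt_idn, T.ver.src_idn]
      have hi := T.interchange _ _ _ _ hr hKE (CoreE.comp_aux K M h₁) hEE
      have e2 := (T.hor.comp_congr (CoreE.comp_val K M h₁) (T.ver.id_comp' ⟨_, rfl⟩ hEE).symm
        (coreE_row (CoreE.comp K M h₁).2.1 _ (by rw [CoreE.bot_comp, T.sideH.tgt_comp, h₂]))
        (by rw [T.right_ver, T.left_ver]; exact T.sideV.comp_congr hr hKE _ _)).trans hi.symm
      have hEM : T.ver.tgt E.1 = T.ver.src (T.hor.comp _ _ hr) := CoreE.comp_aux M E h₂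
      refine (CoreE.comp_val (CoreE.comp K M h₁) E _).trans ?_
      refine Eq.trans ?_ (CoreE.comp_val K (CoreE.comp M E h₂) _).symm
      refine (T.ver.comp_congr rfl e2 _ (hEM.trans (T.ver.src_comp _ _ _).symm)).trans ?_
      refine (T.ver.assoc _ _ _ hEM _).symm.trans ?_
      refine T.ver.comp_congr (CoreE.comp_val M E h₂).symm ?_ _ _
      refine (T.hor.assoc _ _ _ hKM hME).trans ?_
      refine T.hor.comp_congr rfl ?_ _ _
      rw [← T.ver_idn_comp _ _ h₂, CoreE.bot_comp])
    (fun E => by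
      refine Subtype.ext ?_
      rw [CoreE.comp_val]
      simp only [CoreE.bot_inv]
      refine (T.ver.inv_comp _).trans ?_
      rw [T.bot_hor]
      simp only [T.ver.tgt_idn, T.sideH.comp_inv]
      rfl)

variable (T) in
/-- For a box `A` whose top side is an identity, `φ(A) ∈ D` is `A⁻¹` on top of `idd r(A)`. -/
def phi (A : B) (hA : T.sideH.IsId (T.top A)) : T.CoreD :=
  ⟨T.ver.comp (T.boxInv A) (T.hor.idn (T.right A))
    (by
      refine (T.bot_boxInv A).trans ?_
      rw [T.top_hor_idn, ← T.corner_tr, hA.inv.eq_idn_src, T.sideH.src_inv]),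
   by
    rw [left, T.left_ver]
    simp only [T.left_boxInv, T.hor.src_idn, T.sideV.inv_comp]
    exact ⟨_, rfl⟩,
   by
    rw [bot, T.ver.tgt_comp]; exact isId_bot_idn _⟩

variable (T) in
/-- For a box `A` whose bottom side is an identity, `ψ(A) ∈ E` is `idd l(A)` on top of `A⁻¹`. -/
def psi (A : B) (hA : T.sideH.IsId (T.bot A)) : T.CoreE :=
  ⟨T.ver.comp (T.hor.idn (T.left A)) (T.boxInv A)
    (by
      refine Eq.trans ?_ (T.top_boxInv A).symm
      rw [T.bot_hor_idn, ← T.corner_bl, hA.inv.eq_idn_tgt, T.sideH.tgt_inv]),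
   by
    rw [right, T.right_ver]
    simp only [T.right_boxInv, T.hor.tgt_idn, T.sideV.comp_inv]
    exact ⟨_, rfl⟩,
   by
    rw [top, T.ver.src_comp]; exact isId_top_idn _⟩

/-! ### Corner functions and the filling condition -/

variable (T)

/-- The number of boxes with left side `g` and top side `x`. -/
def cornerTL (g : V) (x : H) : ℕ := Nat.card {U : B // T.left U = g ∧ T.top U = x}
/-- The number of boxes with right side `g` and top side `x`. -/
def cornerTR (g : V) (x : H) : ℕ := Nat.card {U : B // T.right U = g ∧ T.top U = x}
/-- The number of boxes with left side `g` and bottom side `x`. -/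
def cornerBL (g : V) (x : H) : ℕ := Nat.card {U : B // T.left U = g ∧ T.bot U = x}

/-- The corner function `⌜(A)`. -/
def boxTL (A : B) : ℕ := T.cornerTL (T.left A) (T.top A)
/-- The corner function `⌝(A)`. -/
def boxTR (A : B) : ℕ := T.cornerTR (T.right A) (T.top A)
/-- The corner function `⌞(A)`. -/
def boxBL (A : B) : ℕ := T.cornerBL (T.left A) (T.bot A)

/-- The filling condition: `⌝(g, x) ≠ 0` for all `x ∈ H` and `g ∈ V` with `r(x) = t(g)`. -/
def Filling : Prop :=
  ∀ (g : V) (x : H), T.sideH.tgt x = T.sideV.src g → T.cornerTR g x ≠ 0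

/-! ### The algebra `kT` -/

/-- The algebra `kT` with basis the boxes: the groupoid algebra of the vertical groupoid. -/
abbrev Alg (k : Type*) [Field k] : Type _ := GroupoidAlgebra k T.ver

section
variable (k : Type*) [Field k]

/-- The box `A` as a basis element of `kT`. -/
abbrev ofBox (A : B) : T.Alg k := GroupoidAlgebra.of k T.ver A

open Classical in
/-- The comultiplication `Δ(A) = ∑ X ⊗ Y / ⌝(Y)`, the sum over all `(X, Y)` with `XY = A`. -/
def comul [Fintype B] : T.Alg k →ₗ[k] T.Alg k ⊗[k] T.Alg k :=
  (GroupoidAlgebra.basis k T.ver).constr k fun A =>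
    ∑ p ∈ (Finset.univ : Finset (B × B)).filter
        (fun p => ∃ h : T.right p.1 = T.left p.2, T.hor.comp p.1 p.2 h = A),
      ((1 : k) / (T.boxTR p.2 : k)) • (T.ofBox k p.1 ⊗ₜ[k] T.ofBox k p.2)

open Classical in
/-- The counit: `ε(A) = ⌜(A)` if `A` is an identity for the horizontal composition, else `0`. -/
def counit : T.Alg k →ₗ[k] k :=
  (GroupoidAlgebra.basis k T.ver).constr k fun A =>
    if T.hor.IsId A then (T.boxTL A : k) else 0

open Classical in
/-- The element `_D 1 = ∑ {idd z | D}`, the sum over `z ∈ H` with `r(z) = e(D)`. -/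
def oneD [Fintype H] (D : T.CoreD) : T.Alg k :=
  ∑ z : {z : H // T.sideH.tgt z = T.coreD.tgt D},
    T.ofBox k (T.hor.comp (T.ver.idn z.1) D.1 (coreD_row D.2.1 z.1 z.2))

open Classical in
/-- The element `1_E = ∑ {E | idd x}`, the sum over `x ∈ H` with `l(x) = e(E)`. -/
def oneE [Fintype H] (E : T.CoreE) : T.Alg k :=
  ∑ x : {x : H // T.sideH.src x = T.coreE.tgt E},
    T.ofBox k (T.hor.comp E.1 (T.ver.idn x.1) (coreE_row E.2.1 x.1 x.2.symm))

end

end DoubleGroupoid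

end

/-!
Write `bl`, `br`, `tr` for the corners of a box, `X \ A = X^h A` for the horizontal quotient of two
boxes with the same left side, and `θ(p)` for the number of boxes whose left and top sides are both
the identity of `p`.

The proof rests on one count. Two boxes with the same left and top sides differ by a box with
trivial left and top sides, attached at the bottom right vertex. Hence `⌜(A) = θ(br A)`, and by
reflection `⌝(A) = θ(bl A)` and `⌞(A) = θ(tr A)` (`cornerTL_eq_theta` and its corollaries). Since
`bl Y = br X` whenever `XY = A`, the comultiplication becomes a sum over the left factor alone,
`Δ(A) = ∑ θ(br X)⁻¹ X ⊗ (X \ A)`, over the boxes `X` with the same left side as `A`. The filling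
condition says that the weights `θ(br X)⁻¹` of the boxes with prescribed left and top sides add up
to one, and likewise for left and bottom sides with the weights `θ(tr X)⁻¹`
(`Filling.sum_left_top`, `Filling.sum_left_bot`).

With this, each axiom compares two sums over boxes by an explicit reparametrization.

* `Filling.comul_mul`: the pairs `(X, Z)` contributing to `Δ(A)Δ(C)` are replaced by `(X, U)`, with
  `U` the box `X` on top of `Z`. By interchange the term depends only on `U`, up to the weight of
  `X`, and these weights add up to one.
* `comul_rTensor_comul_one_eq_left` and `comul_rTensor_comul_one_eq_right`: in `Δ(1)` only left
  factors with trivial left side occur, and the parametrizations of the two sides differ by the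
  translation of such a box by a horizontal arrow.
* `counit_mul_left` and `counit_mul_right`: at most one factorization of the middle box contributes,
  and its weight cancels one of the two counits.
* The convolution products of the antipode with the identity are computed box by box and grouped by
  one side of the resulting box (`Filling.mul_id_antipode`, `Filling.mul_antipode_id`); they agree
  with the target and source maps, computed from `Δ(1)` in `target_ofBox` and `source_ofBox`.

The counit and the antipode are unique for a given comultiplication (`counit_unique`,
`antipode_unique`), so every structure with this `Δ` has the stated ones. Finally `D ↦ _D 1` and
`E ↦ 1_E` extend to injective algebra maps on `kD` and `(kE)ᵒᵖ` (`coreDHom`, `coreEHom`), and since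
every `D` is some `φ(A)` and every `E` is some `ψ(A)`, their images are the source and target
subalgebras.

The dependent compositions of a groupoid are replaced by the total operation `GroupoidStr.mul`, and
the equations of double groupoids are given to `grind`, which checks composability on the way.
-/

noncomputable section

/-! ### Total composition and calculus of boxes -/

namespace GroupoidStr
variable {A O : Type*} (G : GroupoidStr A O)

open Classical in
/-- Composition as a total operation; the value on a non-composable pair is irrelevant. -/
def mul (f g : A) : A := if h : G.tgt f = G.src g then G.comp f g h else f

variable {f g k : A}

theorem comp_eq_mul (h : G.tgt f = G.src g) : G.comp f g h = G.mul f g := (dif_pos h).symm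

theorem src_mul (h : G.tgt f = G.src g) : G.src (G.mul f g) = G.src f := by
  rw [← G.comp_eq_mul h, G.src_comp]

theorem tgt_mul (h : G.tgt f = G.src g) : G.tgt (G.mul f g) = G.tgt g := by
  rw [← G.comp_eq_mul h, G.tgt_comp]

theorem mul_assoc (h₁ : G.tgt f = G.src g) (h₂ : G.tgt g = G.src k) :
    G.mul (G.mul f g) k = G.mul f (G.mul g k) := by
  rw [← G.comp_eq_mul h₁, ← G.comp_eq_mul h₂, ← G.comp_eq_mul ((G.tgt_comp _ _ _).trans h₂),
    ← G.comp_eq_mul (h₁.trans (G.src_comp _ _ _).symm), G.assoc]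

theorem idn_mul {p : O} (h : p = G.src f) : G.mul (G.idn p) f = f := by
  have h' : G.tgt (G.idn p) = G.src f := by rw [G.tgt_idn, h]
  rw [← G.comp_eq_mul h']; exact G.id_comp' ⟨_, rfl⟩ _

theorem mul_idn {p : O} (h : G.tgt f = p) : G.mul f (G.idn p) = f := by
  have h' : G.tgt f = G.src (G.idn p) := by rw [G.src_idn, h]
  rw [← G.comp_eq_mul h']; exact G.comp_id' ⟨_, rfl⟩ _

theorem mul_inv (f : A) : G.mul f (G.inv f) = G.idn (G.src f) := by
  rw [← G.comp_eq_mul (G.src_inv f).symm, G.comp_inv]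

theorem inv_mul (f : A) : G.mul (G.inv f) f = G.idn (G.tgt f) := by
  rw [← G.comp_eq_mul (G.tgt_inv f), G.inv_comp]

theorem inv_inv (f : A) : G.inv (G.inv f) = f :=
  (G.eq_inv (G.tgt_inv f) ⟨_, G.inv_comp f⟩).symm

theorem mul_inv_mul (h : G.tgt f = G.src g) : G.mul (G.inv f) (G.mul f g) = g := by
  rw [← G.mul_assoc (G.tgt_inv f) h, G.inv_mul, G.idn_mul h]

theorem mul_mul_inv (h : G.src f = G.src g) : G.mul f (G.mul (G.inv f) g) = g := by
  rw [← G.mul_assoc (G.src_inv f).symm (by rw [G.tgt_inv, h]), G.mul_inv, G.idn_mul h]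

theorem mul_mul_inv_right (h : G.tgt f = G.src g) : G.mul (G.mul f g) (G.inv g) = f := by
  rw [G.mul_assoc h (G.src_inv g).symm, G.mul_inv, G.mul_idn h]

theorem mul_inv_mul_right (h : G.tgt f = G.tgt g) : G.mul (G.mul f (G.inv g)) g = f := by
  rw [G.mul_assoc (by rw [G.src_inv, h]) (G.tgt_inv g), G.inv_mul, G.mul_idn h]

theorem inv_mul_rev (h : G.tgt f = G.src g) :
    G.inv (G.mul f g) = G.mul (G.inv g) (G.inv f) := by
  have h' : G.tgt (G.inv g) = G.src (G.inv f) := by rw [G.tgt_inv, G.src_inv, h]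
  refine (G.eq_inv (by rw [G.tgt_mul h, G.src_mul h', G.src_inv]) ?_).symm
  rw [G.comp_eq_mul, G.mul_assoc h (by rw [G.src_mul h', G.src_inv]),
    ← G.mul_assoc (G.src_inv g).symm h', G.mul_inv, G.idn_mul (by rw [G.src_inv, h]), G.mul_inv]
  exact ⟨_, rfl⟩

theorem mul_left_cancel (h : G.tgt f = G.src g) (h' : G.tgt f = G.src k)
    (e : G.mul f g = G.mul f k) : g = k := by
  rw [← G.mul_inv_mul h, e, G.mul_inv_mul h']

theorem mul_right_cancel (h : G.tgt f = G.src k) (h' : G.tgt g = G.src k)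
    (e : G.mul f k = G.mul g k) : f = g := by
  rw [← G.mul_mul_inv_right h, e, G.mul_mul_inv_right h']

theorem eq_idn_of_mul_eq_right (h : G.tgt f = G.src g) (e : G.mul f g = g) :
    f = G.idn (G.src g) := by
  rw [← G.mul_mul_inv_right h, e, G.mul_inv]

theorem eq_idn_of_mul_eq_left (h : G.tgt f = G.src g) (e : G.mul f g = f) :
    g = G.idn (G.tgt f) := by
  rw [← G.mul_inv_mul h, e, G.inv_mul]

end GroupoidStr

namespace DoubleGroupoid
variable {P H V B : Type*} (T : DoubleGroupoid P H V B)

section calculus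
variable {X Y Z W : B} {x y : H} {g h : V}

theorem top_hmul (h : T.hor.tgt X = T.hor.src Y) :
    T.ver.src (T.hor.mul X Y) = T.sideH.mul (T.ver.src X) (T.ver.src Y) := by
  rw [← T.hor.comp_eq_mul h, T.top_hor, T.sideH.comp_eq_mul]

theorem bot_hmul (h : T.hor.tgt X = T.hor.src Y) :
    T.ver.tgt (T.hor.mul X Y) = T.sideH.mul (T.ver.tgt X) (T.ver.tgt Y) := by
  rw [← T.hor.comp_eq_mul h, T.bot_hor, T.sideH.comp_eq_mul]

theorem left_vmul (h : T.ver.tgt X = T.ver.src Y) :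
    T.hor.src (T.ver.mul X Y) = T.sideV.mul (T.hor.src X) (T.hor.src Y) := by
  rw [← T.ver.comp_eq_mul h, T.left_ver, T.sideV.comp_eq_mul]

theorem right_vmul (h : T.ver.tgt X = T.ver.src Y) :
    T.hor.tgt (T.ver.mul X Y) = T.sideV.mul (T.hor.tgt X) (T.hor.tgt Y) := by
  rw [← T.ver.comp_eq_mul h, T.right_ver, T.sideV.comp_eq_mul]

theorem hor_idn_mul (e : T.sideV.tgt g = T.sideV.src h) :
    T.hor.idn (T.sideV.mul g h) = T.ver.mul (T.hor.idn g) (T.hor.idn h) := by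
  rw [← T.sideV.comp_eq_mul e, T.hor_idn_comp, T.ver.comp_eq_mul]

theorem ver_idn_mul (h : T.sideH.tgt x = T.sideH.src y) :
    T.ver.idn (T.sideH.mul x y) = T.hor.mul (T.ver.idn x) (T.ver.idn y) := by
  rw [← T.sideH.comp_eq_mul h, T.ver_idn_comp, T.hor.comp_eq_mul]

theorem interchange_mul (hXY : T.hor.tgt X = T.hor.src Y) (hZW : T.hor.tgt Z = T.hor.src W)
    (hXZ : T.ver.tgt X = T.ver.src Z) (hYW : T.ver.tgt Y = T.ver.src W) :
    T.ver.mul (T.hor.mul X Y) (T.hor.mul Z W) = T.hor.mul (T.ver.mul X Z) (T.ver.mul Y W) := by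
  rw [← T.hor.comp_eq_mul hXY, ← T.hor.comp_eq_mul hZW, ← T.ver.comp_eq_mul hXZ,
    ← T.ver.comp_eq_mul hYW, ← T.hor.comp_eq_mul, ← T.interchange _ _ _ _ hXY hZW hXZ hYW,
    T.ver.comp_eq_mul]
  rw [T.right_ver, T.left_ver]
  exact T.sideV.comp_congr hXY hZW _ _

theorem top_hinv (X : B) : T.ver.src (T.hor.inv X) = T.sideH.inv (T.ver.src X) := T.top_hor_inv X
theorem bot_hinv (X : B) : T.ver.tgt (T.hor.inv X) = T.sideH.inv (T.ver.tgt X) := T.bot_hor_inv X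
theorem left_vinv (X : B) : T.hor.src (T.ver.inv X) = T.sideV.inv (T.hor.src X) := T.left_ver_inv X
theorem right_vinv (X : B) : T.hor.tgt (T.ver.inv X) = T.sideV.inv (T.hor.tgt X) :=
  T.right_ver_inv X

theorem ver_inv_idn (g : V) : T.ver.inv (T.hor.idn g) = T.hor.idn (T.sideV.inv g) := by
  refine (T.ver.eq_inv (by rw [T.bot_hor_idn, T.top_hor_idn, T.sideV.src_inv]) ?_).symm
  rw [← T.hor_idn_comp g (T.sideV.inv g) (T.sideV.src_inv g).symm, T.sideV.comp_inv, ← T.idn_idn]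
  exact ⟨_, rfl⟩

/-- The vertical inverse is functorial for horizontal composition. -/
theorem ver_inv_hmul (h : T.hor.tgt X = T.hor.src Y) :
    T.ver.inv (T.hor.mul X Y) = T.hor.mul (T.ver.inv X) (T.ver.inv Y) := by
  have h' : T.hor.tgt (T.ver.inv X) = T.hor.src (T.ver.inv Y) := by
    rw [T.right_vinv, T.left_vinv, h]
  have h'' : T.ver.tgt (T.hor.mul X Y) = T.ver.src (T.hor.mul (T.ver.inv X) (T.ver.inv Y)) := by
    rw [T.bot_hmul h, T.top_hmul h', T.ver.src_inv, T.ver.src_inv]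
  refine (T.ver.eq_inv h'' ?_).symm
  rw [T.ver.comp_eq_mul, T.interchange_mul h h' (T.ver.src_inv _).symm (T.ver.src_inv _).symm,
    T.ver.mul_inv, T.ver.mul_inv, ← T.ver_idn_mul (by rw [T.corner_tr, T.corner_tl, h])]
  exact ⟨_, rfl⟩

/-- The horizontal inverse is functorial for vertical composition. -/
theorem hor_inv_vmul (h : T.ver.tgt X = T.ver.src Y) :
    T.hor.inv (T.ver.mul X Y) = T.ver.mul (T.hor.inv X) (T.hor.inv Y) := by
  have h' : T.ver.tgt (T.hor.inv X) = T.ver.src (T.hor.inv Y) := by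
    rw [T.bot_hinv, T.top_hinv, h]
  have h'' : T.hor.tgt (T.ver.mul X Y) = T.hor.src (T.ver.mul (T.hor.inv X) (T.hor.inv Y)) := by
    rw [T.right_vmul h, T.left_vmul h', T.hor.src_inv, T.hor.src_inv]
  refine (T.hor.eq_inv h'' ?_).symm
  rw [T.hor.comp_eq_mul, ← T.interchange_mul (T.hor.src_inv _).symm (T.hor.src_inv _).symm h h',
    T.hor.mul_inv, T.hor.mul_inv, ← T.hor_idn_mul (by rw [← T.corner_bl, ← T.corner_tl, h])]
  exact ⟨_, rfl⟩

theorem hor_inv_ver_inv (X : B) : T.hor.inv (T.ver.inv X) = T.boxInv X := by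
  refine (T.hor.eq_inv ((T.right_ver_inv X).trans (T.left_boxInv X).symm) ?_).symm
  rw [T.hor.comp_eq_mul, boxInv, ← T.ver_inv_hmul (T.hor.src_inv X).symm, T.hor.mul_inv,
    T.ver_inv_idn]
  exact ⟨_, rfl⟩

theorem boxInv_boxInv (X : B) : T.boxInv (T.boxInv X) = X := by
  rw [← T.hor_inv_ver_inv (T.boxInv X), boxInv, T.ver.inv_inv, T.hor.inv_inv]

end calculus
end DoubleGroupoid

/-! ### Corner functions and structure maps on boxes -/

attribute [grind =] GroupoidStr.src_mul GroupoidStr.tgt_mul GroupoidStr.src_idn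
  GroupoidStr.tgt_idn GroupoidStr.src_inv GroupoidStr.tgt_inv GroupoidStr.mul_inv_mul
  GroupoidStr.mul_mul_inv GroupoidStr.mul_mul_inv_right GroupoidStr.mul_inv_mul_right
  GroupoidStr.mul_inv GroupoidStr.inv_mul GroupoidStr.mul_assoc GroupoidStr.inv_mul_rev
  GroupoidStr.inv_inv GroupoidStr.idn_mul GroupoidStr.mul_idn GroupoidStr.inv_idn

namespace DoubleGroupoid

-- Each corner of a box is reached along two sides; both descriptions are needed, since horizontal
-- compositions refer to the endpoints of left and right sides and vertical ones to those of top and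
-- bottom sides.
attribute [grind _=_] corner_tl corner_tr corner_bl corner_br

attribute [grind =] top_hmul bot_hmul left_vmul right_vmul
  top_hor_idn bot_hor_idn left_ver_idn right_ver_idn idn_idn top_hinv bot_hinv left_vinv right_vinv
  interchange_mul hor_inv_vmul ver_inv_hmul hor_inv_idn ver_inv_idn boxInv

variable {P H V B : Type*} (T : DoubleGroupoid P H V B)

/-- The number `θ(p)` of boxes whose left and top sides are the identities of `p`.
Reflecting such a box horizontally gives an arrow of the core groupoid `E` that ends at `p`, so
`θ(p)` is the number of these arrows. -/
def theta (p : P) : ℕ := T.cornerTL (T.sideV.idn p) (T.sideH.idn p)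

/-- The bottom right vertex of a box. -/
abbrev br (A : B) : P := T.sideH.tgt (T.ver.tgt A)

/-- Two boxes `A`, `X` with the same left and top sides differ by the box `(id b(A)⁻¹)(A^v X)`,
whose left and top sides are trivial. -/
theorem cornerTL_eq_theta (A : B) :
    T.cornerTL (T.hor.src A) (T.ver.src A) = T.theta (T.br A) := by
  refine Nat.card_congr
    { toFun := fun X => ⟨T.hor.mul (T.ver.idn (T.sideH.inv (T.ver.tgt A)))
        (T.ver.mul (T.ver.inv A) X.1), ?_⟩
      invFun := fun D => ⟨T.ver.mul A (T.hor.mul (T.ver.idn (T.ver.tgt A)) D.1), ?_⟩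
      left_inv := ?_
      right_inv := ?_ }
  · obtain ⟨X, h₁, h₂⟩ := X
    constructor <;> grind (ematch := 15) (gen := 15)
  · obtain ⟨D, h₁, h₂⟩ := D
    constructor <;> grind (ematch := 15) (gen := 15)
  · rintro ⟨X, h₁, h₂⟩
    have e : T.hor.mul (T.ver.idn (T.ver.tgt A)) (T.hor.mul
        (T.ver.idn (T.sideH.inv (T.ver.tgt A))) (T.ver.mul (T.ver.inv A) X)) =
        T.ver.mul (T.ver.inv A) X := by
      rw [← T.hor_inv_idn]
      grind (ematch := 15) (gen := 15)
    refine Subtype.ext ?_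
    simp only
    rw [e]
    grind
  · rintro ⟨D, h₁, h₂⟩
    refine Subtype.ext ?_
    simp only
    have e : T.ver.mul (T.ver.inv A) (T.ver.mul A (T.hor.mul (T.ver.idn (T.ver.tgt A)) D)) =
        T.hor.mul (T.ver.idn (T.ver.tgt A)) D := by
      grind (ematch := 15) (gen := 15)
    rw [e, ← T.hor_inv_idn]
    grind (ematch := 15) (gen := 15)

theorem cornerTR_eq_cornerTL (g : V) (x : H) :
    T.cornerTR g x = T.cornerTL g (T.sideH.inv x) := by
  refine Nat.card_congr
    { toFun := fun X => ⟨T.hor.inv X.1, ?_⟩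
      invFun := fun X => ⟨T.hor.inv X.1, ?_⟩
      left_inv := fun X => Subtype.ext (T.hor.inv_inv _)
      right_inv := fun X => Subtype.ext (T.hor.inv_inv _) }
  · obtain ⟨X, h₁, h₂⟩ := X
    constructor <;> grind
  · obtain ⟨X, h₁, h₂⟩ := X
    constructor <;> grind

theorem cornerBL_eq_cornerTL (g : V) (x : H) :
    T.cornerBL g x = T.cornerTL (T.sideV.inv g) x := by
  refine Nat.card_congr
    { toFun := fun X => ⟨T.ver.inv X.1, ?_⟩
      invFun := fun X => ⟨T.ver.inv X.1, ?_⟩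
      left_inv := fun X => Subtype.ext (T.ver.inv_inv _)
      right_inv := fun X => Subtype.ext (T.ver.inv_inv _) }
  · obtain ⟨X, h₁, h₂⟩ := X
    constructor <;> grind
  · obtain ⟨X, h₁, h₂⟩ := X
    constructor <;> grind

theorem boxTL_eq_theta (A : B) : T.boxTL A = T.theta (T.br A) := T.cornerTL_eq_theta A

theorem boxTR_eq_theta (A : B) : T.boxTR A = T.theta (T.sideH.src (T.ver.tgt A)) := by
  have := T.cornerTL_eq_theta (T.hor.inv A)
  rw [boxTR, cornerTR_eq_cornerTL]
  grind

theorem boxBL_eq_theta (A : B) : T.boxBL A = T.theta (T.sideH.tgt (T.ver.src A)) := by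
  have := T.cornerTL_eq_theta (T.ver.inv A)
  rw [boxBL, cornerBL_eq_cornerTL]
  grind

theorem theta_ne_zero [Finite B] (p : P) : T.theta p ≠ 0 := by
  have : Nonempty {U : B // T.left U = T.sideV.idn p ∧ T.top U = T.sideH.idn p} :=
    ⟨T.Theta p, by rw [Theta, T.idn_idn]; exact T.hor.src_idn _, T.top_Theta p⟩
  exact Nat.card_pos.ne'

variable {T} in
/-- Under the filling condition every pair consisting of a left and a top side is completed by a
box. -/
theorem Filling.exists_left_top (hT : T.Filling) {g : V} {x : H}
    (h : T.sideH.src x = T.sideV.src g) : ∃ X, T.hor.src X = g ∧ T.ver.src X = x := by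
  have h1 := hT g (T.sideH.inv x) (by rw [T.sideH.tgt_inv, h])
  rw [cornerTR_eq_cornerTL, T.sideH.inv_inv] at h1
  obtain ⟨X, hX⟩ := (Nat.card_ne_zero.1 h1).1
  exact ⟨X, hX⟩

section weights
variable (k : Type*) [Field k] [CharZero k] [Fintype B]

theorem cast_theta_ne_zero (p : P) : (T.theta p : k) ≠ 0 := Nat.cast_ne_zero.2 (T.theta_ne_zero p)

open Classical in
variable {T} in
/-- The weights `1/θ(br X)` of all boxes with given left and top sides add up to one. -/
theorem Filling.sum_left_top (hT : T.Filling) {g : V} {x : H}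
    (h : T.sideH.src x = T.sideV.src g) :
    ∑ X ∈ (Finset.univ : Finset B).filter (fun X => T.hor.src X = g ∧ T.ver.src X = x),
      ((T.theta (T.br X) : k))⁻¹ = 1 := by
  obtain ⟨A, rfl, rfl⟩ := hT.exists_left_top h
  have hA := T.cornerTL_eq_theta A
  rw [Finset.sum_congr rfl (g := fun _ => (T.theta (T.br A) : k)⁻¹), Finset.sum_const, nsmul_eq_mul,
    ← Fintype.card_subtype, ← Nat.card_eq_fintype_card]
  · rw [cornerTL] at hA
    rw [hA, mul_inv_cancel₀ (T.cast_theta_ne_zero k _)]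
  · intro X hX
    rw [Finset.mem_filter] at hX
    rw [← hA, ← T.cornerTL_eq_theta, hX.2.1, hX.2.2]

open Classical in
variable {T} in
/-- The weights `1/θ(tr X)` of all boxes with given left and bottom sides add up to one. -/
theorem Filling.sum_left_bot (hT : T.Filling) {g : V} {x : H}
    (h : T.sideH.src x = T.sideV.tgt g) :
    ∑ X ∈ (Finset.univ : Finset B).filter (fun X => T.hor.src X = g ∧ T.ver.tgt X = x),
      ((T.theta (T.sideH.tgt (T.ver.src X)) : k))⁻¹ = 1 := by
  rw [← hT.sum_left_top k (g := T.sideV.inv g) (x := x) (by rw [h, T.sideV.src_inv])]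
  refine Finset.sum_nbij' T.ver.inv T.ver.inv ?_ ?_ ?_ ?_ ?_
  all_goals simp only [Finset.mem_filter, Finset.mem_univ, true_and]
  all_goals grind

end weights

section structureMaps
variable {k : Type*} [Field k]

theorem ofBox_mul_ofBox {A C : B} (h : T.ver.tgt A = T.ver.src C) :
    T.ofBox k A * T.ofBox k C = T.ofBox k (T.ver.mul A C) := by
  rw [GroupoidAlgebra.of_mul_of_pos h, T.ver.comp_eq_mul]

theorem ofBox_mul_ofBox_eq_zero {A C : B} (h : T.ver.tgt A ≠ T.ver.src C) :
    T.ofBox k A * T.ofBox k C = 0 := GroupoidAlgebra.of_mul_of_neg h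

open Classical in
/-- A factorization `A = XY` is determined by `X`, and its weight `1/⌝(Y)` is `1/θ(br X)`, as the
bottom left vertex of `Y` is the bottom right vertex of `X`. -/
theorem comul_ofBox [Fintype B] (A : B) : T.comul k (T.ofBox k A) =
    ∑ X ∈ (Finset.univ : Finset B).filter (fun X => T.hor.src X = T.hor.src A),
      (T.theta (T.br X) : k)⁻¹ • (T.ofBox k X ⊗ₜ[k] T.ofBox k (T.hor.mul (T.hor.inv X) A)) := by
  rw [comul, ofBox, GroupoidAlgebra.of, Module.Basis.constr_basis]
  refine Finset.sum_nbij' Prod.fst (fun X => (X, T.hor.mul (T.hor.inv X) A)) ?_ ?_ ?_ ?_ ?_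
  all_goals simp only [Finset.mem_filter, Finset.mem_univ, true_and, Prod.forall]
  · rintro X Y ⟨h, rfl⟩
    exact (T.hor.src_comp _ _ _).symm
  · intro X h
    have h' : T.hor.tgt X = T.hor.src (T.hor.mul (T.hor.inv X) A) := by grind
    exact ⟨h', by rw [T.hor.comp_eq_mul]; grind⟩
  · rintro X Y ⟨h, rfl⟩
    rw [T.hor.comp_eq_mul h, T.hor.mul_inv_mul h]
  · intros; trivial
  · rintro X Y ⟨h, rfl⟩
    rw [T.hor.comp_eq_mul h, T.hor.mul_inv_mul h, T.boxTR_eq_theta, one_div, br, T.corner_br,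
      T.corner_bl, show T.hor.tgt X = T.hor.src Y from h]

open Classical in
theorem counit_ofBox (A : B) : T.counit k (T.ofBox k A) =
    if T.hor.IsId A then (T.theta (T.br A) : k) else 0 := by
  rw [counit, ofBox, GroupoidAlgebra.of, Module.Basis.constr_basis, T.boxTL_eq_theta]

/-- The antipode of `kT`. -/
def antipode : T.Alg k →ₗ[k] T.Alg k :=
  (GroupoidAlgebra.basis k T.ver).constr k fun A =>
    ((T.boxTL A : k) / (T.boxBL A : k)) • T.ofBox k (T.boxInv A)

theorem antipode_ofBox (A : B) : T.antipode (T.ofBox k A) =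
    ((T.boxTL A : k) / (T.boxBL A : k)) • T.ofBox k (T.boxInv A) := by
  rw [antipode, ofBox, GroupoidAlgebra.of, Module.Basis.constr_basis]

theorem antipode_ofBox_eq_theta (A : B) : T.antipode (T.ofBox k A) =
    ((T.theta (T.br A) : k) / (T.theta (T.sideH.tgt (T.ver.src A)) : k)) •
      T.ofBox k (T.boxInv A) := by
  rw [antipode_ofBox, boxTL_eq_theta, boxBL_eq_theta]

theorem ext_ofBox {M : Type*} [AddCommMonoid M] [Module k M] {f g : T.Alg k →ₗ[k] M}
    (h : ∀ A, f (T.ofBox k A) = g (T.ofBox k A)) : f = g :=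
  (GroupoidAlgebra.basis k T.ver).ext h

end structureMaps
end DoubleGroupoid

/-! ### Coalgebra structure and multiplicativity of the comultiplication -/

namespace DoubleGroupoid
variable {P H V B : Type*} (T : DoubleGroupoid P H V B)

section coalgebra
variable {k : Type*} [Field k] [Fintype B]

open Classical in
theorem comul_coassoc (a : T.Alg k) :
    TensorProduct.assoc k _ _ _ ((T.comul k).rTensor _ (T.comul k a)) =
      (T.comul k).lTensor _ (T.comul k a) := by
  suffices h : (TensorProduct.assoc k _ _ _).toLinearMap ∘ₗ (T.comul k).rTensor _ ∘ₗ T.comul k =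
      (T.comul k).lTensor _ ∘ₗ T.comul k from LinearMap.congr_fun h a
  refine T.ext_ofBox fun A => ?_
  simp only [LinearMap.comp_apply, comul_ofBox, map_sum, map_smul, LinearMap.rTensor_tmul,
    LinearMap.lTensor_tmul, TensorProduct.sum_tmul, TensorProduct.tmul_sum, LinearEquiv.coe_coe,
    ← TensorProduct.smul_tmul', TensorProduct.assoc_tmul, Finset.smul_sum, TensorProduct.tmul_smul,
    smul_smul]
  -- replace `U = XY` by `(X, Y)`
  rw [Finset.sum_comm' (t' := Finset.univ.filter fun X => T.hor.src X = T.hor.src A)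
    (s' := fun _ => Finset.univ.filter fun U => T.hor.src U = T.hor.src A)
    (by simp only [Finset.mem_filter, Finset.mem_univ, true_and]; intro U X; grind)]
  refine Finset.sum_congr rfl fun X hX => ?_
  rw [Finset.mem_filter] at hX
  have hX := hX.2
  refine Finset.sum_nbij' (fun U => T.hor.mul (T.hor.inv X) U) (fun Y => T.hor.mul X Y)
    ?_ ?_ ?_ ?_ ?_
  all_goals simp only [Finset.mem_filter, Finset.mem_univ, true_and]
  · intro U hU; grind
  · intro U hU; grind
  · intro U hU; grind
  · intro U hU; grind
  · intro U hU
    have h1 : T.br (T.hor.mul (T.hor.inv X) U) = T.br U := by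
      simp only [br]; grind
    have h2 : T.hor.mul (T.hor.inv (T.hor.mul (T.hor.inv X) U)) (T.hor.mul (T.hor.inv X) A) =
        T.hor.mul (T.hor.inv U) A := by grind
    rw [h1, h2, mul_comm]

variable [CharZero k]

open Classical in
theorem counit_rTensor (a : T.Alg k) :
    (T.counit k).rTensor _ (T.comul k a) = 1 ⊗ₜ[k] a := by
  suffices h : (T.counit k).rTensor _ ∘ₗ T.comul k = TensorProduct.mk k _ _ 1 from
    LinearMap.congr_fun h a
  refine T.ext_ofBox fun A => ?_
  simp only [LinearMap.comp_apply, comul_ofBox, map_sum, map_smul, LinearMap.rTensor_tmul,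
    counit_ofBox, TensorProduct.mk_apply]
  rw [Finset.sum_eq_single (T.hor.idn (T.hor.src A))]
  · have h : T.hor.mul (T.hor.inv (T.hor.idn (T.hor.src A))) A = A := by grind
    rw [if_pos ⟨_, rfl⟩, h, TensorProduct.smul_tmul', smul_eq_mul,
      inv_mul_cancel₀ (T.cast_theta_ne_zero k _)]
  · intro X hX hne
    rw [Finset.mem_filter] at hX
    rw [if_neg, TensorProduct.zero_tmul, smul_zero]
    rintro ⟨g, rfl⟩
    rw [T.hor.src_idn] at hX
    exact hne (by rw [hX.2])
  · exact fun h => absurd (by rw [Finset.mem_filter, T.hor.src_idn]; simp) h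

open Classical in
theorem counit_lTensor (a : T.Alg k) :
    (T.counit k).lTensor _ (T.comul k a) = a ⊗ₜ[k] 1 := by
  suffices h : (T.counit k).lTensor _ ∘ₗ T.comul k = (TensorProduct.mk k _ _).flip 1 from
    LinearMap.congr_fun h a
  refine T.ext_ofBox fun A => ?_
  simp only [LinearMap.comp_apply, comul_ofBox, map_sum, map_smul, LinearMap.lTensor_tmul,
    counit_ofBox, TensorProduct.mk_apply, LinearMap.flip_apply]
  rw [Finset.sum_eq_single A]
  · have h : T.hor.mul (T.hor.inv A) A = T.hor.idn (T.hor.tgt A) := by grind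
    have h' : T.br (T.hor.idn (T.hor.tgt A)) = T.br A := by simp only [br]; grind
    rw [h, if_pos ⟨_, rfl⟩, h', ← TensorProduct.tmul_smul, smul_eq_mul,
      inv_mul_cancel₀ (T.cast_theta_ne_zero k _)]
  · intro X hX hne
    rw [Finset.mem_filter] at hX
    rw [if_neg, TensorProduct.tmul_zero, smul_zero]
    rintro ⟨g, hg⟩
    have : T.hor.mul X (T.hor.mul (T.hor.inv X) A) = A := by grind
    refine hne ?_
    rw [hg] at this
    grind
  · exact fun h => absurd (by simp) h

variable {T} in
open Classical in
/-- The comultiplication is multiplicative. The filling condition enters as follows: for a left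
factor `U` of `A` on top of `C`, the boxes `X` with the left side of `A` and the top side of `U` are
the possible upper parts of `U`, and their weights add up to one. -/
theorem Filling.comul_mul [Fintype H] (hT : T.Filling) (a b : T.Alg k) :
    T.comul k (a * b) = T.comul k a * T.comul k b := by
  suffices h : (LinearMap.mul k (T.Alg k)).compr₂ (T.comul k) =
      (LinearMap.mul k _).compl₁₂ (T.comul k) (T.comul k) from
    LinearMap.congr_fun₂ h a b
  refine T.ext_ofBox fun A => T.ext_ofBox fun C => ?_
  simp only [LinearMap.compr₂_apply, LinearMap.compl₁₂_apply, LinearMap.mul_apply',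
    T.comul_ofBox A, T.comul_ofBox C, Finset.sum_mul_sum, smul_mul_smul_comm,
    Algebra.TensorProduct.tmul_mul_tmul]
  by_cases hAC : T.ver.tgt A = T.ver.src C
  · rw [T.ofBox_mul_ofBox hAC, comul_ofBox]
    -- replace `Z` by `U = X` on top of `Z`
    have key : ∀ X ∈ (Finset.univ : Finset B).filter (fun X => T.hor.src X = T.hor.src A),
        ∑ Z ∈ (Finset.univ : Finset B).filter (fun X => T.hor.src X = T.hor.src C),
          ((T.theta (T.br X) : k)⁻¹ * (T.theta (T.br Z) : k)⁻¹) •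
            ((T.ofBox k X * T.ofBox k Z) ⊗ₜ[k] (T.ofBox k (T.hor.mul (T.hor.inv X) A) *
              T.ofBox k (T.hor.mul (T.hor.inv Z) C))) =
        ∑ U ∈ (Finset.univ : Finset B).filter (fun U => T.hor.src U = T.hor.src (T.ver.mul A C) ∧
            T.ver.src X = T.ver.src U),
          ((T.theta (T.br X) : k)⁻¹ * (T.theta (T.br U) : k)⁻¹) •
            (T.ofBox k U ⊗ₜ[k] T.ofBox k (T.hor.mul (T.hor.inv U) (T.ver.mul A C))) := by
      intro X hX
      have hX := (Finset.mem_filter.1 hX).2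
      rw [← Finset.sum_filter_of_ne (p := fun Z => T.ver.tgt X = T.ver.src Z)]
      · refine Finset.sum_nbij' (fun Z => T.ver.mul X Z) (fun U => T.ver.mul (T.ver.inv X) U)
          ?_ ?_ ?_ ?_ ?_
        all_goals simp only [Finset.mem_filter, Finset.mem_univ, true_and, and_imp]
        · intro Z h1 h2; grind
        · intro Z h1 h2; grind
        · intro Z h1 h2; grind
        · intro Z h1 h2; grind
        · intro Z h1 h2
          have h3 : T.ver.tgt (T.hor.mul (T.hor.inv X) A) =
            T.ver.src (T.hor.mul (T.hor.inv Z) C) := by grind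
          have h4 : T.ver.mul (T.hor.mul (T.hor.inv X) A) (T.hor.mul (T.hor.inv Z) C) =
            T.hor.mul (T.hor.inv (T.ver.mul X Z)) (T.ver.mul A C) := by grind
          rw [T.ofBox_mul_ofBox h2, T.ofBox_mul_ofBox h3, h4, br, br, br, T.ver.tgt_mul h2]
      · intro Z _ hne
        by_contra h
        rw [T.ofBox_mul_ofBox_eq_zero h, TensorProduct.zero_tmul, smul_zero] at hne
        exact hne rfl
    rw [Finset.sum_congr rfl key, Finset.sum_comm' (t' := Finset.univ.filter fun U =>
        T.hor.src U = T.hor.src (T.ver.mul A C))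
      (s' := fun U => Finset.univ.filter fun X => T.hor.src X = T.hor.src A ∧
        T.ver.src X = T.ver.src U)
      (by simp only [Finset.mem_filter, Finset.mem_univ, true_and]; intro U X; tauto)]
    refine Finset.sum_congr rfl fun U hU => ?_
    have hU := (Finset.mem_filter.1 hU).2
    rw [← Finset.sum_smul, ← Finset.sum_mul, hT.sum_left_top k (by grind), one_mul]
  · rw [T.ofBox_mul_ofBox_eq_zero hAC, map_zero]
    refine (Finset.sum_eq_zero fun X hX => Finset.sum_eq_zero fun Z hZ => ?_).symm
    have hX := (Finset.mem_filter.1 hX).2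
    have hZ := (Finset.mem_filter.1 hZ).2
    by_cases h1 : T.ver.tgt X = T.ver.src Z
    · by_cases h2 : T.ver.tgt (T.hor.mul (T.hor.inv X) A) = T.ver.src (T.hor.mul (T.hor.inv Z) C)
      · refine absurd ?_ hAC
        have h3 : T.hor.mul X (T.hor.mul (T.hor.inv X) A) = A := by grind
        have h4 : T.hor.mul Z (T.hor.mul (T.hor.inv Z) C) = C := by grind
        rw [← h3, ← h4]
        grind
      · rw [T.ofBox_mul_ofBox_eq_zero h2, TensorProduct.tmul_zero, smul_zero]
    · rw [T.ofBox_mul_ofBox_eq_zero h1, TensorProduct.zero_tmul, smul_zero]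

end coalgebra
end DoubleGroupoid

/-! ### The comultiplication of the unit -/

section tensor
variable {k A ι κ : Type*} [Field k] [Ring A] [Algebra k A]

theorem sum_tmul_one_mul_one_tmul_sum (s : Finset ι) (t : Finset κ) (c : ι → k) (d : κ → k)
    (a b : ι → A) (a' b' : κ → A) :
    ((∑ i ∈ s, c i • (a i ⊗ₜ[k] b i)) ⊗ₜ[k] (1 : A)) *
      (TensorProduct.assoc k A A A).symm ((1 : A) ⊗ₜ[k] ∑ j ∈ t, d j • (a' j ⊗ₜ[k] b' j)) =
    ∑ q ∈ s ×ˢ t, (c q.1 * d q.2) • ((a q.1 ⊗ₜ[k] (b q.1 * a' q.2)) ⊗ₜ[k] b' q.2) := by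
  simp only [TensorProduct.sum_tmul, TensorProduct.tmul_sum, map_sum, Finset.sum_mul_sum,
    ← TensorProduct.smul_tmul', TensorProduct.tmul_smul, map_smul, TensorProduct.assoc_symm_tmul,
    smul_mul_smul_comm, Algebra.TensorProduct.tmul_mul_tmul, mul_one, one_mul, Finset.sum_product]

theorem one_tmul_sum_mul_sum_tmul_one (s : Finset ι) (t : Finset κ) (c : ι → k) (d : κ → k)
    (a b : ι → A) (a' b' : κ → A) :
    (TensorProduct.assoc k A A A).symm ((1 : A) ⊗ₜ[k] ∑ j ∈ t, d j • (a' j ⊗ₜ[k] b' j)) *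
      ((∑ i ∈ s, c i • (a i ⊗ₜ[k] b i)) ⊗ₜ[k] (1 : A)) =
    ∑ q ∈ s ×ˢ t, (c q.1 * d q.2) • ((a q.1 ⊗ₜ[k] (a' q.2 * b q.1)) ⊗ₜ[k] b' q.2) := by
  simp only [TensorProduct.sum_tmul, TensorProduct.tmul_sum, map_sum, Finset.sum_mul_sum,
    ← TensorProduct.smul_tmul', TensorProduct.tmul_smul, map_smul, TensorProduct.assoc_symm_tmul,
    smul_mul_smul_comm, Algebra.TensorProduct.tmul_mul_tmul, mul_one, one_mul, Finset.sum_product]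
  rw [Finset.sum_comm]
  simp only [mul_comm]

end tensor

namespace DoubleGroupoid
variable {P H V B : Type*} (T : DoubleGroupoid P H V B)

section unit
variable {k : Type*} [Field k] [Fintype H]

theorem one_eq_sum : (1 : T.Alg k) = ∑ x : H, T.ofBox k (T.ver.idn x) :=
  GroupoidAlgebra.one_def

variable [Fintype B]

open Classical in
/-- `Δ(1)`, as a sum over pairs of a horizontal arrow `x` and a box `X` with trivial left side
starting at the same vertex as `x`. -/
theorem comul_one : T.comul k 1 =
    ∑ p ∈ (Finset.univ : Finset (H × B)).filter
        (fun p => T.hor.src p.2 = T.sideV.idn (T.sideH.src p.1)),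
      (T.theta (T.br p.2) : k)⁻¹ • (T.ofBox k p.2 ⊗ₜ[k]
        T.ofBox k (T.hor.mul (T.hor.inv p.2) (T.ver.idn p.1))) := by
  rw [one_eq_sum, map_sum, ← Finset.univ_product_univ, Finset.sum_filter, Finset.sum_product]
  refine Finset.sum_congr rfl fun x _ => ?_
  rw [comul_ofBox, ← Finset.sum_filter, T.left_ver_idn]

open Classical in
/-- `(Δ ⊗ id)Δ(1)`, as a sum over triples of a horizontal arrow `x` and two boxes with trivial left
sides at the source of `x`: the triple `((x, U), X)` stands for the factorization of `id x` into
`X`, `X^h U` and `U^h (id x)`. -/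
theorem comul_rTensor_comul_one :
    (T.comul k).rTensor (T.Alg k) (T.comul k 1) =
    ∑ q ∈ (Finset.univ : Finset ((H × B) × B)).filter (fun q =>
        T.hor.src q.1.2 = T.sideV.idn (T.sideH.src q.1.1) ∧
          T.hor.src q.2 = T.sideV.idn (T.sideH.src q.1.1)),
      ((T.theta (T.br q.2) : k)⁻¹ * (T.theta (T.br q.1.2) : k)⁻¹) •
        ((T.ofBox k q.2 ⊗ₜ[k] T.ofBox k (T.hor.mul (T.hor.inv q.2) q.1.2)) ⊗ₜ[k]
          T.ofBox k (T.hor.mul (T.hor.inv q.1.2) (T.ver.idn q.1.1))) := by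
  rw [comul_one, map_sum, Finset.sum_filter, Finset.sum_filter,
    Fintype.sum_prod_type (α₁ := H × B)]
  refine Fintype.sum_congr _ _ fun p => ?_
  by_cases h : T.hor.src p.2 = T.sideV.idn (T.sideH.src p.1)
  · simp only [h, if_true, true_and, map_smul, LinearMap.rTensor_tmul, comul_ofBox,
      TensorProduct.sum_tmul, Finset.smul_sum, Finset.sum_filter]
    refine Finset.sum_congr rfl fun X _ => ?_
    split_ifs
    · rw [← TensorProduct.smul_tmul', smul_smul, mul_comm]
    · rw [TensorProduct.zero_tmul, smul_zero]
  · simp only [h, if_false, false_and, Finset.sum_const_zero]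

open Classical in
theorem comul_rTensor_comul_one_eq_left :
    (T.comul k).rTensor (T.Alg k) (T.comul k 1) = (T.comul k 1 ⊗ₜ[k] (1 : T.Alg k)) *
      (TensorProduct.assoc k (T.Alg k) (T.Alg k) (T.Alg k)).symm
        ((1 : T.Alg k) ⊗ₜ[k] T.comul k 1) := by
  rw [comul_rTensor_comul_one, comul_one]
  refine Eq.trans ?_ (sum_tmul_one_mul_one_tmul_sum _ _ _ _ _ _ _ _).symm
  rw [← Finset.sum_filter_of_ne (p := fun q : (H × B) × (H × B) =>
    T.ver.tgt (T.hor.mul (T.hor.inv q.1.2) (T.ver.idn q.1.1)) = T.ver.src q.2.2)]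
  · -- `(x, X), (y, Z)` corresponds to `X` and the box `U = (id b(X)) Z`
    refine Finset.sum_nbij'
      (fun q => ((T.sideH.mul (T.ver.tgt q.2) (T.ver.src (T.hor.mul
          (T.ver.idn (T.sideH.inv (T.ver.tgt q.2))) q.1.2)), q.2),
        (T.sideH.mul (T.sideH.inv (T.ver.tgt q.2)) q.1.1,
          T.hor.mul (T.ver.idn (T.sideH.inv (T.ver.tgt q.2))) q.1.2)))
      (fun q => ((T.sideH.mul (T.ver.tgt q.1.2) q.2.1,
        T.hor.mul (T.ver.idn (T.ver.tgt q.1.2)) q.2.2), q.1.2)) ?_ ?_ ?_ ?_ ?_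
    all_goals simp only [Finset.mem_filter, Finset.mem_univ, true_and, Prod.forall, and_imp,
      Finset.mem_product, Prod.mk.injEq]
    · intro x U X h1 h2
      refine ⟨⟨?_, ?_⟩, ?_⟩
      · grind (ematch := 12) (gen := 12)
      · grind (ematch := 12) (gen := 12)
      · grind (ematch := 12) (gen := 12)
    · intro x X y Z h1 h2 h3
      have a1 : T.sideH.src (T.ver.tgt X) = T.sideH.src x := by
        rw [T.corner_bl, h1, T.sideV.tgt_idn]
      have a2 : T.sideH.mul (T.sideH.inv (T.ver.tgt X)) x = T.ver.src Z := by grind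
      have a3 : T.sideH.tgt (T.ver.tgt X) = T.sideH.src (T.ver.src Z) := by grind
      have a4 : T.sideH.src (T.ver.src Z) = T.sideH.src y := by
        rw [T.corner_tl, h2, T.sideV.src_idn]
      have a5 : T.hor.tgt (T.ver.idn (T.ver.tgt X)) = T.hor.src Z := by grind
      refine ⟨?_, ?_⟩
      · grind (ematch := 12) (gen := 12)
      · grind (ematch := 12) (gen := 12)
    · intro x U X h1 h2
      refine ⟨⟨?_, ?_⟩, trivial⟩
      · grind (ematch := 12) (gen := 12)
      · rw [← T.hor_inv_idn]
        grind (ematch := 12) (gen := 12)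
    · intro x X y Z h1 h2 h3
      have a1 : T.sideH.src (T.ver.tgt X) = T.sideH.src x := by
        rw [T.corner_bl, h1, T.sideV.tgt_idn]
      have a2 : T.sideH.mul (T.sideH.inv (T.ver.tgt X)) x = T.ver.src Z := by grind
      have a3 : T.sideH.tgt (T.ver.tgt X) = T.sideH.src (T.ver.src Z) := by grind
      have a4 : T.sideH.src (T.ver.src Z) = T.sideH.src y := by
        rw [T.corner_tl, h2, T.sideV.src_idn]
      have a5 : T.hor.tgt (T.ver.idn (T.ver.tgt X)) = T.hor.src Z := by grind
      have e : T.hor.mul (T.ver.idn (T.sideH.inv (T.ver.tgt X)))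
        (T.hor.mul (T.ver.idn (T.ver.tgt X)) Z) = Z := by
        rw [← T.hor_inv_idn]
        grind (ematch := 12) (gen := 12)
      refine ⟨⟨?_, trivial⟩, ?_, e⟩
      · rw [e]
        grind (ematch := 12) (gen := 12)
      · grind (ematch := 12) (gen := 12)
    · intro x U X h1 h2
      have a1 : T.sideH.src (T.ver.src U) = T.sideH.src x := by
        rw [T.corner_tl, h1, T.sideV.src_idn]
      have a2 : T.sideH.src (T.ver.tgt X) = T.sideH.src x := by
        rw [T.corner_bl, h2, T.sideV.tgt_idn]
      have a3 : T.hor.tgt (T.ver.idn (T.sideH.inv (T.ver.tgt X))) = T.hor.src U := by grind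
      have e1 : T.sideH.mul (T.ver.tgt X) (T.ver.src (T.hor.mul
          (T.ver.idn (T.sideH.inv (T.ver.tgt X))) U)) = T.ver.src U := by
        grind (ematch := 12) (gen := 12)
      have e2 : T.br (T.hor.mul (T.ver.idn (T.sideH.inv (T.ver.tgt X))) U) = T.br U := by
        simp only [br]; grind
      have e3 : T.ver.tgt (T.hor.mul (T.hor.inv X) (T.ver.idn (T.ver.src U))) =
          T.ver.src (T.hor.mul (T.ver.idn (T.sideH.inv (T.ver.tgt X))) U) := by grind
      have e4 : T.ver.mul (T.hor.mul (T.hor.inv X) (T.ver.idn (T.ver.src U)))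
          (T.hor.mul (T.ver.idn (T.sideH.inv (T.ver.tgt X))) U) =
          T.hor.mul (T.hor.inv X) U := by
        rw [T.interchange_mul (by grind) a3 (by grind) (by grind)]
        grind
      have e5 : T.hor.mul (T.hor.inv (T.hor.mul (T.ver.idn (T.sideH.inv (T.ver.tgt X))) U))
          (T.ver.idn (T.sideH.mul (T.sideH.inv (T.ver.tgt X)) x)) =
          T.hor.mul (T.hor.inv U) (T.ver.idn x) := by
        rw [T.ver_idn_mul (by grind), T.hor.inv_mul_rev a3, T.hor_inv_idn, T.sideH.inv_inv,
          ← T.hor_inv_idn]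
        grind (ematch := 12) (gen := 12)
      rw [e1, e2, e5, T.ofBox_mul_ofBox e3, e4]
  · intro q _ hne
    by_contra h
    rw [T.ofBox_mul_ofBox_eq_zero h, TensorProduct.tmul_zero, TensorProduct.zero_tmul,
      smul_zero] at hne
    exact hne rfl

open Classical in
theorem comul_rTensor_comul_one_eq_right :
    (T.comul k).rTensor (T.Alg k) (T.comul k 1) =
      (TensorProduct.assoc k (T.Alg k) (T.Alg k) (T.Alg k)).symm ((1 : T.Alg k) ⊗ₜ[k] T.comul k 1) *
      (T.comul k 1 ⊗ₜ[k] (1 : T.Alg k)) := by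
  rw [comul_rTensor_comul_one, comul_one]
  refine Eq.trans ?_ (one_tmul_sum_mul_sum_tmul_one _ _ _ _ _ _ _ _).symm
  rw [← Finset.sum_filter_of_ne (p := fun q : (H × B) × (H × B) =>
    T.ver.tgt q.2.2 = T.ver.src (T.hor.mul (T.hor.inv q.1.2) (T.ver.idn q.1.1)))]
  · -- `(x, X), (y, Z)` corresponds to `X` and the box `U = (id t(X)) Z`
    refine Finset.sum_nbij'
      (fun q => ((T.sideH.mul (T.ver.src q.2) (T.ver.tgt (T.hor.mul
          (T.ver.idn (T.sideH.inv (T.ver.src q.2))) q.1.2)), q.2),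
        (T.sideH.mul (T.sideH.inv (T.ver.src q.2)) q.1.1,
          T.hor.mul (T.ver.idn (T.sideH.inv (T.ver.src q.2))) q.1.2)))
      (fun q => ((T.sideH.mul (T.ver.src q.1.2) q.2.1,
        T.hor.mul (T.ver.idn (T.ver.src q.1.2)) q.2.2), q.1.2)) ?_ ?_ ?_ ?_ ?_
    all_goals simp only [Finset.mem_filter, Finset.mem_univ, true_and, Prod.forall, and_imp,
      Finset.mem_product, Prod.mk.injEq]
    · intro x U X h1 h2
      refine ⟨⟨?_, ?_⟩, ?_⟩
      · grind (ematch := 12) (gen := 12)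
      · grind (ematch := 12) (gen := 12)
      · grind (ematch := 12) (gen := 12)
    · intro x X y Z h1 h2 h3
      have a1 : T.sideH.src (T.ver.src X) = T.sideH.src x := by
        rw [T.corner_tl, h1, T.sideV.src_idn]
      have a2 : T.sideH.mul (T.sideH.inv (T.ver.src X)) x = T.ver.tgt Z := by grind
      have a3 : T.sideH.tgt (T.ver.src X) = T.sideH.src (T.ver.tgt Z) := by grind
      have a4 : T.sideH.src (T.ver.tgt Z) = T.sideH.src y := by
        rw [T.corner_bl, h2, T.sideV.tgt_idn]
      have a5 : T.hor.tgt (T.ver.idn (T.ver.src X)) = T.hor.src Z := by grind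
      refine ⟨?_, ?_⟩
      · grind (ematch := 12) (gen := 12)
      · grind (ematch := 12) (gen := 12)
    · intro x U X h1 h2
      refine ⟨⟨?_, ?_⟩, trivial⟩
      · grind (ematch := 12) (gen := 12)
      · rw [← T.hor_inv_idn]
        grind (ematch := 12) (gen := 12)
    · intro x X y Z h1 h2 h3
      have a1 : T.sideH.src (T.ver.src X) = T.sideH.src x := by
        rw [T.corner_tl, h1, T.sideV.src_idn]
      have a2 : T.sideH.mul (T.sideH.inv (T.ver.src X)) x = T.ver.tgt Z := by grind
      have a3 : T.sideH.tgt (T.ver.src X) = T.sideH.src (T.ver.tgt Z) := by grind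
      have a4 : T.sideH.src (T.ver.tgt Z) = T.sideH.src y := by
        rw [T.corner_bl, h2, T.sideV.tgt_idn]
      have a5 : T.hor.tgt (T.ver.idn (T.ver.src X)) = T.hor.src Z := by grind
      have e : T.hor.mul (T.ver.idn (T.sideH.inv (T.ver.src X)))
        (T.hor.mul (T.ver.idn (T.ver.src X)) Z) = Z := by
        rw [← T.hor_inv_idn]
        grind (ematch := 12) (gen := 12)
      refine ⟨⟨?_, trivial⟩, ?_, e⟩
      · rw [e]
        grind (ematch := 12) (gen := 12)
      · grind (ematch := 12) (gen := 12)
    · intro x U X h1 h2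
      have a1 : T.sideH.src (T.ver.tgt U) = T.sideH.src x := by
        rw [T.corner_bl, h1, T.sideV.tgt_idn]
      have a2 : T.sideH.src (T.ver.src X) = T.sideH.src x := by
        rw [T.corner_tl, h2, T.sideV.src_idn]
      have a3 : T.hor.tgt (T.ver.idn (T.sideH.inv (T.ver.src X))) = T.hor.src U := by grind
      have e1 : T.sideH.mul (T.ver.src X) (T.ver.tgt (T.hor.mul
          (T.ver.idn (T.sideH.inv (T.ver.src X))) U)) = T.ver.tgt U := by
        grind (ematch := 12) (gen := 12)
      have e2 : T.br (T.hor.mul (T.ver.idn (T.sideH.inv (T.ver.src X))) U) = T.br U := by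
        simp only [br]; grind
      have e3 : T.ver.tgt (T.hor.mul (T.ver.idn (T.sideH.inv (T.ver.src X))) U) =
          T.ver.src (T.hor.mul (T.hor.inv X) (T.ver.idn (T.ver.tgt U))) := by grind
      have e4 : T.ver.mul (T.hor.mul (T.ver.idn (T.sideH.inv (T.ver.src X))) U)
          (T.hor.mul (T.hor.inv X) (T.ver.idn (T.ver.tgt U))) =
          T.hor.mul (T.hor.inv X) U := by
        rw [T.interchange_mul a3 (by grind) (by grind) (by grind)]
        grind
      have e5 : T.hor.mul (T.hor.inv (T.hor.mul (T.ver.idn (T.sideH.inv (T.ver.src X))) U))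
          (T.ver.idn (T.sideH.mul (T.sideH.inv (T.ver.src X)) x)) =
          T.hor.mul (T.hor.inv U) (T.ver.idn x) := by
        rw [T.ver_idn_mul (by grind), T.hor.inv_mul_rev a3, T.hor_inv_idn, T.sideH.inv_inv,
          ← T.hor_inv_idn]
        grind (ematch := 12) (gen := 12)
      rw [e1, e2, e5, T.ofBox_mul_ofBox e3, e4]
  · intro q _ hne
    by_contra h
    rw [T.ofBox_mul_ofBox_eq_zero h, TensorProduct.tmul_zero, TensorProduct.zero_tmul,
      smul_zero] at hne
    exact hne rfl

end unit
end DoubleGroupoid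

/-! ### Columns of boxes that compose to a vertical arrow -/

namespace DoubleGroupoid
variable {P H V B : Type*} (T : DoubleGroupoid P H V B)

section boxes
variable {T} {A C D X : B}

/-- If a horizontal factorization `C = XY` is such that `A` on top of `X` and `Y` on top of `D`
are vertical arrows, then so is the column `A`, `C`, `D`, and `X` is determined by `A` and `C`. -/
theorem isId_of_factor_left (hl : T.hor.src X = T.hor.src C) (h₁ : T.ver.tgt A = T.ver.src X)
    (h₂ : T.hor.IsId (T.ver.mul A X))
    (h₃ : T.ver.tgt (T.hor.mul (T.hor.inv X) C) = T.ver.src D)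
    (h₄ : T.hor.IsId (T.ver.mul (T.hor.mul (T.hor.inv X) C) D)) :
    X = T.ver.mul (T.ver.inv A) (T.hor.idn (T.sideV.mul (T.hor.src A) (T.hor.src C))) ∧
      T.ver.tgt A = T.ver.src C ∧ T.ver.tgt C = T.ver.src D ∧
      T.hor.IsId (T.ver.mul (T.ver.mul A C) D) := by
  obtain ⟨g, hg⟩ := h₂
  obtain ⟨h, hh⟩ := h₄
  set Y := T.hor.mul (T.hor.inv X) C with hY
  have hXY : T.hor.mul X Y = C := by grind
  have hr : T.hor.tgt X = T.hor.src Y := by grind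
  have g1 : g = T.sideV.mul (T.hor.src A) (T.hor.src X) := by
    rw [← T.left_vmul h₁, hg, T.hor.src_idn]
  have bX : T.ver.tgt X = T.sideH.idn (T.sideV.tgt g) := by
    rw [← T.bot_hor_idn, ← hg, T.ver.tgt_mul h₁]
  have tY : T.ver.src Y = T.sideH.idn (T.sideV.src h) := by
    rw [← T.top_hor_idn, ← hh, T.ver.src_mul h₃]
  have tX : T.ver.src X = T.ver.src C := by
    rw [← hXY, T.top_hmul hr, tY]; grind
  have bY : T.ver.tgt Y = T.ver.tgt C := by
    rw [← hXY, T.bot_hmul hr, bX]; grind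
  have hAC : T.ver.tgt A = T.ver.src C := h₁.trans tX
  have hCD : T.ver.tgt C = T.ver.src D := bY.symm.trans h₃
  refine ⟨?_, hAC, hCD, ?_⟩
  · rw [← hl, ← g1, ← hg]; grind
  · have rA : T.ver.tgt (T.hor.idn (T.hor.tgt A)) = T.ver.src Y := by grind
    have lD : T.ver.tgt X = T.ver.src (T.hor.idn (T.hor.src D)) := by grind
    have e1 : T.ver.mul A C =
        T.hor.mul (T.ver.mul A X) (T.ver.mul (T.hor.idn (T.hor.tgt A)) Y) := by
      rw [← T.interchange_mul (by grind) hr h₁ rA, hXY, T.hor.mul_idn rfl]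
    have e2 : T.ver.mul (T.ver.mul A C) D = T.hor.mul
        (T.ver.mul (T.ver.mul A X) (T.hor.idn (T.hor.src D)))
        (T.ver.mul (T.ver.mul (T.hor.idn (T.hor.tgt A)) Y) D) := by
      rw [← T.interchange_mul (by grind) (by grind) (by grind) (by grind), ← e1,
        T.hor.idn_mul rfl]
    rw [e2, hg, T.ver.mul_assoc rA h₃, hh, ← T.hor_idn_mul (by grind), ← T.hor_idn_mul (by grind)]
    have g2 : g = T.sideV.mul (T.hor.tgt A) (T.hor.tgt X) := by
      rw [← T.right_vmul h₁, hg, T.hor.tgt_idn]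
    have g3 : h = T.sideV.mul (T.hor.src Y) (T.hor.src D) := by
      rw [← T.left_vmul h₃, hh, T.hor.src_idn]
    rw [T.hor.idn_mul (by rw [T.hor.src_idn, g2, g3, hr, T.sideV.mul_assoc] <;> grind)]
    exact ⟨_, rfl⟩

/-- Conversely, if the column `A`, `C`, `D` is a vertical arrow, then the only candidate for `X` in
`isId_of_factor_left` does give a factorization of `C` of that kind. -/
theorem factor_left_of_isId (hAC : T.ver.tgt A = T.ver.src C) (hCD : T.ver.tgt C = T.ver.src D)
    (h : T.hor.IsId (T.ver.mul (T.ver.mul A C) D))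
    (hX : X = T.ver.mul (T.ver.inv A) (T.hor.idn (T.sideV.mul (T.hor.src A) (T.hor.src C)))) :
    T.hor.src X = T.hor.src C ∧ (T.ver.tgt A = T.ver.src X ∧ T.hor.IsId (T.ver.mul A X)) ∧
    (T.ver.tgt (T.hor.mul (T.hor.inv X) C) = T.ver.src D ∧
      T.hor.IsId (T.ver.mul (T.hor.mul (T.hor.inv X) C) D)) := by
  obtain ⟨g, hg⟩ := h
  have g1 : g = T.sideV.mul (T.sideV.mul (T.hor.src A) (T.hor.src C)) (T.hor.src D) := by
    rw [← T.left_vmul hAC, ← T.left_vmul (by grind), hg, T.hor.src_idn]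
  have tA : T.ver.src A = T.sideH.idn (T.sideV.src (T.hor.src A)) := by
    have : T.ver.src A = T.sideH.idn (T.sideV.src g) := by
      rw [← T.top_hor_idn, ← hg]; grind
    rw [this]; grind
  have c0 : T.sideV.tgt (T.hor.src A) = T.sideV.src (T.hor.src C) := by grind
  have c1 : T.sideV.tgt (T.hor.src C) = T.sideV.src (T.hor.src D) := by grind
  have hc : T.ver.tgt (T.ver.inv A) =
      T.ver.src (T.hor.idn (T.sideV.mul (T.hor.src A) (T.hor.src C))) := by grind
  have lX : T.hor.src X = T.hor.src C := by
    rw [hX, T.left_vmul hc]; grind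
  have tX : T.ver.tgt A = T.ver.src X := by
    rw [hX, T.ver.src_mul hc]; grind
  have AX : T.ver.mul A X = T.hor.idn (T.sideV.mul (T.hor.src A) (T.hor.src C)) := by
    rw [hX]; grind
  have bX : T.ver.tgt X = T.sideH.idn (T.sideV.src (T.hor.src D)) := by
    rw [hX, T.ver.tgt_mul hc]; grind
  have bY : T.ver.tgt (T.hor.mul (T.hor.inv X) C) = T.ver.src D := by
    rw [T.bot_hmul (by grind), T.bot_hinv, bX]; grind
  refine ⟨lX, ⟨tX, _, AX⟩, bY, ?_⟩
  have e1 : T.ver.mul C D = T.ver.mul X (T.hor.idn (T.hor.src D)) := by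
    refine T.ver.mul_left_cancel (f := A) (by grind) (by grind) ?_
    rw [← T.ver.mul_assoc hAC hCD, hg, ← T.ver.mul_assoc tX (by grind), AX, g1,
      T.hor_idn_mul (by grind)]
  have e2 : T.ver.mul (T.hor.mul (T.hor.inv X) C) D = T.hor.mul
      (T.hor.inv (T.ver.mul X (T.hor.idn (T.hor.src D)))) (T.ver.mul C D) := by
    rw [T.hor_inv_vmul (by grind), ← T.interchange_mul (by grind) (by grind) (by grind) hCD]
    rw [T.hor.inv_idn, T.hor.idn_mul rfl]
  rw [e2, e1, T.hor.inv_mul]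
  exact ⟨_, rfl⟩

/-- If a horizontal factorization `C = XY` is such that `X` on top of `D` and `A` on top of `Y`
are vertical arrows, then so is the column `A`, `C`, `D`, and `X` is determined by `C` and `D`. The
bottom side of `Y` is then trivial, so the bottom right vertices of `X` and `Y` agree. -/
theorem isId_of_factor_right (hl : T.hor.src X = T.hor.src C) (h₁ : T.ver.tgt X = T.ver.src D)
    (h₂ : T.hor.IsId (T.ver.mul X D))
    (h₃ : T.ver.tgt A = T.ver.src (T.hor.mul (T.hor.inv X) C))
    (h₄ : T.hor.IsId (T.ver.mul A (T.hor.mul (T.hor.inv X) C))) :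
    X = T.ver.mul (T.hor.idn (T.sideV.mul (T.hor.src C) (T.hor.src D))) (T.ver.inv D) ∧
      T.br (T.hor.mul (T.hor.inv X) C) = T.br X ∧
      T.ver.tgt A = T.ver.src C ∧ T.ver.tgt C = T.ver.src D ∧
      T.hor.IsId (T.ver.mul (T.ver.mul A C) D) := by
  obtain ⟨g, hg⟩ := h₂
  obtain ⟨h, hh⟩ := h₄
  set Y := T.hor.mul (T.hor.inv X) C with hY
  have hXY : T.hor.mul X Y = C := by grind
  have hr : T.hor.tgt X = T.hor.src Y := by grind
  have g1 : g = T.sideV.mul (T.hor.src X) (T.hor.src D) := by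
    rw [← T.left_vmul h₁, hg, T.hor.src_idn]
  have tX : T.ver.src X = T.sideH.idn (T.sideV.src g) := by
    rw [← T.top_hor_idn, ← hg, T.ver.src_mul h₁]
  have bY : T.ver.tgt Y = T.sideH.idn (T.sideV.tgt h) := by
    rw [← T.bot_hor_idn, ← hh, T.ver.tgt_mul h₃]
  have tY : T.ver.src Y = T.ver.src C := by
    rw [← hXY, T.top_hmul hr, tX]; grind
  have bX : T.ver.tgt X = T.ver.tgt C := by
    rw [← hXY, T.bot_hmul hr, bY]; grind
  have hAC : T.ver.tgt A = T.ver.src C := h₃.trans tY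
  have hCD : T.ver.tgt C = T.ver.src D := bX.symm.trans h₁
  refine ⟨?_, ?_, hAC, hCD, ?_⟩
  · rw [← hl, ← g1, ← hg]; grind
  · have : T.sideH.src (T.ver.tgt Y) = T.sideH.tgt (T.ver.tgt Y) := by rw [bY]; grind
    rw [br, ← this]; grind
  · have lA : T.ver.tgt (T.hor.idn (T.hor.src A)) = T.ver.src X := by grind
    have rD : T.ver.tgt Y = T.ver.src (T.hor.idn (T.hor.tgt D)) := by grind
    have e1 : T.ver.mul A C =
        T.hor.mul (T.ver.mul (T.hor.idn (T.hor.src A)) X) (T.ver.mul A Y) := by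
      rw [← T.interchange_mul (by grind) hr lA h₃, hXY, T.hor.idn_mul rfl]
    have e2 : T.ver.mul (T.ver.mul A C) D = T.hor.mul
        (T.ver.mul (T.ver.mul (T.hor.idn (T.hor.src A)) X) D)
        (T.ver.mul (T.ver.mul A Y) (T.hor.idn (T.hor.tgt D))) := by
      rw [← T.interchange_mul (by grind) (by grind) (by grind) (by grind), ← e1,
        T.hor.mul_idn rfl]
    rw [e2, hh, T.ver.mul_assoc lA h₁, hg, ← T.hor_idn_mul (by grind), ← T.hor_idn_mul (by grind)]
    have g2 : g = T.sideV.mul (T.hor.tgt X) (T.hor.tgt D) := by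
      rw [← T.right_vmul h₁, hg, T.hor.tgt_idn]
    have g3 : h = T.sideV.mul (T.hor.src A) (T.hor.src Y) := by
      rw [← T.left_vmul h₃, hh, T.hor.src_idn]
    rw [T.hor.idn_mul (by rw [T.hor.src_idn, g2, g3, hr, T.sideV.mul_assoc] <;> grind)]
    exact ⟨_, rfl⟩

/-- Conversely, if the column `A`, `C`, `D` is a vertical arrow, then the only candidate for `X` in
`isId_of_factor_right` does give a factorization of `C` of that kind. -/
theorem factor_right_of_isId (hAC : T.ver.tgt A = T.ver.src C) (hCD : T.ver.tgt C = T.ver.src D)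
    (h : T.hor.IsId (T.ver.mul (T.ver.mul A C) D))
    (hX : X = T.ver.mul (T.hor.idn (T.sideV.mul (T.hor.src C) (T.hor.src D))) (T.ver.inv D)) :
    T.hor.src X = T.hor.src C ∧ (T.ver.tgt X = T.ver.src D ∧ T.hor.IsId (T.ver.mul X D)) ∧
    (T.ver.tgt A = T.ver.src (T.hor.mul (T.hor.inv X) C) ∧
      T.hor.IsId (T.ver.mul A (T.hor.mul (T.hor.inv X) C))) := by
  obtain ⟨g, hg⟩ := h
  have g1 : g = T.sideV.mul (T.hor.src A) (T.sideV.mul (T.hor.src C) (T.hor.src D)) := by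
    rw [← T.left_vmul hCD, ← T.left_vmul (by grind), ← T.ver.mul_assoc hAC hCD, hg, T.hor.src_idn]
  have c0 : T.sideV.tgt (T.hor.src A) = T.sideV.src (T.hor.src C) := by grind
  have c1 : T.sideV.tgt (T.hor.src C) = T.sideV.src (T.hor.src D) := by grind
  have bD : T.ver.tgt D = T.sideH.idn (T.sideV.tgt (T.hor.src D)) := by
    have : T.ver.tgt D = T.sideH.idn (T.sideV.tgt g) := by
      rw [← T.bot_hor_idn, ← hg]; grind
    rw [this]; grind
  have hc : T.ver.tgt (T.hor.idn (T.sideV.mul (T.hor.src C) (T.hor.src D))) =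
      T.ver.src (T.ver.inv D) := by grind
  have lX : T.hor.src X = T.hor.src C := by
    rw [hX, T.left_vmul hc]; grind
  have bX : T.ver.tgt X = T.ver.src D := by
    rw [hX, T.ver.tgt_mul hc]; grind
  have XD : T.ver.mul X D = T.hor.idn (T.sideV.mul (T.hor.src C) (T.hor.src D)) := by
    rw [hX]; grind
  have tX : T.ver.src X = T.sideH.idn (T.sideV.tgt (T.hor.src A)) := by
    rw [hX, T.ver.src_mul hc]; grind
  have tY : T.ver.tgt A = T.ver.src (T.hor.mul (T.hor.inv X) C) := by
    rw [T.top_hmul (by grind), T.top_hinv, tX]; grind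
  refine ⟨lX, ⟨bX, _, XD⟩, tY, ?_⟩
  have e1 : T.ver.mul A C = T.ver.mul (T.hor.idn (T.hor.src A)) X := by
    refine T.ver.mul_right_cancel (k := D) (by grind) (by grind) ?_
    rw [hg, T.ver.mul_assoc (by grind) bX, XD, g1, T.hor_idn_mul (by grind)]
  have e2 : T.ver.mul A (T.hor.mul (T.hor.inv X) C) = T.hor.mul
      (T.hor.inv (T.ver.mul (T.hor.idn (T.hor.src A)) X)) (T.ver.mul A C) := by
    rw [T.hor_inv_vmul (by grind), ← T.interchange_mul (by grind) (by grind) (by grind) hAC]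
    rw [T.hor.inv_idn, T.hor.idn_mul rfl]
  rw [e2, e1, T.hor.inv_mul]
  exact ⟨_, rfl⟩

end boxes
end DoubleGroupoid

/-! ### The counit of a product -/

section bilinear
variable {k A ι : Type*} [Field k] [Ring A] [Algebra k A]

theorem Module.Basis.induction_of_span (e : Module.Basis ι k A) {p : A → Prop} (zero : p 0)
    (add : ∀ a b, p a → p b → p (a + b)) (smul : ∀ (c : k) a, p a → p (c • a))
    (basis : ∀ i, p (e i)) (a : A) : p a := by
  have ha : a ∈ Submodule.span k (Set.range e) := by
    rw [Module.Basis.span_eq]; trivial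
  refine Submodule.span_induction (p := fun x _ => p x) ?_ zero (fun x y _ _ => add x y)
    (fun c x _ => smul c x) ha
  rintro _ ⟨i, rfl⟩
  exact basis i

/-- The identity `ε(abc) = ε(ab₁)ε(b₂c)` is trilinear, so it can be checked on a basis. -/
theorem counit_mul_left_of_basis (e : Module.Basis ι k A) (ε : A →ₗ[k] k) (Δ : A →ₗ[k] A ⊗[k] A)
    (h : ∀ i j l, ε (e i * e j * e l) = LinearMap.mul' k k (TensorProduct.map
      (ε ∘ₗ LinearMap.mulLeft k (e i)) (ε ∘ₗ LinearMap.mulRight k (e l)) (Δ (e j))))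
    (a b c : A) : ε (a * b * c) = LinearMap.mul' k k (TensorProduct.map
      (ε ∘ₗ LinearMap.mulLeft k a) (ε ∘ₗ LinearMap.mulRight k c) (Δ b)) := by
  have key : ∀ (a c : A) (t : A ⊗[k] A), LinearMap.mul' k k (TensorProduct.map
      (ε ∘ₗ LinearMap.mulLeft k a) (ε ∘ₗ LinearMap.mulRight k c) t) =
      LinearMap.mul' k k (TensorProduct.map ε ε ((a ⊗ₜ[k] 1) * t * (1 ⊗ₜ[k] c))) := by
    intro a c t
    induction t with
    | zero => simp
    | tmul x y => simp
    | add x y hx hy => simp only [map_add, hx, hy, mul_add, add_mul]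
  rw [key]
  simp only [key] at h
  induction a using Module.Basis.induction_of_span e with
  | zero => simp
  | add x y hx hy => simp only [add_mul, map_add, hx, hy, TensorProduct.add_tmul]
  | smul r x hx =>
    simp only [smul_mul_assoc, map_smul, hx, ← TensorProduct.smul_tmul']
  | basis i =>
    induction c using Module.Basis.induction_of_span e with
    | zero => simp
    | add x y hx hy =>
      simp only [mul_add, map_add, hx, hy, TensorProduct.tmul_add]
    | smul r x hx =>
      simp only [mul_smul_comm, map_smul, hx, TensorProduct.tmul_smul]
    | basis l =>
      induction b using Module.Basis.induction_of_span e with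
      | zero => simp
      | add x y hx hy => simp only [mul_add, add_mul, map_add, hx, hy]
      | smul r x hx => simp only [mul_smul_comm, smul_mul_assoc, map_smul, hx]
      | basis j => exact h i j l

/-- The identity `ε(abc) = ε(ab₂)ε(b₁c)` is trilinear, so it can be checked on a basis. -/
theorem counit_mul_right_of_basis (e : Module.Basis ι k A) (ε : A →ₗ[k] k) (Δ : A →ₗ[k] A ⊗[k] A)
    (h : ∀ i j l, ε (e i * e j * e l) = LinearMap.mul' k k (TensorProduct.map
      (ε ∘ₗ LinearMap.mulRight k (e l)) (ε ∘ₗ LinearMap.mulLeft k (e i)) (Δ (e j))))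
    (a b c : A) : ε (a * b * c) = LinearMap.mul' k k (TensorProduct.map
      (ε ∘ₗ LinearMap.mulRight k c) (ε ∘ₗ LinearMap.mulLeft k a) (Δ b)) := by
  have key : ∀ (a c : A) (t : A ⊗[k] A), LinearMap.mul' k k (TensorProduct.map
      (ε ∘ₗ LinearMap.mulRight k c) (ε ∘ₗ LinearMap.mulLeft k a) t) =
      LinearMap.mul' k k (TensorProduct.map ε ε ((1 ⊗ₜ[k] a) * t * (c ⊗ₜ[k] 1))) := by
    intro a c t
    induction t with
    | zero => simp
    | tmul x y => simp
    | add x y hx hy => simp only [map_add, hx, hy, mul_add, add_mul]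
  rw [key]
  simp only [key] at h
  induction a using Module.Basis.induction_of_span e with
  | zero => simp
  | add x y hx hy => simp only [add_mul, map_add, hx, hy, TensorProduct.tmul_add]
  | smul r x hx =>
    simp only [smul_mul_assoc, map_smul, hx, TensorProduct.tmul_smul]
  | basis i =>
    induction c using Module.Basis.induction_of_span e with
    | zero => simp
    | add x y hx hy =>
      simp only [mul_add, map_add, hx, hy, TensorProduct.add_tmul]
    | smul r x hx =>
      simp only [mul_smul_comm, map_smul, hx, ← TensorProduct.smul_tmul']
    | basis l =>
      induction b using Module.Basis.induction_of_span e with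
      | zero => simp
      | add x y hx hy => simp only [mul_add, add_mul, map_add, hx, hy]
      | smul r x hx => simp only [mul_smul_comm, smul_mul_assoc, map_smul, hx]
      | basis j => exact h i j l

end bilinear

namespace DoubleGroupoid
variable {P H V B : Type*} (T : DoubleGroupoid P H V B)

section counit
variable {k : Type*} [Field k]

open Classical in
theorem counit_ofBox_mul_ofBox (A C : B) : T.counit k (T.ofBox k A * T.ofBox k C) =
    if T.ver.tgt A = T.ver.src C ∧ T.hor.IsId (T.ver.mul A C) then (T.theta (T.br C) : k)
    else 0 := by
  by_cases h : T.ver.tgt A = T.ver.src C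
  · rw [T.ofBox_mul_ofBox h, counit_ofBox, br, T.ver.tgt_mul h]
    simp only [h, true_and]
  · rw [T.ofBox_mul_ofBox_eq_zero h, map_zero, if_neg fun h' => h h'.1]

variable [Fintype H]

open Classical in
theorem counit_ofBox_mul_mul (A C D : B) :
    T.counit k (T.ofBox k A * T.ofBox k C * T.ofBox k D) =
    if T.ver.tgt A = T.ver.src C ∧ T.ver.tgt C = T.ver.src D ∧
      T.hor.IsId (T.ver.mul (T.ver.mul A C) D) then (T.theta (T.br D) : k) else 0 := by
  by_cases h : T.ver.tgt A = T.ver.src C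
  · rw [T.ofBox_mul_ofBox h, counit_ofBox_mul_ofBox, T.ver.tgt_mul h]
    simp only [h, true_and]
  · rw [T.ofBox_mul_ofBox_eq_zero h, zero_mul, map_zero, if_neg fun h' => h h'.1]

variable [CharZero k] [Fintype B]

open Classical in
theorem counit_mul_left (a b c : T.Alg k) : T.counit k (a * b * c) =
    LinearMap.mul' k k (TensorProduct.map (T.counit k ∘ₗ LinearMap.mulLeft k a)
      (T.counit k ∘ₗ LinearMap.mulRight k c) (T.comul k b)) := by
  refine counit_mul_left_of_basis (GroupoidAlgebra.basis k T.ver) (T.counit k) (T.comul k)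
    (fun A C D => ?_) a b c
  change T.counit k (T.ofBox k A * T.ofBox k C * T.ofBox k D) = LinearMap.mul' k k
    (TensorProduct.map (T.counit k ∘ₗ LinearMap.mulLeft k (T.ofBox k A))
      (T.counit k ∘ₗ LinearMap.mulRight k (T.ofBox k D)) (T.comul k (T.ofBox k C)))
  simp only [comul_ofBox, map_sum, map_smul, TensorProduct.map_tmul, LinearMap.comp_apply,
    LinearMap.mulLeft_apply, LinearMap.mulRight_apply, LinearMap.mul'_apply,
    counit_ofBox_mul_ofBox, counit_ofBox_mul_mul]
  by_cases h : T.ver.tgt A = T.ver.src C ∧ T.ver.tgt C = T.ver.src D ∧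
      T.hor.IsId (T.ver.mul (T.ver.mul A C) D)
  · obtain ⟨X₀, hX₀⟩ : ∃ X₀, X₀ =
      T.ver.mul (T.ver.inv A) (T.hor.idn (T.sideV.mul (T.hor.src A) (T.hor.src C))) := ⟨_, rfl⟩
    obtain ⟨h1, h2, h3⟩ := factor_left_of_isId h.1 h.2.1 h.2.2 hX₀
    rw [if_pos h, Finset.sum_eq_single_of_mem X₀ (by simpa using h1),
      if_pos h2, if_pos h3, smul_eq_mul, inv_mul_cancel_left₀ (T.cast_theta_ne_zero k _)]
    intro X hX hne
    by_cases h4 : T.ver.tgt A = T.ver.src X ∧ T.hor.IsId (T.ver.mul A X)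
    · rw [if_pos h4, if_neg (fun h5 => hne
        ((isId_of_factor_left (Finset.mem_filter.1 hX).2 h4.1 h4.2 h5.1 h5.2).1.trans hX₀.symm)),
        mul_zero, smul_zero]
    · rw [if_neg h4, zero_mul, smul_zero]
  · rw [if_neg h, Finset.sum_eq_zero]
    intro X hX
    by_cases h4 : T.ver.tgt A = T.ver.src X ∧ T.hor.IsId (T.ver.mul A X)
    · rw [if_pos h4, if_neg (fun h5 => h
        (isId_of_factor_left (Finset.mem_filter.1 hX).2 h4.1 h4.2 h5.1 h5.2).2), mul_zero,
        smul_zero]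
    · rw [if_neg h4, zero_mul, smul_zero]

open Classical in
theorem counit_mul_right (a b c : T.Alg k) : T.counit k (a * b * c) =
    LinearMap.mul' k k (TensorProduct.map (T.counit k ∘ₗ LinearMap.mulRight k c)
      (T.counit k ∘ₗ LinearMap.mulLeft k a) (T.comul k b)) := by
  refine counit_mul_right_of_basis (GroupoidAlgebra.basis k T.ver) (T.counit k) (T.comul k)
    (fun A C D => ?_) a b c
  change T.counit k (T.ofBox k A * T.ofBox k C * T.ofBox k D) = LinearMap.mul' k k
    (TensorProduct.map (T.counit k ∘ₗ LinearMap.mulRight k (T.ofBox k D))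
      (T.counit k ∘ₗ LinearMap.mulLeft k (T.ofBox k A)) (T.comul k (T.ofBox k C)))
  simp only [comul_ofBox, map_sum, map_smul, TensorProduct.map_tmul, LinearMap.comp_apply,
    LinearMap.mulLeft_apply, LinearMap.mulRight_apply, LinearMap.mul'_apply,
    counit_ofBox_mul_ofBox, counit_ofBox_mul_mul]
  by_cases h : T.ver.tgt A = T.ver.src C ∧ T.ver.tgt C = T.ver.src D ∧
      T.hor.IsId (T.ver.mul (T.ver.mul A C) D)
  · obtain ⟨X₀, hX₀⟩ : ∃ X₀, X₀ =
      T.ver.mul (T.hor.idn (T.sideV.mul (T.hor.src C) (T.hor.src D))) (T.ver.inv D) := ⟨_, rfl⟩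
    obtain ⟨h1, h2, h3⟩ := factor_right_of_isId h.1 h.2.1 h.2.2 hX₀
    have h6 := (isId_of_factor_right h1 h2.1 h2.2 h3.1 h3.2).2.1
    rw [if_pos h, Finset.sum_eq_single_of_mem X₀ (by simpa using h1),
      if_pos h2, if_pos h3, h6, smul_eq_mul, mul_comm,
      mul_inv_cancel_right₀ (T.cast_theta_ne_zero k _)]
    intro X hX hne
    by_cases h4 : T.ver.tgt X = T.ver.src D ∧ T.hor.IsId (T.ver.mul X D)
    · rw [if_pos h4, if_neg (fun h5 => hne
        ((isId_of_factor_right (Finset.mem_filter.1 hX).2 h4.1 h4.2 h5.1 h5.2).1.trans hX₀.symm)),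
        mul_zero, smul_zero]
    · rw [if_neg h4, zero_mul, smul_zero]
  · rw [if_neg h, Finset.sum_eq_zero]
    intro X hX
    by_cases h4 : T.ver.tgt X = T.ver.src D ∧ T.hor.IsId (T.ver.mul X D)
    · rw [if_pos h4, if_neg (fun h5 => h
        (isId_of_factor_right (Finset.mem_filter.1 hX).2 h4.1 h4.2 h5.1 h5.2).2.2), mul_zero,
        smul_zero]
    · rw [if_neg h4, zero_mul, smul_zero]

end counit
end DoubleGroupoid

/-! ### Convolution, and the boxes in the source and target maps -/

section convolution
variable {k A : Type*} [Field k] [Ring A] [Algebra k A]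

/-- A comultiplication has at most one counit. -/
theorem counit_unique {Δ : A →ₗ[k] A ⊗[k] A} {ε ε' : A →ₗ[k] k}
    (h : ∀ a, ε.rTensor A (Δ a) = 1 ⊗ₜ[k] a) (h' : ∀ a, ε'.lTensor A (Δ a) = a ⊗ₜ[k] 1) :
    ε = ε' := by
  ext a
  have h1 : ∀ t : A ⊗[k] A, TensorProduct.rid k k (ε'.lTensor k (ε.rTensor A t)) =
      ε (TensorProduct.rid k A (ε'.lTensor A t)) := by
    intro t
    induction t with
    | zero => simp
    | tmul x y => simp
    | add x y hx hy => simp only [map_add, hx, hy]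
  have h2 := h1 (Δ a)
  rw [h, h', LinearMap.lTensor_tmul, TensorProduct.rid_tmul, TensorProduct.rid_tmul] at h2
  simpa using h2.symm

/-- The convolution product of two endomorphisms. -/
def convolution (Δ : A →ₗ[k] A ⊗[k] A) (f g : A →ₗ[k] A) : A →ₗ[k] A :=
  LinearMap.mul' k A ∘ₗ TensorProduct.map f g ∘ₗ Δ

theorem convolution_apply (Δ : A →ₗ[k] A ⊗[k] A) (f g : A →ₗ[k] A) (a : A) :
    convolution Δ f g a = LinearMap.mul' k A (TensorProduct.map f g (Δ a)) := rfl

theorem convolution_convolution_apply (Δ : A →ₗ[k] A ⊗[k] A) (f g h : A →ₗ[k] A) (a : A) :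
    convolution Δ (convolution Δ f g) h a = LinearMap.mul' k A ((LinearMap.mul' k A).rTensor A
      (TensorProduct.map (TensorProduct.map f g) h (Δ.rTensor A (Δ a)))) := by
  rw [convolution_apply]
  generalize Δ a = t
  induction t with
  | zero => simp
  | tmul x y => simp [convolution_apply]
  | add x y hx hy => simp only [map_add, hx, hy]

theorem convolution_assoc {Δ : A →ₗ[k] A ⊗[k] A}
    (hΔ : ∀ a, TensorProduct.assoc k A A A (Δ.rTensor A (Δ a)) = Δ.lTensor A (Δ a))
    (f g h : A →ₗ[k] A) :
    convolution Δ (convolution Δ f g) h = convolution Δ f (convolution Δ g h) := by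
  ext a
  have h1 : ∀ t : (A ⊗[k] A) ⊗[k] A, LinearMap.mul' k A ((LinearMap.mul' k A).rTensor A
      (TensorProduct.map (TensorProduct.map f g) h t)) =
      LinearMap.mul' k A ((LinearMap.mul' k A).lTensor A
      (TensorProduct.map f (TensorProduct.map g h) (TensorProduct.assoc k A A A t))) := by
    intro t
    induction t with
    | zero => simp
    | tmul x y =>
      induction x with
      | zero => simp
      | tmul x z => simp [mul_assoc]
      | add x z hx hz => simp only [map_add, TensorProduct.add_tmul, hx, hz]
    | add x y hx hy => simp only [map_add, hx, hy]
  rw [convolution_convolution_apply, h1, hΔ, convolution_apply]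
  generalize Δ a = t
  induction t with
  | zero => simp
  | tmul x y => simp [convolution_apply]
  | add x y hx hy => simp only [map_add, hx, hy]

/-- A weak antipode is determined by its two one-sided convolution products with the identity,
since `S = S * id * S`. -/
theorem antipode_unique {Δ : A →ₗ[k] A ⊗[k] A}
    (hΔ : ∀ a, TensorProduct.assoc k A A A (Δ.rTensor A (Δ a)) = Δ.lTensor A (Δ a))
    {S S' : A →ₗ[k] A} (hl : convolution Δ S .id = convolution Δ S' .id)
    (hr : convolution Δ .id S = convolution Δ .id S')
    (h : convolution Δ (convolution Δ S .id) S = S)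
    (h' : convolution Δ (convolution Δ S' .id) S' = S') : S = S' := by
  rw [← h, hl, convolution_assoc hΔ, hr, ← convolution_assoc hΔ, h']

theorem rid_lTensor_one_tmul_mul_sum {ι : Type*} (ε : A →ₗ[k] k) (a : A) (s : Finset ι) (c : ι → k)
    (x y : ι → A) : TensorProduct.rid k A (ε.lTensor A (((1 : A) ⊗ₜ[k] a) *
      ∑ i ∈ s, c i • (x i ⊗ₜ[k] y i))) = ∑ i ∈ s, (c i * ε (a * y i)) • x i := by
  simp only [Finset.mul_sum, map_sum, mul_smul_comm, Algebra.TensorProduct.tmul_mul_tmul, map_smul,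
    LinearMap.lTensor_tmul, TensorProduct.rid_tmul, one_mul, smul_smul]

theorem lid_rTensor_sum_mul_tmul_one {ι : Type*} (ε : A →ₗ[k] k) (a : A) (s : Finset ι) (c : ι → k)
    (x y : ι → A) : TensorProduct.lid k A (ε.rTensor A ((∑ i ∈ s, c i • (x i ⊗ₜ[k] y i)) *
      (a ⊗ₜ[k] (1 : A)))) = ∑ i ∈ s, (c i * ε (x i * a)) • y i := by
  simp only [Finset.sum_mul, map_sum, smul_mul_assoc, Algebra.TensorProduct.tmul_mul_tmul, map_smul,
    LinearMap.rTensor_tmul, TensorProduct.lid_tmul, mul_one, smul_smul]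

end convolution

namespace DoubleGroupoid
variable {P H V B : Type*} (T : DoubleGroupoid P H V B)

section boxes
variable {T} {A X : B} {x : H}

theorem boxInv_hmul {Y : B} (h : T.hor.tgt X = T.hor.src Y) :
    T.boxInv (T.hor.mul X Y) = T.hor.mul (T.boxInv Y) (T.boxInv X) := by
  rw [boxInv, T.hor.inv_mul_rev h, T.ver_inv_hmul (by rw [T.hor.tgt_inv, T.hor.src_inv, h])]
  rfl

theorem phi_val (hA : T.sideH.IsId (T.top A)) :
    (T.phi A hA).1 = T.ver.mul (T.boxInv A) (T.hor.idn (T.hor.tgt A)) := by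
  exact T.ver.comp_eq_mul _

theorem psi_val (hA : T.sideH.IsId (T.bot A)) :
    (T.psi A hA).1 = T.ver.mul (T.hor.idn (T.hor.src A)) (T.boxInv A) := by
  exact T.ver.comp_eq_mul _

/-- A term `(x, X)` of `Δ(1)` contributes to `ε_s(A)` only if `t(A)` is trivial, and then `X` is
`id x | φ(A)`. -/
theorem source_factor (hl : T.hor.src X = T.sideV.idn (T.sideH.src x))
    (h₁ : T.ver.tgt A = T.ver.src (T.hor.mul (T.hor.inv X) (T.ver.idn x)))
    (h₂ : T.hor.IsId (T.ver.mul A (T.hor.mul (T.hor.inv X) (T.ver.idn x)))) :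
    T.sideH.IsId (T.ver.src A) ∧ T.sideH.tgt x = T.br A ∧
      T.br (T.hor.mul (T.hor.inv X) (T.ver.idn x)) = T.br X ∧
      X = T.hor.mul (T.ver.idn x) (T.ver.mul (T.boxInv A) (T.hor.idn (T.hor.tgt A))) := by
  obtain ⟨g, hg⟩ := h₂
  set Y := T.hor.mul (T.hor.inv X) (T.ver.idn x) with hY
  have lx : T.hor.src X = T.hor.src (T.ver.idn x) := by grind
  have tA : T.ver.src A = T.sideH.idn (T.sideV.src g) := by
    rw [← T.top_hor_idn, ← hg]; grind
  have rY : T.hor.tgt Y = T.sideV.idn (T.sideH.tgt x) := by grind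
  have bY : T.ver.tgt Y = T.sideH.idn (T.sideV.tgt g) := by
    rw [← T.bot_hor_idn, ← hg, T.ver.tgt_mul h₁]
  have g1 : g = T.hor.tgt A := by
    rw [← T.hor.tgt_idn g, ← hg, T.right_vmul h₁, rY, T.sideV.mul_idn]
    grind
  have rx : T.sideH.tgt x = T.br A := by
    rw [br, h₁]; grind
  have Y1 : Y = T.ver.mul (T.ver.inv A) (T.hor.idn (T.hor.tgt A)) := by
    rw [← g1, ← hg]; grind
  have X1 : X = T.hor.mul (T.ver.idn x) (T.hor.inv Y) := by
    rw [hY, T.hor.inv_mul_rev (by grind), T.hor.inv_inv]; grind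
  have hYi : T.hor.inv Y = T.ver.mul (T.boxInv A) (T.hor.idn (T.hor.tgt A)) := by
    rw [Y1, T.hor_inv_vmul (by grind), T.hor_inv_ver_inv, T.hor.inv_idn]
  refine ⟨⟨_, tA⟩, rx, ?_, hYi ▸ X1⟩
  have e1 : T.sideH.src (T.ver.tgt Y) = T.br X := by
    rw [br, T.corner_bl, T.corner_br]; grind
  rw [← e1, br, bY]; grind

/-- Conversely, the box `id x | φ(A)` does contribute to `ε_s(A)`. -/
theorem factor_source (hA : T.sideH.IsId (T.ver.src A)) (hx : T.sideH.tgt x = T.br A)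
    (hX : X = T.hor.mul (T.ver.idn x) (T.ver.mul (T.boxInv A) (T.hor.idn (T.hor.tgt A)))) :
    T.hor.src X = T.sideV.idn (T.sideH.src x) ∧
    T.ver.tgt A = T.ver.src (T.hor.mul (T.hor.inv X) (T.ver.idn x)) ∧
    T.hor.IsId (T.ver.mul A (T.hor.mul (T.hor.inv X) (T.ver.idn x))) := by
  obtain ⟨p, hp⟩ := hA
  have h0 : T.ver.tgt (T.ver.inv A) = T.ver.src (T.hor.idn (T.hor.tgt A)) := by grind
  set Y := T.ver.mul (T.ver.inv A) (T.hor.idn (T.hor.tgt A)) with hY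
  have hYi : T.hor.inv Y = T.ver.mul (T.boxInv A) (T.hor.idn (T.hor.tgt A)) := by
    rw [hY, T.hor_inv_vmul (by grind), T.hor_inv_ver_inv, T.hor.inv_idn]
  rw [← hYi] at hX
  have rY : T.hor.tgt Y = T.sideV.idn (T.sideH.tgt x) := by
    rw [hY, T.right_vmul h0]; grind
  have c : T.hor.tgt (T.ver.idn x) = T.hor.src (T.hor.inv Y) := by grind
  have e : T.hor.mul (T.hor.inv X) (T.ver.idn x) = Y := by
    rw [hX, T.hor.inv_mul_rev c, T.hor.inv_inv]; grind
  refine ⟨by rw [hX, T.hor.src_mul c, T.left_ver_idn], ?_, ?_⟩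
  · rw [e, hY]; grind
  · rw [e, hY]
    exact ⟨T.hor.tgt A, by grind⟩

/-- A term `(x, X)` of `Δ(1)` contributes to `ε_t(A)` only if `b(A)` is trivial, and then `X` is the
horizontal reflection of `ψ(A)`. -/
theorem target_factor (hl : T.hor.src X = T.sideV.idn (T.sideH.src x))
    (h₁ : T.ver.tgt X = T.ver.src A) (h₂ : T.hor.IsId (T.ver.mul X A)) :
    T.sideH.IsId (T.ver.tgt A) ∧ T.sideH.src x = T.sideH.src (T.ver.src A) ∧
      X = T.ver.mul (T.hor.idn (T.hor.src A)) (T.ver.inv A) := by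
  obtain ⟨g, hg⟩ := h₂
  have bA : T.ver.tgt A = T.sideH.idn (T.sideV.tgt g) := by
    rw [← T.bot_hor_idn, ← hg]; grind
  have lx : T.sideH.src x = T.sideH.src (T.ver.src A) := by
    rw [← h₁, T.corner_bl, hl, T.sideV.tgt_idn]
  have g1 : g = T.hor.src A := by
    rw [← T.hor.src_idn g, ← hg, T.left_vmul h₁, hl, T.sideV.idn_mul]
    grind
  refine ⟨⟨_, bA⟩, lx, ?_⟩
  rw [← g1, ← hg]; grind

/-- Conversely, the horizontal reflection of `ψ(A)` does contribute to `ε_t(A)`. -/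
theorem factor_target (hA : T.sideH.IsId (T.ver.tgt A))
    (hx : T.sideH.src x = T.sideH.src (T.ver.src A))
    (hX : X = T.ver.mul (T.hor.idn (T.hor.src A)) (T.ver.inv A)) :
    T.hor.src X = T.sideV.idn (T.sideH.src x) ∧ T.ver.tgt X = T.ver.src A ∧
      T.hor.IsId (T.ver.mul X A) := by
  obtain ⟨p, hp⟩ := hA
  have h0 : T.ver.tgt (T.hor.idn (T.hor.src A)) = T.ver.src (T.ver.inv A) := by grind
  refine ⟨?_, ?_, T.hor.src A, ?_⟩
  · rw [hX, T.left_vmul h0, T.hor.src_idn, T.left_vinv, T.sideV.mul_inv, hx, T.corner_tl]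
  · rw [hX]; grind
  · rw [hX]; grind

theorem hor_inv_vmul_target (hA : T.sideH.IsId (T.ver.tgt A)) :
    T.hor.inv (T.ver.mul (T.hor.idn (T.hor.src A)) (T.ver.inv A)) =
      T.ver.mul (T.hor.idn (T.hor.src A)) (T.boxInv A) := by
  obtain ⟨p, hp⟩ := hA
  rw [T.hor_inv_vmul (by grind), T.hor.inv_idn, T.hor_inv_ver_inv]

/-- `X` on top of `(X^h A)⁻¹` is `ψ(A) | id t(X)`. -/
theorem vmul_boxInv (hl : T.hor.src X = T.hor.src A) (hA : T.sideH.IsId (T.ver.tgt A)) :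
    T.ver.tgt X = T.ver.src (T.boxInv (T.hor.mul (T.hor.inv X) A)) ∧
    T.ver.mul X (T.boxInv (T.hor.mul (T.hor.inv X) A)) = T.hor.mul
      (T.ver.mul (T.hor.idn (T.hor.src A)) (T.boxInv A)) (T.ver.idn (T.ver.src X)) := by
  obtain ⟨p, hp⟩ := hA
  have h1 : T.hor.mul (T.hor.idn (T.hor.src A)) X = X := by grind
  have h2 : T.boxInv (T.hor.mul (T.hor.inv X) A) = T.hor.mul (T.boxInv A) (T.ver.inv X) := by grind
  rw [h2]
  refine ⟨by grind, ?_⟩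
  nth_rw 1 [← h1]
  rw [T.interchange_mul] <;> grind

/-- `X⁻¹` on top of `Y = X^h A` is `id b(Y) | φ(A)`. -/
theorem boxInv_vmul (hl : T.hor.src X = T.hor.src A) (hA : T.sideH.IsId (T.ver.src A)) :
    T.ver.tgt (T.boxInv X) = T.ver.src (T.hor.mul (T.hor.inv X) A) ∧
    T.ver.mul (T.boxInv X) (T.hor.mul (T.hor.inv X) A) = T.hor.mul
      (T.ver.idn (T.ver.tgt (T.hor.mul (T.hor.inv X) A)))
      (T.ver.mul (T.boxInv A) (T.hor.idn (T.hor.tgt A))) := by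
  obtain ⟨p, hp⟩ := hA
  set Y := T.hor.mul (T.hor.inv X) A with hY
  have h1 : T.hor.mul Y (T.hor.idn (T.hor.tgt A)) = Y := by grind
  have h2 : T.boxInv X = T.hor.mul (T.ver.inv Y) (T.boxInv A) := by
    have e : X = T.hor.mul A (T.hor.inv Y) := by grind
    rw [e, boxInv_hmul (by grind), boxInv, T.hor.inv_inv]
  rw [h2]
  refine ⟨by grind, ?_⟩
  nth_rw 2 [← h1]
  rw [T.interchange_mul] <;> grind

/-- `id b(Y)⁻¹ | φ(X)` on top of `Y⁻¹`, for `A = XY`, is `A⁻¹`. -/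
theorem phi_vmul_boxInv (hl : T.hor.src X = T.hor.src A) (hX : T.sideH.IsId (T.ver.src X)) :
    T.ver.mul (T.hor.mul (T.ver.idn (T.ver.src (T.boxInv (T.hor.mul (T.hor.inv X) A))))
      (T.ver.mul (T.boxInv X) (T.hor.idn (T.hor.tgt X))))
      (T.boxInv (T.hor.mul (T.hor.inv X) A)) = T.boxInv A := by
  obtain ⟨p, hp⟩ := hX
  set Y := T.hor.mul (T.hor.inv X) A with hY
  have hXY : T.hor.tgt X = T.hor.src Y := by grind
  have h1 : T.hor.mul (T.boxInv Y) (T.hor.idn (T.sideV.inv (T.hor.src Y))) = T.boxInv Y := by grind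
  have h2 : T.boxInv A = T.hor.mul (T.boxInv Y) (T.boxInv X) := by
    rw [← boxInv_hmul hXY, hY, T.hor.mul_mul_inv hl]
  have h3 : T.ver.tgt (T.boxInv X) = T.ver.src (T.hor.idn (T.hor.tgt X)) := by grind
  have h4 : T.ver.mul (T.ver.mul (T.boxInv X) (T.hor.idn (T.hor.tgt X)))
      (T.hor.idn (T.sideV.inv (T.hor.src Y))) = T.boxInv X := by
    rw [T.ver.mul_assoc h3 (by grind), ← T.hor_idn_mul (by grind), ← hXY, T.sideV.mul_inv,
      ← T.idn_idn, T.ver.mul_idn (by rw [h3, T.top_hor_idn])]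
  nth_rw 2 [← h1]
  rw [T.interchange_mul, h2, h4]
  all_goals grind

end boxes
end DoubleGroupoid

/-! ### Source and target maps, and the antipode -/

namespace DoubleGroupoid
variable {P H V B : Type*} (T : DoubleGroupoid P H V B)

section sourceTarget
variable (k : Type*) [Field k] [Fintype H]

open Classical in
theorem oneD_eq_sum (D : T.CoreD) : T.oneD k D =
    ∑ z ∈ (Finset.univ : Finset H).filter (fun z => T.sideH.tgt z = T.sideH.src (T.ver.src D.1)),
      T.ofBox k (T.hor.mul (T.ver.idn z) D.1) := by
  rw [Finset.sum_subtype (p := fun z => T.sideH.tgt z = T.coreD.tgt D)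
    (F := Subtype.fintype _) _ (fun z => by simp; rfl)]
  exact Fintype.sum_congr _ _ fun z => congrArg _ (T.hor.comp_eq_mul _)

open Classical in
theorem oneE_eq_sum (E : T.CoreE) : T.oneE k E =
    ∑ x ∈ (Finset.univ : Finset H).filter (fun x => T.sideH.src x = T.br E.1),
      T.ofBox k (T.hor.mul E.1 (T.ver.idn x)) := by
  rw [Finset.sum_subtype (p := fun z => T.sideH.src z = T.coreE.tgt E)
    (F := Subtype.fintype _) _ (fun z => by simp; rfl)]
  exact Fintype.sum_congr _ _ fun z => congrArg _ (T.hor.comp_eq_mul _)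

open Classical in
theorem oneD_phi (A : B) (hA : T.sideH.IsId (T.ver.src A)) : T.oneD k (T.phi A hA) =
    ∑ z ∈ (Finset.univ : Finset H).filter (fun z => T.sideH.tgt z = T.br A),
      T.ofBox k (T.hor.mul (T.ver.idn z)
        (T.ver.mul (T.boxInv A) (T.hor.idn (T.hor.tgt A)))) := by
  have h : T.sideH.src (T.ver.src (T.phi A hA).1) = T.br A := by
    obtain ⟨p, hp⟩ := id hA
    rw [phi_val, T.ver.src_mul] <;> grind
  rw [oneD_eq_sum, h, phi_val]

open Classical in
theorem oneE_psi (A : B) (hA : T.sideH.IsId (T.ver.tgt A)) : T.oneE k (T.psi A hA) =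
    ∑ x ∈ (Finset.univ : Finset H).filter (fun x => T.sideH.src x = T.sideH.src (T.ver.src A)),
      T.ofBox k (T.hor.mul
        (T.ver.mul (T.hor.idn (T.hor.src A)) (T.boxInv A)) (T.ver.idn x)) := by
  have h : T.br (T.psi A hA).1 = T.sideH.src (T.ver.src A) := by
    obtain ⟨p, hp⟩ := id hA
    rw [br, psi_val, T.ver.tgt_mul] <;> grind
  rw [oneE_eq_sum, h, psi_val]

variable [Fintype B]

theorem source_ofBox [CharZero k] (A : B) (hA : T.sideH.IsId (T.ver.src A)) :
    TensorProduct.rid k (T.Alg k) ((T.counit k).lTensor (T.Alg k)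
      (((1 : T.Alg k) ⊗ₜ[k] T.ofBox k A) * T.comul k 1)) = T.oneD k (T.phi A hA) := by
  classical
  rw [comul_one]
  refine (rid_lTensor_one_tmul_mul_sum _ _ _ _ _ _).trans ?_
  rw [oneD_phi, ← Finset.sum_filter_of_ne (p := fun q : H × B =>
    T.ver.tgt A = T.ver.src (T.hor.mul (T.hor.inv q.2) (T.ver.idn q.1)) ∧
    T.hor.IsId (T.ver.mul A (T.hor.mul (T.hor.inv q.2) (T.ver.idn q.1))))]
  · refine Finset.sum_nbij' Prod.fst (fun x => (x, T.hor.mul (T.ver.idn x)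
        (T.ver.mul (T.boxInv A) (T.hor.idn (T.hor.tgt A))))) ?_ ?_ ?_ ?_ ?_
    all_goals simp only [Finset.mem_filter, Finset.mem_univ, true_and, Prod.forall, Prod.mk.injEq]
    · rintro x X ⟨h1, h2, h3⟩
      exact (source_factor h1 h2 h3).2.1
    · intro x hx
      exact factor_source hA hx rfl
    · rintro x X ⟨h1, h2, h3⟩
      exact (source_factor h1 h2 h3).2.2.2.symm
    · intros; trivial
    · rintro x X ⟨h1, h2, h3⟩
      have h := source_factor h1 h2 h3
      rw [← h.2.2.2, counit_ofBox_mul_ofBox, if_pos ⟨h2, h3⟩, h.2.2.1,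
        inv_mul_cancel₀ (T.cast_theta_ne_zero k _), one_smul]
  · intro q _ hne
    by_contra h
    rw [counit_ofBox_mul_ofBox, if_neg h, mul_zero, zero_smul] at hne
    exact hne rfl

theorem source_ofBox_eq_zero (A : B) (hA : ¬ T.sideH.IsId (T.ver.src A)) :
    TensorProduct.rid k (T.Alg k) ((T.counit k).lTensor (T.Alg k)
      (((1 : T.Alg k) ⊗ₜ[k] T.ofBox k A) * T.comul k 1)) = 0 := by
  classical
  rw [comul_one]
  refine (rid_lTensor_one_tmul_mul_sum _ _ _ _ _ _).trans (Finset.sum_eq_zero fun q hq => ?_)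
  rw [counit_ofBox_mul_ofBox, if_neg, mul_zero, zero_smul]
  exact fun h => hA (source_factor (Finset.mem_filter.1 hq).2 h.1 h.2).1

theorem target_ofBox (A : B) (hA : T.sideH.IsId (T.ver.tgt A)) :
    TensorProduct.lid k (T.Alg k) ((T.counit k).rTensor (T.Alg k)
      (T.comul k 1 * (T.ofBox k A ⊗ₜ[k] (1 : T.Alg k)))) =
    ((T.boxTL A : k) / (T.boxBL A : k)) • T.oneE k (T.psi A hA) := by
  classical
  rw [comul_one]
  refine (lid_rTensor_sum_mul_tmul_one _ _ _ _ _ _).trans ?_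
  rw [oneE_psi, Finset.smul_sum, ← Finset.sum_filter_of_ne (p := fun q : H × B =>
    T.ver.tgt q.2 = T.ver.src A ∧ T.hor.IsId (T.ver.mul q.2 A))]
  · refine Finset.sum_nbij' Prod.fst
      (fun x => (x, T.ver.mul (T.hor.idn (T.hor.src A)) (T.ver.inv A))) ?_ ?_ ?_ ?_ ?_
    all_goals simp only [Finset.mem_filter, Finset.mem_univ, true_and, Prod.forall, Prod.mk.injEq]
    · rintro x X ⟨h1, h2, h3⟩
      exact (target_factor h1 h2 h3).2.1
    · intro x hx
      exact factor_target hA hx rfl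
    · rintro x X ⟨h1, h2, h3⟩
      exact (target_factor h1 h2 h3).2.2.symm
    · intros; trivial
    · rintro x X ⟨h1, h2, h3⟩
      have h := target_factor h1 h2 h3
      rw [counit_ofBox_mul_ofBox, if_pos ⟨h2, h3⟩, boxTL_eq_theta, boxBL_eq_theta,
        ← hor_inv_vmul_target hA, ← h.2.2, br, h2, div_eq_inv_mul]
  · intro q _ hne
    by_contra h
    rw [counit_ofBox_mul_ofBox, if_neg h, mul_zero, zero_smul] at hne
    exact hne rfl

theorem target_ofBox_eq_zero (A : B) (hA : ¬ T.sideH.IsId (T.ver.tgt A)) :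
    TensorProduct.lid k (T.Alg k) ((T.counit k).rTensor (T.Alg k)
      (T.comul k 1 * (T.ofBox k A ⊗ₜ[k] (1 : T.Alg k)))) = 0 := by
  classical
  rw [comul_one]
  refine (lid_rTensor_sum_mul_tmul_one _ _ _ _ _ _).trans (Finset.sum_eq_zero fun q hq => ?_)
  rw [counit_ofBox_mul_ofBox, if_neg, mul_zero, zero_smul]
  exact fun h => hA (target_factor (Finset.mem_filter.1 hq).2 h.1 h.2).1

end sourceTarget

section antipode

variable {T} in
/-- The bottom side of `φ(X)` is trivial, so the summand of `_{φ(X)} 1` given by `z` has bottom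
side `z`. -/
theorem bot_idn_hmul_phi {X : B} (hX : T.sideH.IsId (T.ver.src X)) {z : H}
    (hz : T.sideH.tgt z = T.br X) : T.ver.tgt (T.hor.mul (T.ver.idn z)
      (T.ver.mul (T.boxInv X) (T.hor.idn (T.hor.tgt X)))) = z := by
  obtain ⟨p, hp⟩ := hX
  have h : T.ver.tgt (T.boxInv X) = T.ver.src (T.hor.idn (T.hor.tgt X)) := by grind
  rw [T.bot_hmul (by grind)]
  grind

variable {k : Type*} [Field k] [Fintype H] [Fintype B]

open Classical in
theorem mul_lTensor_antipode (A : B) :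
    LinearMap.mul' k (T.Alg k) (T.antipode.lTensor (T.Alg k) (T.comul k (T.ofBox k A))) =
    ∑ X ∈ (Finset.univ : Finset B).filter (fun X => T.hor.src X = T.hor.src A),
      ((T.theta (T.br X) : k)⁻¹ * ((T.theta (T.br A) : k) /
        (T.theta (T.sideH.tgt (T.ver.src A)) : k))) •
      (T.ofBox k X * T.ofBox k (T.boxInv (T.hor.mul (T.hor.inv X) A))) := by
  rw [comul_ofBox, map_sum, map_sum]
  refine Finset.sum_congr rfl fun X hX => ?_
  have hX := (Finset.mem_filter.1 hX).2
  have h1 : T.br (T.hor.mul (T.hor.inv X) A) = T.br A := by simp only [br]; grind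
  have h2 : T.sideH.tgt (T.ver.src (T.hor.mul (T.hor.inv X) A)) = T.sideH.tgt (T.ver.src A) := by
    grind
  rw [map_smul, map_smul, LinearMap.lTensor_tmul, antipode_ofBox_eq_theta, h1, h2,
    LinearMap.mul'_apply, mul_smul_comm, smul_smul]

open Classical in
theorem mul_rTensor_antipode [CharZero k] (A : B) :
    LinearMap.mul' k (T.Alg k) (T.antipode.rTensor (T.Alg k) (T.comul k (T.ofBox k A))) =
    ∑ X ∈ (Finset.univ : Finset B).filter (fun X => T.hor.src X = T.hor.src A),
      (T.theta (T.sideH.tgt (T.ver.src X)) : k)⁻¹ •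
      (T.ofBox k (T.boxInv X) * T.ofBox k (T.hor.mul (T.hor.inv X) A)) := by
  rw [comul_ofBox, map_sum, map_sum]
  refine Finset.sum_congr rfl fun X hX => ?_
  rw [map_smul, map_smul, LinearMap.rTensor_tmul, antipode_ofBox_eq_theta, LinearMap.mul'_apply,
    smul_mul_assoc, smul_smul, div_eq_mul_inv, inv_mul_cancel_left₀ (T.cast_theta_ne_zero k _)]

variable {T}

/-- The terms of `A₁ S(A₂)` with the same top side of the first factor are multiples of one box,
with weights that add up to one. -/
theorem Filling.mul_id_antipode [CharZero k] (hT : T.Filling) (A : B)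
    (hA : T.sideH.IsId (T.ver.tgt A)) :
    LinearMap.mul' k (T.Alg k) (T.antipode.lTensor (T.Alg k) (T.comul k (T.ofBox k A))) =
    ((T.boxTL A : k) / (T.boxBL A : k)) • T.oneE k (T.psi A hA) := by
  classical
  rw [mul_lTensor_antipode, oneE_psi, boxTL_eq_theta, boxBL_eq_theta, Finset.smul_sum,
    ← Finset.sum_fiberwise_of_maps_to (g := fun X => T.ver.src X)
      (t := Finset.univ.filter fun x => T.sideH.src x = T.sideH.src (T.ver.src A))]
  · refine Finset.sum_congr rfl fun x hx => ?_
    have hx := (Finset.mem_filter.1 hx).2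
    rw [Finset.filter_filter, Finset.sum_congr rfl (g := fun X => (T.theta (T.br X) : k)⁻¹ •
      (((T.theta (T.br A) : k) / (T.theta (T.sideH.tgt (T.ver.src A)) : k)) • T.ofBox k (T.hor.mul
        (T.ver.mul (T.hor.idn (T.hor.src A)) (T.boxInv A)) (T.ver.idn x))))]
    · rw [← Finset.sum_smul, hT.sum_left_top k (by rw [hx, T.corner_tl]), one_smul]
    · intro X hX
      obtain ⟨-, h1, rfl⟩ := Finset.mem_filter.1 hX
      have h := vmul_boxInv h1 hA
      rw [T.ofBox_mul_ofBox h.1, h.2, smul_smul]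
  · intro X hX
    have hX := (Finset.mem_filter.1 hX).2
    rw [Finset.mem_filter, T.corner_tl, T.corner_tl, hX]
    exact ⟨Finset.mem_univ _, rfl⟩

theorem mul_id_antipode_eq_zero (A : B) (hA : ¬ T.sideH.IsId (T.ver.tgt A)) :
    LinearMap.mul' k (T.Alg k) (T.antipode.lTensor (T.Alg k) (T.comul k (T.ofBox k A))) = 0 := by
  classical
  rw [mul_lTensor_antipode]
  refine Finset.sum_eq_zero fun X hX => ?_
  have hX := (Finset.mem_filter.1 hX).2
  rw [T.ofBox_mul_ofBox_eq_zero, smul_zero]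
  intro h
  refine hA ⟨T.sideH.src (T.ver.tgt X), ?_⟩
  have e : T.ver.src (T.boxInv (T.hor.mul (T.hor.inv X) A)) =
    T.sideH.mul (T.sideH.inv (T.ver.tgt A)) (T.ver.tgt X) := by grind
  exact T.sideH.eq_idn_of_mul_eq_right (by grind) (by grind)

variable [CharZero k]

/-- The terms of `S(A₁) A₂` with the same bottom side of the second factor are multiples of one box,
with weights that add up to one. Since that bottom side is `b(X)⁻¹ b(A)`, fixing it amounts to
fixing `b(X)`. -/
theorem Filling.mul_antipode_id (hT : T.Filling) (A : B) (hA : T.sideH.IsId (T.ver.src A)) :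
    LinearMap.mul' k (T.Alg k) (T.antipode.rTensor (T.Alg k) (T.comul k (T.ofBox k A))) =
    T.oneD k (T.phi A hA) := by
  classical
  rw [mul_rTensor_antipode, oneD_phi,
    ← Finset.sum_fiberwise_of_maps_to (g := fun X => T.ver.tgt (T.hor.mul (T.hor.inv X) A))
      (t := Finset.univ.filter fun z => T.sideH.tgt z = T.br A)]
  · refine Finset.sum_congr rfl fun z hz => ?_
    have hz := (Finset.mem_filter.1 hz).2
    rw [Finset.filter_filter, Finset.sum_congr (s₂ := Finset.univ.filter fun X =>
        T.hor.src X = T.hor.src A ∧ T.ver.tgt X = T.sideH.mul (T.ver.tgt A) (T.sideH.inv z))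
      (g := fun X => (T.theta (T.sideH.tgt (T.ver.src X)) : k)⁻¹ • T.ofBox k (T.hor.mul
        (T.ver.idn z) (T.ver.mul (T.boxInv A) (T.hor.idn (T.hor.tgt A)))))]
    · rw [← Finset.sum_smul, hT.sum_left_bot k (by grind), one_smul]
    · ext X
      simp only [Finset.mem_filter, Finset.mem_univ, true_and, and_congr_right_iff]
      intro h1
      have e : T.ver.tgt (T.hor.mul (T.hor.inv X) A) =
        T.sideH.mul (T.sideH.inv (T.ver.tgt X)) (T.ver.tgt A) := by grind
      have e1 : T.sideH.src (T.ver.tgt X) = T.sideH.src (T.ver.tgt A) := by grind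
      rw [e]
      constructor
      · rintro rfl
        grind
      · intro e2
        rw [e2]
        grind
    · intro X hX
      obtain ⟨-, h1, h2⟩ := Finset.mem_filter.1 hX
      have h3 : T.ver.tgt (T.hor.mul (T.hor.inv X) A) = z := by
        have e : T.ver.tgt (T.hor.mul (T.hor.inv X) A) =
          T.sideH.mul (T.sideH.inv (T.ver.tgt X)) (T.ver.tgt A) := by grind
        rw [e, h2]
        grind
      have h := boxInv_vmul h1 hA
      rw [T.ofBox_mul_ofBox h.1, h.2, h3]
  · intro X hX
    have hX := (Finset.mem_filter.1 hX).2
    simp only [Finset.mem_filter, Finset.mem_univ, true_and, br]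
    grind

theorem mul_antipode_id_eq_zero (A : B) (hA : ¬ T.sideH.IsId (T.ver.src A)) :
    LinearMap.mul' k (T.Alg k) (T.antipode.rTensor (T.Alg k) (T.comul k (T.ofBox k A))) = 0 := by
  classical
  rw [mul_rTensor_antipode]
  refine Finset.sum_eq_zero fun X hX => ?_
  have hX := (Finset.mem_filter.1 hX).2
  rw [T.ofBox_mul_ofBox_eq_zero, smul_zero]
  intro h
  refine hA ⟨T.sideH.tgt (T.sideH.inv (T.ver.src X)), ?_⟩
  have e : T.ver.src (T.hor.mul (T.hor.inv X) A) =
    T.sideH.mul (T.sideH.inv (T.ver.src X)) (T.ver.src A) := by grind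
  exact T.sideH.eq_idn_of_mul_eq_left (by grind) (by grind)

/-- The identity `S * id * S = S`. In `(S * id)(X) S(Y)` for `A = XY` only the factors `X` with
trivial top side contribute, and of the summands of `_{φ(X)} 1` only one composes with `Y⁻¹`, the
result being `A⁻¹`. The weights of these `X` add up to one. -/
theorem Filling.antipode_id_antipode (hT : T.Filling) (a : T.Alg k) :
    convolution (T.comul k) (convolution (T.comul k) T.antipode .id) T.antipode a =
      T.antipode a := by
  classical
  refine LinearMap.congr_fun (T.ext_ofBox fun A => ?_) a
  rw [convolution_apply, comul_ofBox, map_sum, map_sum,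
    ← Finset.sum_filter_of_ne (p := fun X => T.ver.src X =
      T.sideH.idn (T.sideH.src (T.ver.src A)))]
  · rw [Finset.filter_filter, Finset.sum_congr rfl (g := fun X => (T.theta (T.br X) : k)⁻¹ •
      T.antipode (T.ofBox k A))]
    · rw [← Finset.sum_smul, hT.sum_left_top k (by rw [T.sideH.src_idn, T.corner_tl]), one_smul]
    · intro X hX
      obtain ⟨-, h1, h2⟩ := Finset.mem_filter.1 hX
      have hX : T.sideH.IsId (T.ver.src X) := ⟨_, h2⟩
      have e1 : T.br (T.hor.mul (T.hor.inv X) A) = T.br A := by simp only [br]; grind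
      have e2 : T.sideH.tgt (T.ver.src (T.hor.mul (T.hor.inv X) A)) =
        T.sideH.tgt (T.ver.src A) := by grind
      have e3 : convolution (T.comul k) T.antipode .id (T.ofBox k X) = T.oneD k (T.phi X hX) :=
        hT.mul_antipode_id X hX
      rw [map_smul, map_smul, TensorProduct.map_tmul, LinearMap.mul'_apply, e3,
        antipode_ofBox_eq_theta, antipode_ofBox_eq_theta, e1, e2, mul_smul_comm, oneD_phi,
        Finset.sum_mul]
      congr 2
      rw [Finset.sum_eq_single_of_mem (T.ver.src (T.boxInv (T.hor.mul (T.hor.inv X) A)))]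
      · rw [T.ofBox_mul_ofBox, phi_vmul_boxInv h1 hX]
        refine bot_idn_hmul_phi hX ?_
        simp only [br]; grind
      · simp only [Finset.mem_filter, Finset.mem_univ, true_and, br]
        grind
      · intro z hz hne
        rw [T.ofBox_mul_ofBox_eq_zero]
        rwa [bot_idn_hmul_phi hX (Finset.mem_filter.1 hz).2]
  · intro X hX hne
    have hX := (Finset.mem_filter.1 hX).2
    by_contra h
    have hX' : ¬ T.sideH.IsId (T.ver.src X) := fun hi => h (by
      rw [T.corner_tl A, ← hX, ← T.corner_tl]; exact hi.eq_idn_src)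
    have e : convolution (T.comul k) T.antipode .id (T.ofBox k X) = 0 :=
      mul_antipode_id_eq_zero X hX'
    rw [map_smul, map_smul, TensorProduct.map_tmul, LinearMap.mul'_apply, e, zero_mul,
      smul_zero] at hne
    exact hne rfl

end antipode
end DoubleGroupoid

/-! ### The core groupoid algebras inside `kT` -/

namespace DoubleGroupoid
variable {P H V B : Type*} (T : DoubleGroupoid P H V B)

section cores
variable {T} {x y z : H}

theorem right_idn_eq_left (D : T.CoreD) (h : T.sideH.tgt z = T.sideH.src (T.ver.src D.1)) :
    T.hor.tgt (T.ver.idn z) = T.hor.src D.1 := coreD_row D.2.1 z h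

theorem right_eq_left_idn (E : T.CoreE) (h : T.br E.1 = T.sideH.src x) :
    T.hor.tgt E.1 = T.hor.src (T.ver.idn x) := coreE_row E.2.1 x h

theorem bot_idn_hmul (D : T.CoreD) (h : T.sideH.tgt z = T.sideH.src (T.ver.src D.1)) :
    T.ver.tgt (T.hor.mul (T.ver.idn z) D.1) = z := by
  have h1 := right_idn_eq_left D h
  have h2 : T.ver.tgt D.1 = T.sideH.idn (T.sideH.src (T.ver.src D.1)) := bot_eq_idn D.2.1 D.2.2
  rw [T.bot_hmul h1, h2, T.ver.tgt_idn, T.sideH.mul_idn h]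

theorem top_idn_hmul (D : T.CoreD) (h : T.sideH.tgt z = T.sideH.src (T.ver.src D.1)) :
    T.ver.src (T.hor.mul (T.ver.idn z) D.1) = T.sideH.mul z (T.ver.src D.1) := by
  rw [T.top_hmul (right_idn_eq_left D h), T.ver.src_idn]

theorem top_hmul_idn (E : T.CoreE) (h : T.br E.1 = T.sideH.src x) :
    T.ver.src (T.hor.mul E.1 (T.ver.idn x)) = x := by
  have h1 := right_eq_left_idn E h
  have h2 : T.ver.src E.1 = T.sideH.idn (T.br E.1) := top_eq_idn E.2.1 E.2.2
  rw [T.top_hmul h1, h2, T.ver.src_idn, T.sideH.idn_mul h]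

theorem bot_hmul_idn (E : T.CoreE) (h : T.br E.1 = T.sideH.src x) :
    T.ver.tgt (T.hor.mul E.1 (T.ver.idn x)) = T.sideH.mul (T.ver.tgt E.1) x := by
  rw [T.bot_hmul (right_eq_left_idn E h), T.ver.tgt_idn]

theorem coreD_comp_val (D L : T.CoreD) (h : T.coreD.tgt D = T.coreD.src L) :
    (T.coreD.comp D L h).1 =
      T.ver.mul (T.hor.mul (T.ver.idn (T.ver.src L.1)) D.1) L.1 := by
  refine (CoreD.comp_val D L h).trans ?_
  rw [T.ver.comp_eq_mul, T.hor.comp_eq_mul]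

theorem coreE_comp_val (M E : T.CoreE) (h : T.coreE.tgt M = T.coreE.src E) :
    (T.coreE.comp M E h).1 =
      T.ver.mul E.1 (T.hor.mul M.1 (T.ver.idn (T.ver.tgt E.1))) := by
  refine (CoreE.comp_val M E h).trans ?_
  rw [T.ver.comp_eq_mul, T.hor.comp_eq_mul]

/-- The summand of `_D 1` given by `y t(L)` on top of the summand of `_L 1` given by `y` is the
summand of `_{D ⋄ L} 1` given by `y`. -/
theorem idn_hmul_vmul_idn_hmul (D L : T.CoreD) (h : T.coreD.tgt D = T.coreD.src L)
    (hy : T.sideH.tgt y = T.sideH.src (T.ver.src L.1)) :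
    T.ver.mul (T.hor.mul (T.ver.idn (T.sideH.mul y (T.ver.src L.1))) D.1)
      (T.hor.mul (T.ver.idn y) L.1) = T.hor.mul (T.ver.idn y) (T.coreD.comp D L h).1 := by
  have h' : T.sideH.tgt (T.ver.src L.1) = T.sideH.src (T.ver.src D.1) := h.symm
  have h1 := right_idn_eq_left D h'
  have h2 := right_idn_eq_left L hy
  have h3 : T.hor.tgt (T.ver.idn y) = T.hor.src (T.ver.idn (T.ver.src L.1)) := by
    rw [T.right_ver_idn, T.left_ver_idn, hy]
  have h4 : T.ver.tgt (T.hor.mul (T.ver.idn (T.ver.src L.1)) D.1) = T.ver.src L.1 :=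
    bot_idn_hmul D h'
  rw [coreD_comp_val, T.ver_idn_mul hy, T.hor.mul_assoc h3 h1,
    T.interchange_mul (by rw [T.hor.src_mul h1, h3]) h2 (by rw [T.ver.tgt_idn, T.ver.src_idn]) h4,
    T.ver.idn_mul (by rw [T.ver.src_idn])]

/-- The summand of `1_E` given by `x` on top of the summand of `1_M` given by `b(E) x` is the
summand of `1_{M ∘ E}` given by `x`. -/
theorem hmul_idn_vmul_hmul_idn (M E : T.CoreE) (h : T.coreE.tgt M = T.coreE.src E)
    (hx : T.br E.1 = T.sideH.src x) :
    T.ver.mul (T.hor.mul E.1 (T.ver.idn x))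
      (T.hor.mul M.1 (T.ver.idn (T.sideH.mul (T.ver.tgt E.1) x))) =
    T.hor.mul (T.coreE.comp M E h).1 (T.ver.idn x) := by
  have h1 := right_eq_left_idn M h
  have h2 := right_eq_left_idn E hx
  have h3 : T.hor.tgt (T.ver.idn (T.ver.tgt E.1)) = T.hor.src (T.ver.idn x) := by
    rw [T.right_ver_idn, T.left_ver_idn, ← hx]
  have h4 : T.ver.src (T.hor.mul M.1 (T.ver.idn (T.ver.tgt E.1))) = T.ver.tgt E.1 :=
    top_hmul_idn M h
  rw [coreE_comp_val, T.ver_idn_mul hx, ← T.hor.mul_assoc h1 h3,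
    T.interchange_mul h2 (by rw [T.hor.tgt_mul h1, h3]) h4.symm
      (by rw [T.ver.tgt_idn, T.ver.src_idn]),
    T.ver.idn_mul (by rw [T.ver.src_idn])]

end cores

section hom
variable (k : Type*) [Field k] [Fintype H]

open Classical in
theorem oneD_mul_oneD (D L : T.CoreD) : T.oneD k D * T.oneD k L =
    if h : T.coreD.tgt D = T.coreD.src L then T.oneD k (T.coreD.comp D L h) else 0 := by
  rw [oneD_eq_sum T k D, oneD_eq_sum T k L, Finset.sum_mul_sum, Finset.sum_comm]
  split_ifs with h
  · have e : T.sideH.src (T.ver.src (T.coreD.comp D L h).1) = T.sideH.src (T.ver.src L.1) :=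
      T.coreD.tgt_comp D L h
    rw [oneD_eq_sum, e]
    refine Finset.sum_congr rfl fun y hy => ?_
    have hy := (Finset.mem_filter.1 hy).2
    have hz : T.sideH.tgt (T.sideH.mul y (T.ver.src L.1)) = T.sideH.src (T.ver.src D.1) := by
      rw [T.sideH.tgt_mul hy]; exact h.symm
    rw [Finset.sum_eq_single_of_mem (T.sideH.mul y (T.ver.src L.1)) (by simpa using hz),
      T.ofBox_mul_ofBox (by rw [bot_idn_hmul D hz, top_idn_hmul L hy]),
      idn_hmul_vmul_idn_hmul D L h hy]
    intro z hz hne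
    have hz := (Finset.mem_filter.1 hz).2
    exact T.ofBox_mul_ofBox_eq_zero (by rwa [bot_idn_hmul D hz, top_idn_hmul L hy])
  · refine Finset.sum_eq_zero fun y hy => Finset.sum_eq_zero fun z hz => ?_
    have hy := (Finset.mem_filter.1 hy).2
    have hz := (Finset.mem_filter.1 hz).2
    refine T.ofBox_mul_ofBox_eq_zero fun e => h ?_
    rw [bot_idn_hmul D hz, top_idn_hmul L hy] at e
    refine hz.symm.trans ?_
    rw [e, T.sideH.tgt_mul hy]
    rfl

open Classical in
theorem oneE_mul_oneE (E M : T.CoreE) : T.oneE k E * T.oneE k M =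
    if h : T.coreE.tgt M = T.coreE.src E then T.oneE k (T.coreE.comp M E h) else 0 := by
  rw [oneE_eq_sum T k E, oneE_eq_sum T k M, Finset.sum_mul_sum]
  split_ifs with h
  · have e : T.br (T.coreE.comp M E h).1 = T.br E.1 := T.coreE.tgt_comp M E h
    rw [oneE_eq_sum, e]
    refine Finset.sum_congr rfl fun x hx => ?_
    have hx := (Finset.mem_filter.1 hx).2.symm
    have hy : T.br M.1 = T.sideH.src (T.sideH.mul (T.ver.tgt E.1) x) := by
      rw [T.sideH.src_mul hx]; exact h
    rw [Finset.sum_eq_single_of_mem (T.sideH.mul (T.ver.tgt E.1) x) (by simpa using hy.symm),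
      T.ofBox_mul_ofBox (by rw [bot_hmul_idn E hx, top_hmul_idn M hy]),
      hmul_idn_vmul_hmul_idn M E h hx]
    intro y hy hne
    have hy := (Finset.mem_filter.1 hy).2.symm
    exact T.ofBox_mul_ofBox_eq_zero (by rw [bot_hmul_idn E hx, top_hmul_idn M hy]; exact hne.symm)
  · refine Finset.sum_eq_zero fun x hx => Finset.sum_eq_zero fun y hy => ?_
    have hx := (Finset.mem_filter.1 hx).2.symm
    have hy := (Finset.mem_filter.1 hy).2.symm
    refine T.ofBox_mul_ofBox_eq_zero fun e => h ?_
    rw [bot_hmul_idn E hx, top_hmul_idn M hy] at e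
    refine hy.trans ?_
    rw [← e, T.sideH.src_mul hx]
    rfl

variable [Fintype P]

theorem sum_oneD_idn : ∑ p : P, T.oneD k (T.coreD.idn p) = 1 := by
  classical
  rw [one_eq_sum, ← Finset.sum_fiberwise (g := fun z : H => T.sideH.tgt z)]
  refine Finset.sum_congr rfl fun p _ => ?_
  have e : (T.coreD.idn p).1 = T.ver.idn (T.sideH.idn p) := rfl
  rw [oneD_eq_sum, e, T.ver.src_idn, T.sideH.src_idn]
  refine Finset.sum_congr rfl fun z hz => ?_
  rw [T.idn_idn, T.hor.mul_idn]
  rw [T.right_ver_idn, (Finset.mem_filter.1 hz).2]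

theorem sum_oneE_idn : ∑ p : P, T.oneE k (T.coreE.idn p) = 1 := by
  classical
  rw [one_eq_sum, ← Finset.sum_fiberwise (g := fun z : H => T.sideH.src z)]
  refine Finset.sum_congr rfl fun p _ => ?_
  have e : (T.coreE.idn p).1 = T.ver.idn (T.sideH.idn p) := rfl
  rw [oneE_eq_sum, br, e, T.ver.tgt_idn, T.sideH.tgt_idn]
  refine Finset.sum_congr rfl fun z hz => ?_
  rw [T.idn_idn, T.hor.idn_mul]
  rw [T.left_ver_idn, (Finset.mem_filter.1 hz).2]

/-- The algebra map `kD → kT`, `D ↦ _D 1`. -/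
def coreDHom : GroupoidAlgebra k T.coreD →ₐ[k] T.Alg k :=
  AlgHom.ofLinearMap ((GroupoidAlgebra.basis k T.coreD).constr k (T.oneD k))
    (by
      rw [GroupoidAlgebra.one_def, map_sum, ← sum_oneD_idn]
      exact Finset.sum_congr rfl fun p _ => Module.Basis.constr_basis _ _ _ _)
    (by
      have h : (LinearMap.mul k (GroupoidAlgebra k T.coreD)).compr₂
          ((GroupoidAlgebra.basis k T.coreD).constr k (T.oneD k)) =
        (LinearMap.mul k (T.Alg k)).compl₁₂
          ((GroupoidAlgebra.basis k T.coreD).constr k (T.oneD k))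
          ((GroupoidAlgebra.basis k T.coreD).constr k (T.oneD k)) := by
        classical
        refine (GroupoidAlgebra.basis k T.coreD).ext fun D =>
          (GroupoidAlgebra.basis k T.coreD).ext fun L => ?_
        rw [LinearMap.compr₂_apply, LinearMap.compl₁₂_apply, LinearMap.mul_apply',
          LinearMap.mul_apply', Module.Basis.constr_basis, Module.Basis.constr_basis,
          oneD_mul_oneD]
        refine (congrArg _ (GroupoidAlgebra.of_mul_of D L)).trans ?_
        split_ifs
        · exact Module.Basis.constr_basis _ _ _ _
        · exact map_zero _
      exact fun a b => LinearMap.congr_fun₂ h a b)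

theorem coreDHom_of (D : T.CoreD) :
    T.coreDHom k (GroupoidAlgebra.of k T.coreD D) = T.oneD k D :=
  (GroupoidAlgebra.basis k T.coreD).constr_basis k _ _

/-- The algebra map `(kE)ᵒᵖ → kT`, `E ↦ 1_E`. -/
def coreEHom : (GroupoidAlgebra k T.coreE)ᵐᵒᵖ →ₐ[k] T.Alg k :=
  AlgHom.ofLinearMap ((GroupoidAlgebra.basis k T.coreE).constr k (T.oneE k) ∘ₗ
      (MulOpposite.opLinearEquiv k).symm.toLinearMap)
    (by
      change (GroupoidAlgebra.basis k T.coreE).constr k (T.oneE k) 1 = 1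
      rw [GroupoidAlgebra.one_def, map_sum, ← sum_oneE_idn]
      exact Finset.sum_congr rfl fun p _ => Module.Basis.constr_basis _ _ _ _)
    (by
      have h : (LinearMap.mul k (GroupoidAlgebra k T.coreE)).compr₂
          ((GroupoidAlgebra.basis k T.coreE).constr k (T.oneE k)) =
        (LinearMap.mul k (T.Alg k)).flip.compl₁₂
          ((GroupoidAlgebra.basis k T.coreE).constr k (T.oneE k))
          ((GroupoidAlgebra.basis k T.coreE).constr k (T.oneE k)) := by
        classical
        refine (GroupoidAlgebra.basis k T.coreE).ext fun M =>
          (GroupoidAlgebra.basis k T.coreE).ext fun E => ?_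
        rw [LinearMap.compr₂_apply, LinearMap.compl₁₂_apply, LinearMap.flip_apply,
          LinearMap.mul_apply', LinearMap.mul_apply', Module.Basis.constr_basis,
          Module.Basis.constr_basis, oneE_mul_oneE]
        refine (congrArg _ (GroupoidAlgebra.of_mul_of M E)).trans ?_
        split_ifs
        · exact Module.Basis.constr_basis _ _ _ _
        · exact map_zero _
      exact fun a b => LinearMap.congr_fun₂ h b.unop a.unop)

theorem coreEHom_op_of (E : T.CoreE) :
    T.coreEHom k (MulOpposite.op (GroupoidAlgebra.of k T.coreE E)) = T.oneE k E :=
  (GroupoidAlgebra.basis k T.coreE).constr_basis k _ _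

/-- The only box of the core groupoid among the summands of `_D 1` is `D` itself, so the projection
of `kT` onto the span of the boxes of the core groupoid is a left inverse. -/
theorem coreDHom_injective : Function.Injective (T.coreDHom k) := by
  classical
  let g : T.Alg k →ₗ[k] GroupoidAlgebra k T.coreD :=
    (GroupoidAlgebra.basis k T.ver).constr k fun A =>
      if h : T.sideV.IsId (T.left A) ∧ T.sideH.IsId (T.bot A) then
        GroupoidAlgebra.of k T.coreD ⟨A, h⟩ else 0
  have hg : ∀ A, g (T.ofBox k A) = if h : T.sideV.IsId (T.left A) ∧ T.sideH.IsId (T.bot A) then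
      GroupoidAlgebra.of k T.coreD ⟨A, h⟩ else 0 := fun A => Module.Basis.constr_basis _ _ _ _
  have h : g ∘ₗ (T.coreDHom k).toLinearMap = LinearMap.id := by
    refine (GroupoidAlgebra.basis k T.coreD).ext fun D => ?_
    refine (congrArg g ((T.coreDHom_of k D).trans (T.oneD_eq_sum k D))).trans ?_
    rw [map_sum, Finset.sum_eq_single_of_mem (T.sideH.idn (T.sideH.src (T.ver.src D.1)))
      (by simp [T.sideH.tgt_idn])]
    · have e : T.hor.mul (T.ver.idn (T.sideH.idn (T.sideH.src (T.ver.src D.1)))) D.1 = D.1 := by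
        rw [T.idn_idn, T.hor.idn_mul (left_eq_idn D.2.1).symm]
      rw [e, hg, dif_pos D.2]
      rfl
    · intro z hz hne
      have hz := (Finset.mem_filter.1 hz).2
      rw [hg, dif_neg]
      rintro ⟨-, h⟩
      rw [bot, bot_idn_hmul D hz] at h
      exact hne (by rw [← hz]; exact h.eq_idn_tgt)
  exact fun a b hab => by
    have := congrArg g hab
    exact (LinearMap.congr_fun h a).symm.trans (this.trans (LinearMap.congr_fun h b))

/-- The only box of the core groupoid among the summands of `1_E` is `E` itself, so the projection
of `kT` onto the span of the boxes of the core groupoid is a left inverse. -/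
theorem coreEHom_injective : Function.Injective (T.coreEHom k) := by
  classical
  let g : T.Alg k →ₗ[k] GroupoidAlgebra k T.coreE :=
    (GroupoidAlgebra.basis k T.ver).constr k fun A =>
      if h : T.sideV.IsId (T.right A) ∧ T.sideH.IsId (T.top A) then
        GroupoidAlgebra.of k T.coreE ⟨A, h⟩ else 0
  have hg : ∀ A, g (T.ofBox k A) = if h : T.sideV.IsId (T.right A) ∧ T.sideH.IsId (T.top A) then
      GroupoidAlgebra.of k T.coreE ⟨A, h⟩ else 0 := fun A => Module.Basis.constr_basis _ _ _ _
  have h : g ∘ₗ (GroupoidAlgebra.basis k T.coreE).constr k (T.oneE k) = LinearMap.id := by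
    refine (GroupoidAlgebra.basis k T.coreE).ext fun E => ?_
    refine (congrArg g ((Module.Basis.constr_basis _ _ _ _).trans (T.oneE_eq_sum k E))).trans ?_
    rw [map_sum, Finset.sum_eq_single_of_mem (T.sideH.idn (T.br E.1)) (by simp [T.sideH.src_idn])]
    · have e : T.hor.mul E.1 (T.ver.idn (T.sideH.idn (T.br E.1))) = E.1 := by
        rw [T.idn_idn, T.hor.mul_idn (right_eq_idn E.2.1)]
      rw [e, hg, dif_pos E.2]
      rfl
    · intro x hx hne
      have hx := (Finset.mem_filter.1 hx).2.symm
      rw [hg, dif_neg]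
      rintro ⟨-, h⟩
      rw [top, top_hmul_idn E hx] at h
      exact hne (by rw [hx]; exact h.eq_idn_src)
  exact fun a b hab => by
    have := congrArg g hab
    exact MulOpposite.unop_injective
      ((LinearMap.congr_fun h a.unop).symm.trans (this.trans (LinearMap.congr_fun h b.unop)))

end hom

section surjective
variable {T}

/-- Every `D ∈ D` is `φ(D⁻¹)`. -/
theorem exists_phi_eq (D : T.CoreD) :
    ∃ (A : B) (hA : T.sideH.IsId (T.top A)), T.phi A hA = D := by
  have h0 : T.sideH.IsId (T.top (T.boxInv D.1)) := by rw [T.top_boxInv]; exact D.2.2.inv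
  refine ⟨T.boxInv D.1, h0, Subtype.ext ?_⟩
  have h1 : T.hor.tgt (T.boxInv D.1) = T.sideV.idn (T.sideH.src (T.ver.src D.1)) := by
    refine (T.right_boxInv D.1).trans ?_
    rw [left_eq_idn D.2.1, T.sideV.inv_idn]
  rw [phi_val, boxInv_boxInv, h1, ← T.idn_idn, T.ver.mul_idn (bot_eq_idn D.2.1 D.2.2)]

/-- Every `E ∈ E` is `ψ(E⁻¹)`. -/
theorem exists_psi_eq (E : T.CoreE) :
    ∃ (A : B) (hA : T.sideH.IsId (T.bot A)), T.psi A hA = E := by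
  have h0 : T.sideH.IsId (T.bot (T.boxInv E.1)) := by rw [T.bot_boxInv]; exact E.2.2.inv
  refine ⟨T.boxInv E.1, h0, Subtype.ext ?_⟩
  have h1 : T.hor.src (T.boxInv E.1) = T.sideV.idn (T.br E.1) := by
    refine (T.left_boxInv E.1).trans ?_
    rw [right_eq_idn E.2.1, T.sideV.inv_idn]
  rw [psi_val, boxInv_boxInv, h1, ← T.idn_idn, T.ver.idn_mul (top_eq_idn E.2.1 E.2.2).symm]

end surjective
end DoubleGroupoid

/-! ### The weak Hopf algebra -/

namespace DoubleGroupoid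
variable {P H V B : Type*} {T : DoubleGroupoid P H V B}

section weakHopf
variable {k : Type*} [Field k] [CharZero k] [Fintype H] [Fintype B]

/-- The weak bialgebra structure of `kT`. -/
abbrev Filling.weakBialgebra (hT : T.Filling) : WeakBialgebra k (T.Alg k) where
  comul := T.comul k
  counit := T.counit k
  coassoc := LinearMap.ext T.comul_coassoc
  rTensor_counit_comp_comul := LinearMap.ext T.counit_rTensor
  lTensor_counit_comp_comul := LinearMap.ext T.counit_lTensor
  comul_mul := hT.comul_mul
  comul_one_left := T.comul_rTensor_comul_one_eq_left
  comul_one_right := T.comul_rTensor_comul_one_eq_right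
  counit_mul_left := T.counit_mul_left
  counit_mul_right := T.counit_mul_right

section
variable (W : WeakBialgebra k (T.Alg k)) (hW : W.comul = T.comul k)
include hW

theorem counit_eq_of_comul_eq : W.counit = T.counit k := by
  refine counit_unique (Δ := T.comul k) (fun a => ?_) T.counit_lTensor
  rw [← hW]
  exact LinearMap.congr_fun W.rTensor_counit_comp_comul a

theorem weakSource_apply (a : T.Alg k) : weakSource k (T.Alg k) a =
    TensorProduct.rid k (T.Alg k) ((T.counit k).lTensor (T.Alg k)
      (((1 : T.Alg k) ⊗ₜ[k] a) * T.comul k 1)) := by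
  rw [← hW, ← counit_eq_of_comul_eq W hW]; rfl

theorem weakTarget_apply (a : T.Alg k) : weakTarget k (T.Alg k) a =
    TensorProduct.lid k (T.Alg k) ((T.counit k).rTensor (T.Alg k)
      (T.comul k 1 * (a ⊗ₜ[k] (1 : T.Alg k)))) := by
  rw [← hW, ← counit_eq_of_comul_eq W hW]; rfl

theorem mul_id_antipode_eq_weakTarget (hT : T.Filling) (a : T.Alg k) :
    LinearMap.mul' k (T.Alg k) (T.antipode.lTensor (T.Alg k) (T.comul k a)) =
      weakTarget k (T.Alg k) a := by
  suffices h : LinearMap.mul' k (T.Alg k) ∘ₗ T.antipode.lTensor (T.Alg k) ∘ₗ T.comul k =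
      weakTarget k (T.Alg k) from LinearMap.congr_fun h a
  refine T.ext_ofBox fun A => ?_
  rw [weakTarget_apply W hW]
  by_cases hA : T.sideH.IsId (T.ver.tgt A)
  · rw [T.target_ofBox k A hA]
    exact hT.mul_id_antipode A hA
  · rw [T.target_ofBox_eq_zero k A hA]
    exact mul_id_antipode_eq_zero A hA

theorem mul_antipode_id_eq_weakSource (hT : T.Filling) (a : T.Alg k) :
    LinearMap.mul' k (T.Alg k) (T.antipode.rTensor (T.Alg k) (T.comul k a)) =
      weakSource k (T.Alg k) a := by
  suffices h : LinearMap.mul' k (T.Alg k) ∘ₗ T.antipode.rTensor (T.Alg k) ∘ₗ T.comul k =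
      weakSource k (T.Alg k) from LinearMap.congr_fun h a
  refine T.ext_ofBox fun A => ?_
  rw [weakSource_apply W hW]
  by_cases hA : T.sideH.IsId (T.ver.src A)
  · rw [T.source_ofBox k A hA]
    exact hT.mul_antipode_id A hA
  · rw [T.source_ofBox_eq_zero k A hA]
    exact mul_antipode_id_eq_zero A hA

theorem range_weakSource [Fintype P] :
    ((T.coreDHom k).range : Set (T.Alg k)) = LinearMap.range (weakSource k (T.Alg k)) := by
  have h : LinearMap.range (T.coreDHom k).toLinearMap =
      LinearMap.range (weakSource k (T.Alg k)) := by
    rw [LinearMap.range_eq_map, LinearMap.range_eq_map, ← (GroupoidAlgebra.basis k T.coreD).span_eq,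
      ← (GroupoidAlgebra.basis k T.ver).span_eq, Submodule.map_span, Submodule.map_span]
    apply le_antisymm
    · rw [Submodule.span_le]
      rintro _ ⟨_, ⟨D, rfl⟩, rfl⟩
      obtain ⟨A, hA, rfl⟩ := exists_phi_eq D
      refine Submodule.subset_span ⟨T.ofBox k A, ⟨A, rfl⟩, ?_⟩
      rw [weakSource_apply W hW, T.source_ofBox k A hA]
      exact (T.coreDHom_of k _).symm
    · rw [Submodule.span_le]
      rintro _ ⟨_, ⟨A, rfl⟩, rfl⟩
      change weakSource k (T.Alg k) (T.ofBox k A) ∈ _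
      rw [weakSource_apply W hW]
      by_cases hA : T.sideH.IsId (T.ver.src A)
      · rw [T.source_ofBox k A hA, ← T.coreDHom_of]
        exact Submodule.subset_span ⟨_, ⟨_, rfl⟩, rfl⟩
      · rw [T.source_ofBox_eq_zero k A hA]
        exact zero_mem _
  rw [← h]
  rfl

theorem range_weakTarget [Fintype P] :
    ((T.coreEHom k).range : Set (T.Alg k)) = LinearMap.range (weakTarget k (T.Alg k)) := by
  have h : LinearMap.range (T.coreEHom k).toLinearMap =
      LinearMap.range (weakTarget k (T.Alg k)) := by
    rw [LinearMap.range_eq_map, LinearMap.range_eq_map,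
      ← ((GroupoidAlgebra.basis k T.coreE).map (MulOpposite.opLinearEquiv k)).span_eq,
      ← (GroupoidAlgebra.basis k T.ver).span_eq, Submodule.map_span, Submodule.map_span]
    apply le_antisymm
    · rw [Submodule.span_le]
      rintro _ ⟨_, ⟨E, rfl⟩, rfl⟩
      obtain ⟨A, hA, rfl⟩ := exists_psi_eq E
      have e : weakTarget k (T.Alg k) (T.ofBox k A) =
          ((T.boxTL A : k) / (T.boxBL A : k)) • T.oneE k (T.psi A hA) := by
        rw [weakTarget_apply W hW, T.target_ofBox k A hA]
      have h0 : (T.boxTL A : k) / (T.boxBL A : k) ≠ 0 := by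
        rw [boxTL_eq_theta, boxBL_eq_theta]
        exact div_ne_zero (T.cast_theta_ne_zero k _) (T.cast_theta_ne_zero k _)
      have e' : T.oneE k (T.psi A hA) = ((T.boxTL A : k) / (T.boxBL A : k))⁻¹ •
          weakTarget k (T.Alg k) (T.ofBox k A) := by
        rw [e, inv_smul_smul₀ h0]
      have e'' : T.oneE k (T.psi A hA) ∈ Submodule.span k (weakTarget k (T.Alg k) ''
          Set.range (GroupoidAlgebra.basis k T.ver)) := by
        rw [e']
        exact Submodule.smul_mem _ _ (Submodule.subset_span ⟨T.ofBox k A, ⟨A, rfl⟩, rfl⟩)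
      exact (T.coreEHom_op_of k (T.psi A hA)).symm ▸ e''
    · rw [Submodule.span_le]
      rintro _ ⟨_, ⟨A, rfl⟩, rfl⟩
      change weakTarget k (T.Alg k) (T.ofBox k A) ∈ _
      rw [weakTarget_apply W hW]
      by_cases hA : T.sideH.IsId (T.ver.tgt A)
      · rw [T.target_ofBox k A hA, ← T.coreEHom_op_of]
        exact Submodule.smul_mem _ _ (Submodule.subset_span ⟨_, ⟨_, rfl⟩, rfl⟩)
      · rw [T.target_ofBox_eq_zero k A hA]
        exact zero_mem _
  rw [← h]
  rfl

end

/-- The weak Hopf algebra structure of `kT`. -/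
abbrev Filling.weakHopfAlgebra (hT : T.Filling) : WeakHopfAlgebra k (T.Alg k) where
  toWeakBialgebra := hT.weakBialgebra
  antipode := T.antipode
  mul_id_antipode := mul_id_antipode_eq_weakTarget hT.weakBialgebra rfl hT
  mul_antipode_id := mul_antipode_id_eq_weakSource hT.weakBialgebra rfl hT
  mul_antipode_id_antipode a := by
    refine Eq.trans ?_ (hT.antipode_id_antipode a)
    exact (convolution_convolution_apply _ _ _ _ _).symm

theorem antipode_eq_of_comul_eq (hT : T.Filling) (W : WeakHopfAlgebra k (T.Alg k))
    (hW : W.comul = T.comul k) : W.antipode = T.antipode := by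
  refine antipode_unique (Δ := T.comul k) T.comul_coassoc ?_ ?_ ?_ ?_
  · ext a
    refine Eq.trans ?_ (mul_antipode_id_eq_weakSource W.toWeakBialgebra hW hT a).symm
    rw [← W.mul_antipode_id, hW]
    rfl
  · ext a
    refine Eq.trans ?_ (mul_id_antipode_eq_weakTarget W.toWeakBialgebra hW hT a).symm
    rw [← W.mul_id_antipode, hW]
    rfl
  · ext a
    rw [convolution_convolution_apply, ← hW]
    exact W.mul_antipode_id_antipode a
  · ext a
    exact hT.antipode_id_antipode a

end weakHopf
end DoubleGroupoid

end

theorem mainTheorem1 {k : Type*} [Field k] [CharZero k] {P H V B : Type*}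
    [Fintype P] [Fintype H] [Fintype B] (T : DoubleGroupoid P H V B) (hT : T.Filling) :
    (∃ W : WeakHopfAlgebra k (T.Alg k), W.comul = T.comul k) ∧
    ∀ W : WeakHopfAlgebra k (T.Alg k), W.comul = T.comul k →
      W.counit = T.counit k ∧
      (∀ A : B, W.antipode (T.ofBox k A) =
        ((T.boxTL A : k) / (T.boxBL A : k)) • T.ofBox k (T.boxInv A)) ∧
      (∀ A : B, (∀ hA : T.sideH.IsId (T.top A),
          weakSource k (T.Alg k) (T.ofBox k A) = T.oneD k (T.phi A hA)) ∧
        (¬ T.sideH.IsId (T.top A) → weakSource k (T.Alg k) (T.ofBox k A) = 0)) ∧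
      (∀ A : B, (∀ hA : T.sideH.IsId (T.bot A),
          weakTarget k (T.Alg k) (T.ofBox k A) =
            ((T.boxTL A : k) / (T.boxBL A : k)) • T.oneE k (T.psi A hA)) ∧
        (¬ T.sideH.IsId (T.bot A) → weakTarget k (T.Alg k) (T.ofBox k A) = 0)) ∧
      (∃ Hs : Subalgebra k (T.Alg k),
        (Hs : Set (T.Alg k)) = LinearMap.range (weakSource k (T.Alg k)) ∧
        Nonempty (GroupoidAlgebra k T.coreD ≃ₐ[k] Hs)) ∧
      (∃ Ht : Subalgebra k (T.Alg k),
        (Ht : Set (T.Alg k)) = LinearMap.range (weakTarget k (T.Alg k)) ∧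
        Nonempty ((GroupoidAlgebra k T.coreE)ᵐᵒᵖ ≃ₐ[k] Ht)) := by
  refine ⟨⟨hT.weakHopfAlgebra, rfl⟩, fun W hW => ?_⟩
  have hS := DoubleGroupoid.weakSource_apply W.toWeakBialgebra hW
  have hR := DoubleGroupoid.weakTarget_apply W.toWeakBialgebra hW
  refine ⟨DoubleGroupoid.counit_eq_of_comul_eq W.toWeakBialgebra hW, fun A => ?_,
    fun A => ⟨fun hA => ?_, fun hA => ?_⟩, fun A => ⟨fun hA => ?_, fun hA => ?_⟩,
    ⟨(T.coreDHom k).range, DoubleGroupoid.range_weakSource W.toWeakBialgebra hW,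
      ⟨AlgEquiv.ofInjective _ (T.coreDHom_injective k)⟩⟩,
    ⟨(T.coreEHom k).range, DoubleGroupoid.range_weakTarget W.toWeakBialgebra hW,
      ⟨AlgEquiv.ofInjective _ (T.coreEHom_injective k)⟩⟩⟩
  · rw [DoubleGroupoid.antipode_eq_of_comul_eq hT W hW, T.antipode_ofBox]
  · rw [hS, T.source_ofBox k A hA]
  · rw [hS, T.source_ofBox_eq_zero k A hA]
  · rw [hR, T.target_ofBox k A hA]
  · rw [hR, T.target_ofBox_eq_zero k A hA]
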